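/- All powers, square roots and logarithms are principal, and $\operatorname{erfc}(z)=\frac{2}{\sqrt\pi}\int_z^{+\infty}e^{-t^2}\,dt$. For $\operatorname{Re}N_0,\operatorname{Re}N_1>0$ and $|\arg\beta|<\pi$ define $$I(\beta)=\frac{\Gamma(N_0+1)\Gamma(N_1+1)}{\Gamma(N_0+N_1+2)}\;{}_2F_1\!\left(1,N_0+1;N_0+N_1+2;1+\beta\right),$$ where ${}_2F_1$ has its principal value for $\operatorname{Im}\beta>0$ and is continued analytically in $\beta$ to the whole sector $|\arg\beta|<\pi$ (across $\beta>0$). Put $s^*=N_1/N_0$. For $s^*\in\mathbb C\setminus(-\infty,0]$ there is an analytic function $\gamma$ on $|\arg\beta|<\pi$ such that $$\tfrac12\gamma^2(\beta)=\Big(1+\frac1{s^*}\Big)\ln\frac{1+s^*}{1+\beta}-\ln\frac{s^*}{\beta},\qquad \gamma(s^*e^{i\nu})\sim\frac{\nu}{\sqrt{1+s^*}}\quad(\nu\to0),$$ where $\ln\frac ab$ stands for $\ln a-\ln b$. Let $$g(0,\beta)=\frac{(1+s^*)^{-1/2}}{1-\beta/s^*}-\frac{i}{(1+\beta)\gamma(\beta)}\quad(\beta\ne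 s^*),\qquad g(0,s^*)=\frac{1-s^*}{3(1+s^*)^{3/2}}.$$ Then $$I(\beta)\sim\frac{\beta^{N_1}}{(1+\beta)^{N_0+N_1+1}}\,\pi i\,\operatorname{erfc}\!\Big(\gamma(\beta)\sqrt{\tfrac12N_1}\Big)+g(0,\beta)\,\frac{N_0^{N_0}N_1^{N_1}}{(N_0+N_1)^{N_0+N_1}}\sqrt{\frac{2\pi}{N_1}}$$ as $\operatorname{Re}N_0,\operatorname{Re}N_1\to+\infty$, uniformly as long as $\beta$, $s^*$ and their reciprocals are bounded and $|\arg\beta|\le\pi-\delta$, $|\arg s^*|\le\pi-\delta$ with $\delta>0$ fixed. Here $\sim$ means that the difference of the two sides is $o(1)$ times $\frac{N_0^{N_0}N_1^{N_1}}{(N_0+N_1)^{N_0+N_1}}\sqrt{\frac{2\pi}{N_1}}$: for all $\delta,K,\varepsilon>0$ there is $R>0$ such that the modulus of the difference is at most $\varepsilon\left|\frac{N_0^{N_0}N_1^{N_1}}{(N_0+N_1)^{N_0+N_1}}\sqrt{\frac{2\pi}{N_1}}\right|$ whenever $\operatorname{Re}N_0,\operatorname{Re}N_1\ge R$, $K^{-1}\le|\beta|,|s^*|\le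 K$ and $|\arg\beta|,|\arg s^*|\le\pi-\delta$. -/

import Mathlib

open Complex Set Filter Topology MeasureTheory

noncomputable section

/-- The complementary error function of a complex argument,
`erfc z = (2/√π) ∫_z^{+∞} e^{-t²} dt`, the path being the horizontal half-line `t = z + x`, `x > 0`. -/
def erfc (z : ℂ) : ℂ :=
  2 / (Real.sqrt Real.pi : ℂ) * ∫ x in Ioi (0 : ℝ), exp (-(z + (x : ℂ)) ^ 2)

/-- `F` is the branch of Gauss's hypergeometric function `₂F₁(a, b; c; ·)` on `ℂ ∖ (-∞, 1]`
obtained from the power series by analytic continuation out of the upper half of the unit disc.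
(The domain is connected, so there is at most one such function on it.)
In the upper half-plane this is the principal branch; the continuation to the lower half-plane
is the one across the half-line `(1, +∞)`. -/
def IsHypergeometricBranch (a b c : ℂ) (F : ℂ → ℂ) : Prop :=
  DifferentiableOn ℂ F {z | z - 1 ∈ slitPlane} ∧
    ∀ z : ℂ, ‖z‖ < 1 → 0 < z.im → F z = ordinaryHypergeometric a b c z

/-- The branch of `₂F₁(a, b; c; ·)` described by `IsHypergeometricBranch`. -/
def hypergeometricBranch (a b c : ℂ) : ℂ → ℂ :=
  Classical.epsilon (IsHypergeometricBranch a b c)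

/-- `I(β) = Γ(N₀+1) Γ(N₁+1) / Γ(N₀+N₁+2) · ₂F₁(1, N₀+1; N₀+N₁+2; 1+β)` for `|arg β| < π`. -/
def hypergeometricI (N₀ N₁ β : ℂ) : ℂ :=
  Gamma (N₀ + 1) * Gamma (N₁ + 1) / Gamma (N₀ + N₁ + 2) *
    hypergeometricBranch 1 (N₀ + 1) (N₀ + N₁ + 2) (1 + β)

/-- `γ` is the analytic function on `|arg β| < π` with
`½ γ(β)² = (1 + 1/s) ln((1+s)/(1+β)) - ln(s/β)` (the logarithms of the quotients being
differences of principal logarithms, hence analytic in `β`),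
and with the sign fixed by `γ(s e^{iν}) ∼ ν / √(1+s)` as `ν → 0`. -/
def IsGammaBranch (s : ℂ) (γ : ℂ → ℂ) : Prop :=
  DifferentiableOn ℂ γ slitPlane ∧
    (∀ β ∈ slitPlane, (1 / 2 : ℂ) * γ β ^ 2 =
      (1 + 1 / s) * (log (1 + s) - log (1 + β)) - (log s - log β)) ∧
    Tendsto (fun ν : ℂ => γ (s * exp (I * ν)) / ν) (𝓝[≠] 0) (𝓝 ((1 + s) ^ (-(1 / 2) : ℂ)))

/-- The function `γ(β)` described by `IsGammaBranch`, for the parameter `s = s^*`. -/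
def gammaBranch (s : ℂ) : ℂ → ℂ :=
  Classical.epsilon (IsGammaBranch s)

/-- `g(0, β)`, with its limiting value at the removable singularity `β = s`. -/
def gZero (s β : ℂ) : ℂ :=
  open Classical in
  if β = s then (1 - s) / (3 * (1 + s) ^ (3 / 2 : ℂ))
  else (1 + s) ^ (-(1 / 2) : ℂ) / (1 - β / s) - I / ((1 + β) * gammaBranch s β)

/-- The term `β^{N₁} (1+β)^{-N₀-N₁-1} · πi · erfc(γ(β) √(N₁/2))`, with `s^* = N₁/N₀`. -/
def erfcTerm (N₀ N₁ β : ℂ) : ℂ :=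
  β ^ N₁ / (1 + β) ^ (N₀ + N₁ + 1) *
    ((Real.pi : ℂ) * I * erfc (gammaBranch (N₁ / N₀) β * (N₁ / 2) ^ (1 / 2 : ℂ)))

/-- The factor `N₀^{N₀} N₁^{N₁} (N₀+N₁)^{-N₀-N₁} · √(2π/N₁)`. -/
def saddleFactor (N₀ N₁ : ℂ) : ℂ :=
  N₀ ^ N₀ * N₁ ^ N₁ / (N₀ + N₁) ^ (N₀ + N₁) * (2 * (Real.pi : ℂ) / N₁) ^ (1 / 2 : ℂ)

end

/-! Write `β = e^b`, `s^* = e^{p₀}`, and let `φ = phase N₀ N₁`, `σ = logistic`. The substitution `t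
= 1/(1+e^x)` turns Euler's integral for `I(β)` into the integral of `e^{φ(p)} σ(p)/(e^p - e^b)`
along a horizontal line of the strip `|Im p| < π` running below `b`; pushing the line down continues
`I` to the whole sector. The only critical point of `φ` in the strip is `p₀`, and `φ(p₀) - φ(p)` is
`N₀ + N₁` times the gap between `softplus` and its tangent at `p₀`.

Two global facts about `softplus` carry the proof. The tangent gap vanishes only at `p₀`
(`tangentGap_ne_zero`), so it has a holomorphic square root `u = saddleCoord p₀` on the whole strip,
normalized by `u'(p₀) = 1`; up to a constant factor, `γ(β)` is `u(b)`. Moreover `u` is injective on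
the whole strip (`saddleCoord_injOn`). Hence `u'(p)/(u(p) - u(b))` has its only pole at `b`, with
residue one, exactly like `(1+e^b) σ(p)/(e^p - e^b)`.

The first of these kernels integrates exactly to the error function term: in the coordinate `Z ∝ u`
it is the Cauchy transform of a Gaussian (`exp_phase_mul_erfc_eq`). The difference of the kernels is
holomorphic, so its line of integration can be moved to the saddle (`hypergeometricI_sub_erfc`),
where Laplace's method gives the second term, its coefficient being the value of the difference at
`p₀`.

Uniformity has three sources. On the horizontal line through `p₀` the real part of `φ(p₀) - φ(p₀+x)`
is at least `2 log cosh(x/2)` as soon as both parameters have real part at least one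
(`re_phase_sub_ge`), so that line always serves as a contour. For `b` at distance at least `ρ` from
`p₀`, one integration by parts bounds the Laplace remainder by a constant over `|N₀N₁/(N₀+N₁)|`
(`exists_laplace_remainder`). For `b` near `p₀` the normalized error is holomorphic in `b`, and the
maximum principle carries the bound inwards (`exists_uniformRemainder_le`). The error has order
`1/|N₁|`, against `|N₁|^{-1/2}` for the saddle factor. -/

noncomputable section

/-! ### The strip `|Im p| < π` and the functions `softplus` and `logistic` on it. -/

/-- The open strip `|Im p| < π`, the domain of the variable `p = log s`. -/
def logStrip : Set ℂ := {p | |p.im| < Real.pi}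

/-- The function `log (1 + e^p)`. -/
def softplus (p : ℂ) : ℂ := log (1 + exp p)

/-- The logistic function `e^p / (1 + e^p)`, the derivative of `softplus`. -/
def logistic (p : ℂ) : ℂ := exp p / (1 + exp p)

theorem mem_logStrip {p : ℂ} : p ∈ logStrip ↔ |p.im| < Real.pi := Iff.rfl

theorem isOpen_logStrip : IsOpen logStrip :=
  isOpen_lt (continuous_abs.comp continuous_im) continuous_const

theorem convex_logStrip : Convex ℝ logStrip := by
  have : logStrip = imCLM ⁻¹' (Ioo (-Real.pi) Real.pi) := by
    ext p; simp [logStrip, abs_lt]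
  rw [this]
  exact (convex_Ioo _ _).is_linear_preimage imCLM.toLinearMap.isLinear

theorem zero_mem_logStrip : (0 : ℂ) ∈ logStrip := by
  simp [logStrip, Real.pi_pos]

theorem neg_mem_logStrip {p : ℂ} (hp : p ∈ logStrip) : -p ∈ logStrip := by
  simpa [logStrip] using hp

theorem conj_mem_logStrip {p : ℂ} (hp : p ∈ logStrip) : (starRingEnd ℂ) p ∈ logStrip := by
  simpa [logStrip] using hp

theorem log_exp_of_mem_logStrip {p : ℂ} (hp : p ∈ logStrip) : log (exp p) = p :=
  log_exp (abs_lt.1 hp).1 (abs_lt.1 hp).2.le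

theorem log_mem_logStrip {s : ℂ} (hs : s ∈ slitPlane) : log s ∈ logStrip := by
  rw [mem_slitPlane_iff_arg] at hs
  rw [mem_logStrip, log_im, abs_lt]
  exact ⟨neg_pi_lt_arg s, lt_of_le_of_ne (arg_le_pi s) hs.1⟩

theorem exp_injOn_logStrip : InjOn exp logStrip := fun p hp q hq h => by
  rw [← log_exp_of_mem_logStrip hp, ← log_exp_of_mem_logStrip hq, h]

theorem exp_mem_slitPlane_of_mem {p : ℂ} (hp : p ∈ logStrip) : exp p ∈ slitPlane := by
  rw [mem_slitPlane_iff_arg, ← log_im, log_exp_of_mem_logStrip hp]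
  exact ⟨((abs_lt.1 hp).2).ne, exp_ne_zero p⟩

theorem one_add_mem_slitPlane {s : ℂ} (hs : s ∈ slitPlane) : 1 + s ∈ slitPlane := by
  rw [mem_slitPlane_iff] at hs ⊢
  rcases hs with h | h
  · left; simp; linarith
  · right; simpa using h

theorem one_add_exp_mem_slitPlane {p : ℂ} (hp : p ∈ logStrip) : 1 + exp p ∈ slitPlane :=
  one_add_mem_slitPlane (exp_mem_slitPlane_of_mem hp)

theorem one_add_exp_ne_zero {p : ℂ} (hp : p ∈ logStrip) : 1 + exp p ≠ 0 :=
  slitPlane_ne_zero (one_add_exp_mem_slitPlane hp)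

theorem exp_softplus {p : ℂ} (hp : p ∈ logStrip) : exp (softplus p) = 1 + exp p :=
  exp_log (one_add_exp_ne_zero hp)

theorem softplus_mem_logStrip {p : ℂ} (hp : p ∈ logStrip) : softplus p ∈ logStrip :=
  log_mem_logStrip (one_add_exp_mem_slitPlane hp)

theorem hasDerivAt_softplus {p : ℂ} (hp : p ∈ logStrip) :
    HasDerivAt softplus (logistic p) p := by
  have := ((hasDerivAt_exp p).const_add 1).clog (one_add_exp_mem_slitPlane hp)
  exact this

theorem hasDerivAt_logistic {p : ℂ} (hp : p ∈ logStrip) :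
    HasDerivAt logistic (exp p / (1 + exp p) ^ 2) p := by
  have := (hasDerivAt_exp p).div ((hasDerivAt_exp p).const_add 1) (one_add_exp_ne_zero hp)
  exact this.congr_deriv (by ring)

theorem one_sub_logistic {p : ℂ} (hp : p ∈ logStrip) : 1 - logistic p = 1 / (1 + exp p) := by
  have := one_add_exp_ne_zero hp
  rw [logistic]; field_simp; ring

theorem logistic_ne_zero {p : ℂ} (hp : p ∈ logStrip) : logistic p ≠ 0 :=
  div_ne_zero (exp_ne_zero p) (one_add_exp_ne_zero hp)

theorem one_sub_logistic_ne_zero {p : ℂ} (hp : p ∈ logStrip) : 1 - logistic p ≠ 0 := by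
  rw [one_sub_logistic hp]; exact one_div_ne_zero (one_add_exp_ne_zero hp)

theorem logistic_div_one_sub {p : ℂ} (hp : p ∈ logStrip) :
    logistic p / (1 - logistic p) = exp p := by
  have := one_add_exp_ne_zero hp
  rw [one_sub_logistic hp, logistic]; field_simp

theorem logistic_sub_logistic {p q : ℂ} (hp : p ∈ logStrip) (hq : q ∈ logStrip) :
    logistic p - logistic q = (exp p - exp q) / ((1 + exp p) * (1 + exp q)) := by
  have := one_add_exp_ne_zero hp
  have := one_add_exp_ne_zero hq
  rw [logistic, logistic]; field_simp; ring

theorem logistic_injOn : InjOn logistic logStrip := fun p hp q hq h => by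
  apply exp_injOn_logStrip hp hq
  rw [← logistic_div_one_sub hp, ← logistic_div_one_sub hq, h]

theorem logistic_im {p : ℂ} :
    (logistic p).im = Real.exp p.re * Real.sin p.im / normSq (1 + exp p) := by
  rw [logistic, div_im]
  simp only [add_im, add_re, one_im, one_re, exp_im, exp_re]
  ring

theorem logistic_im_pos {p : ℂ} (h0 : 0 < p.im) (h1 : p.im < Real.pi) : 0 < (logistic p).im := by
  have hp : p ∈ logStrip := by rw [mem_logStrip, abs_lt]; constructor <;> linarith
  rw [logistic_im]
  exact div_pos (mul_pos (Real.exp_pos _) (Real.sin_pos_of_pos_of_lt_pi h0 h1))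
    (normSq_pos.2 (one_add_exp_ne_zero hp))

theorem softplus_im_pos {p : ℂ} (h0 : 0 < p.im) (h1 : p.im < Real.pi) : 0 < (softplus p).im := by
  rw [softplus, log_im, ← not_le]
  intro h
  have h2 : 0 < (1 + exp p).im := by
    simp only [add_im, one_im, exp_im, zero_add]
    exact mul_pos (Real.exp_pos _) (Real.sin_pos_of_pos_of_lt_pi h0 h1)
  rcases h.lt_or_eq with h | h
  · exact absurd (arg_neg_iff.1 h) (not_lt.2 h2.le)
  · exact h2.ne' (arg_eq_zero_iff.1 h).2

theorem exp_sub_softplus {p : ℂ} (hp : p ∈ logStrip) : exp (p - softplus p) = logistic p := by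
  rw [exp_sub, exp_softplus hp, logistic]

/-- `p - softplus p` is a logarithm of `logistic p`, which lies in the upper half-plane. An
imaginary part in `(-π, 0]` would give it a nonpositive sine. -/
theorem softplus_im_lt {p : ℂ} (h0 : 0 < p.im) (h1 : p.im < Real.pi) :
    (softplus p).im < p.im := by
  have hp : p ∈ logStrip := by rw [mem_logStrip, abs_lt]; constructor <;> linarith
  by_contra! h
  have h2 := logistic_im_pos h0 h1
  rw [← exp_sub_softplus hp, exp_im] at h2
  have h3 := (abs_lt.1 (mem_logStrip.1 (softplus_mem_logStrip hp))).2
  have h4 : Real.sin (p - softplus p).im ≤ 0 := by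
    apply Real.sin_nonpos_of_nonpos_of_neg_pi_le <;> simp <;> linarith
  exact absurd h2 (not_lt.2 (mul_nonpos_of_nonneg_of_nonpos (Real.exp_pos _).le h4))

theorem softplus_conj {p : ℂ} (hp : p ∈ logStrip) :
    softplus ((starRingEnd ℂ) p) = (starRingEnd ℂ) (softplus p) := by
  rw [softplus, softplus, exp_conj, ← log_conj]
  · simp
  · exact (mem_slitPlane_iff_arg.1 (one_add_exp_mem_slitPlane hp)).1

theorem softplus_im_of_im_zero {p : ℂ} (h : p.im = 0) : (softplus p).im = 0 := by
  rw [softplus, log_im, arg_eq_zero_iff]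
  constructor
  · simp [exp_re, h]; positivity
  · simp [exp_im, h]

/-- Makes `p - softplus p` the principal logarithm of `logistic p`, just as `softplus p` is that of
`1 + e^p`. -/
theorem sub_softplus_mem_logStrip {p : ℂ} (hp : p ∈ logStrip) : p - softplus p ∈ logStrip := by
  have key : ∀ q ∈ logStrip, 0 < q.im → q - softplus q ∈ logStrip := fun q hq h => by
    have h1 := (abs_lt.1 (mem_logStrip.1 hq)).2
    have := softplus_im_lt h h1
    have := softplus_im_pos h h1
    rw [mem_logStrip, sub_im, abs_lt]; constructor <;> linarith
  rcases lt_trichotomy p.im 0 with h | h | h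
  · have := key _ (conj_mem_logStrip hp) (by simpa using h)
    rw [softplus_conj hp, ← map_sub] at this
    simpa using conj_mem_logStrip this
  · rw [mem_logStrip, sub_im, h, softplus_im_of_im_zero h]; simp [Real.pi_pos]
  · exact key p hp h

theorem softplus_neg {p : ℂ} (hp : p ∈ logStrip) : softplus (-p) = softplus p - p := by
  have h := neg_mem_logStrip (sub_softplus_mem_logStrip hp)
  rw [neg_sub] at h
  apply exp_injOn_logStrip (softplus_mem_logStrip (neg_mem_logStrip hp)) h
  rw [exp_softplus (neg_mem_logStrip hp), exp_sub, exp_softplus hp, exp_neg]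
  have := exp_ne_zero p
  field_simp; ring

end

/-! ### Injectivity of `(e^X - 1)/X` and the zeros of the tangent gap. -/

noncomputable section

/-- The divided difference `(e^X - 1) / X`. -/
def expQuot (X : ℂ) : ℂ := (exp X - 1) / X

/-- A branch of `log ((e^X - 1) / X)` on `0 < Im X < 2π`. -/
def logExpQuot (X : ℂ) : ℂ := softplus (X - Real.pi * I) - log (-X)

theorem sub_pi_mul_I_mem {X : ℂ} (h0 : 0 < X.im) (h1 : X.im < 2 * Real.pi) :
    X - Real.pi * I ∈ logStrip := by
  rw [mem_logStrip, abs_lt]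
  constructor <;> simp <;> linarith

/-- The branch comes from `(e^X - 1)/X = (1 + e^{X - πi})/(-X)`: both factors avoid the negative
axis when `0 < Im X < 2π`. -/
theorem exp_logExpQuot {X : ℂ} (h0 : 0 < X.im) (h1 : X.im < 2 * Real.pi) :
    exp (logExpQuot X) = expQuot X := by
  have hX : -X ≠ 0 := by
    intro h; have := congrArg im h; simp at this; linarith
  rw [logExpQuot, exp_sub, exp_softplus (sub_pi_mul_I_mem h0 h1), exp_log hX, exp_sub_pi_mul_I,
    expQuot, ← neg_div_neg_eq]
  congr 1 <;> ring

theorem neg_mem_slitPlane_of_im_pos {X : ℂ} (h0 : 0 < X.im) : -X ∈ slitPlane := by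
  rw [mem_slitPlane_iff]; right; simp; linarith

theorem hasDerivAt_logExpQuot {X : ℂ} (h0 : 0 < X.im) (h1 : X.im < 2 * Real.pi) :
    HasDerivAt logExpQuot (logistic (X - Real.pi * I) - 1 / X) X := by
  have a := (hasDerivAt_softplus (sub_pi_mul_I_mem h0 h1)).comp X
    ((hasDerivAt_id X).sub_const (Real.pi * I))
  have b := (hasDerivAt_neg X).clog (neg_mem_slitPlane_of_im_pos h0)
  exact (a.sub b).congr_deriv (by simp [neg_div_neg_eq])

theorem one_add_sq_half_le_cosh (x : ℝ) : 1 + x ^ 2 / 2 ≤ Real.cosh x := by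
  have h := Real.cosh_sq (x / 2)
  have h2 := Real.cosh_two_mul (x / 2)
  have h3 : (x / 2) ^ 2 ≤ Real.sinh (x / 2) ^ 2 := by
    rw [sq_le_sq, Real.abs_sinh]
    exact Real.self_le_sinh_iff.2 (abs_nonneg _)
  rw [show 2 * (x / 2) = x by ring] at h2
  nlinarith

theorem mul_cos_lt_sin {y : ℝ} (h0 : 0 < y) (h1 : y < Real.pi) : y * Real.cos y < Real.sin y := by
  have hs := Real.sin_pos_of_pos_of_lt_pi h0 h1
  rcases lt_or_ge y (Real.pi / 2) with h | h
  · have hc := Real.cos_pos_of_mem_Ioo (x := y) ⟨by linarith, h⟩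
    have := Real.lt_tan h0 h
    rwa [Real.tan_eq_sin_div_cos, lt_div_iff₀ hc] at this
  · have hc := Real.cos_nonpos_of_pi_div_two_le_of_le h (by linarith)
    nlinarith

/-- This is the positivity of the imaginary part of the derivative of `logExpQuot` after clearing
denominators. For `y < π` the bound `cosh x ≥ 1 + x²/2` splits it into `sin y ≤ y` (the coefficient
of `x²`) and `y sin y < 2 - 2 cos y`, which is `h cos h < sin h` at `h = y/2`. For `y ≥ π` the left
side is nonpositive and the right side positive. -/
theorem sq_mul_sin_lt {x y : ℝ} (h0 : 0 < y) (h1 : y < 2 * Real.pi) :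
    (x ^ 2 + y ^ 2) * Real.sin y < y * (2 * Real.cosh x - 2 * Real.cos y) := by
  have hc := one_add_sq_half_le_cosh x
  have hc1 := Real.cos_le_one y
  rcases lt_or_ge y Real.pi with h | h
  · have hs := Real.sin_pos_of_pos_of_lt_pi h0 h
    have h3 := mul_cos_lt_sin (y := y / 2) (by linarith) (by linarith)
    have hs2 := Real.sin_pos_of_pos_of_lt_pi (x := y / 2) (by linarith) (by linarith)
    have e1 : Real.sin y = 2 * Real.sin (y / 2) * Real.cos (y / 2) := by
      rw [← Real.sin_two_mul]; congr 1; ring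
    have e2 : Real.cos y = 1 - 2 * Real.sin (y / 2) ^ 2 := by
      have := Real.cos_two_mul (y / 2)
      rw [show 2 * (y / 2) = y by ring] at this
      nlinarith [Real.sin_sq_add_cos_sq (y / 2)]
    have h4 : y * Real.sin y < 2 - 2 * Real.cos y := by rw [e1, e2]; nlinarith
    have h5 : Real.sin y ≤ y := Real.sin_le h0.le
    nlinarith [mul_le_mul_of_nonneg_left h5 (sq_nonneg x), mul_le_mul_of_nonneg_left hc h0.le,
      mul_lt_mul_of_pos_left h4 h0]
  · have hs : Real.sin y ≤ 0 := by
      have := Real.sin_nonneg_of_nonneg_of_le_pi (x := y - Real.pi) (by linarith) (by linarith)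
      rw [Real.sin_sub_pi] at this; linarith
    have hne : Real.cos y < 1 := by
      refine lt_of_le_of_ne hc1 fun h => ?_
      rw [Real.cos_eq_one_iff_of_lt_of_lt (by linarith) h1] at h
      linarith
    have : 0 < y * (2 * Real.cosh x - 2 * Real.cos y) := by
      apply mul_pos h0; nlinarith [sq_nonneg x]
    nlinarith [sq_nonneg x, sq_nonneg y,
      mul_nonneg (add_nonneg (sq_nonneg x) (sq_nonneg y)) (neg_nonneg.2 hs)]

/-- A holomorphic function on a convex domain whose derivative stays in an open half-plane is
injective; this is the half-plane condition for `logExpQuot`. -/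
theorem deriv_logExpQuot_im_pos {X : ℂ} (h0 : 0 < X.im) (h1 : X.im < 2 * Real.pi) :
    0 < (logistic (X - Real.pi * I) - 1 / X).im := by
  have hmem := sub_pi_mul_I_mem h0 h1
  have hX : X ≠ 0 := by intro h; simp [h] at h0
  have key := sq_mul_sin_lt (x := X.re) h0 h1
  have hn : 0 < normSq (1 + exp (X - Real.pi * I)) := normSq_pos.2 (one_add_exp_ne_zero hmem)
  have hnX : 0 < normSq X := normSq_pos.2 hX
  have e : normSq (1 + exp (X - Real.pi * I)) =
      Real.exp X.re * (2 * Real.cosh X.re - 2 * Real.cos X.im) := by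
    rw [exp_sub_pi_mul_I, normSq_apply]
    simp only [add_re, add_im, one_re, one_im, neg_re, neg_im, exp_re, exp_im]
    have h3 := Real.sin_sq_add_cos_sq X.im
    have h4 : Real.exp X.re * (2 * Real.cosh X.re) = Real.exp X.re ^ 2 + 1 := by
      rw [Real.cosh_eq]
      have : Real.exp X.re * Real.exp (-X.re) = 1 := by rw [← Real.exp_add]; simp
      linear_combination this
    linear_combination Real.exp X.re ^ 2 * h3 - h4
  rw [sub_im, logistic_im]
  simp only [one_div, inv_im, sub_re, sub_im, mul_re, mul_im, ofReal_re, ofReal_im, I_re, I_im]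
  simp only [mul_zero, sub_zero, mul_one, add_zero, Real.sin_sub_pi]
  have e2 : normSq X = X.re ^ 2 + X.im ^ 2 := by rw [normSq_apply]; ring
  have hE := Real.exp_pos X.re
  have : Real.exp X.re * Real.sin X.im / normSq (1 + exp (X - Real.pi * I)) < X.im / normSq X := by
    rw [div_lt_div_iff₀ hn hnX, e, e2]
    nlinarith
  have e3 : Real.exp X.re * -Real.sin X.im / normSq (1 + exp (X - Real.pi * I)) =
    -(Real.exp X.re * Real.sin X.im / normSq (1 + exp (X - Real.pi * I))) := by ring
  rw [e3, neg_div]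
  linarith

theorem logExpQuot_im (X : ℂ) :
    (logExpQuot X).im = (softplus (X - Real.pi * I)).im - arg (-X) := by
  rw [logExpQuot, sub_im, log_im]

theorem expQuot_im {X : ℂ} : (expQuot X).im =
    Real.exp X.re * (X.re * Real.sin X.im - X.im * Real.cos X.im + X.im * Real.exp (-X.re)) /
      normSq X := by
  have : Real.exp X.re * Real.exp (-X.re) = 1 := by rw [← Real.exp_add]; simp
  rw [expQuot, div_im]
  simp only [sub_im, sub_re, one_im, one_re, exp_im, exp_re]
  rw [← sub_div]
  congr 1
  linear_combination (-X.im) * this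

theorem expQuot_im_pos {X : ℂ} (h0 : 0 < X.im) (h1 : X.im < Real.pi) : 0 < (expQuot X).im := by
  have hX : X ≠ 0 := by intro h; simp [h] at h0
  rw [expQuot_im]
  apply div_pos (mul_pos (Real.exp_pos _) _) (normSq_pos.2 hX)
  set x := X.re
  set y := X.im
  have hs := Real.sin_pos_of_pos_of_lt_pi h0 h1
  have h2 := mul_cos_lt_sin h0 h1
  have h3 : Real.sin y ≤ y := Real.sin_le h0.le
  -- For fixed `y` the bracket is smallest where `e^{-x} = sin y / y`. The inequality `1 + v ≤ e^v`
  -- at `v = -x + log(y / sin y)` compares it with that minimum.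
  have h4 : Real.sin y * (1 + (-x + Real.log (y / Real.sin y))) ≤ y * Real.exp (-x) := by
    have := Real.add_one_le_exp (-x + Real.log (y / Real.sin y))
    rw [Real.exp_add, Real.exp_log (div_pos h0 hs)] at this
    calc _ ≤ Real.sin y * (Real.exp (-x) * (y / Real.sin y)) := by
          apply mul_le_mul_of_nonneg_left _ hs.le; linarith
      _ = _ := by field_simp
  have h5 : 0 ≤ Real.log (y / Real.sin y) := Real.log_nonneg (by rwa [le_div_iff₀ hs, one_mul])
  nlinarith [mul_nonneg hs.le h5]

theorem arg_neg_of_im_pos {X : ℂ} (h0 : 0 < X.im) : -Real.pi < arg (-X) ∧ arg (-X) < 0 :=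
  ⟨neg_pi_lt_arg _, arg_neg_iff.2 (by simpa using h0)⟩

/-- `(e^X - 1)/X` is the mean of `e^{tX}` over `0 ≤ t ≤ 1`, so its argument should lie between `0`
and `Im X`. This bound and `logExpQuot_im_lt` confirm it for the chosen branch, which is what
excludes coincidences modulo `2πi`. -/
theorem logExpQuot_im_pos {X : ℂ} (h0 : 0 < X.im) (h1 : X.im < 2 * Real.pi) :
    0 < (logExpQuot X).im := by
  have ha := arg_neg_of_im_pos h0
  have him : (X - Real.pi * I).im = X.im - Real.pi := by simp
  have hmem := sub_pi_mul_I_mem h0 h1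
  rcases lt_trichotomy X.im Real.pi with h | h | h
  · have h2 := (abs_lt.1 (mem_logStrip.1 (softplus_mem_logStrip hmem))).1
    have h4 := expQuot_im_pos h0 h
    rw [← exp_logExpQuot h0 h1, exp_im] at h4
    by_contra! h3
    have h6 : (softplus (X - Real.pi * I)).im < 0 := by
      have := softplus_im_pos (p := (starRingEnd ℂ) (X - Real.pi * I)) (by simp; linarith)
        (by simp; linarith)
      rw [softplus_conj hmem, conj_im] at this
      linarith
    have h5 : Real.sin (logExpQuot X).im ≤ 0 := by
      apply Real.sin_nonpos_of_nonpos_of_neg_pi_le h3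
      rw [logExpQuot_im]; linarith
    exact absurd h4 (not_lt.2 (mul_nonpos_of_nonneg_of_nonpos (Real.exp_pos _).le h5))
  · rw [logExpQuot_im, softplus_im_of_im_zero (by rw [him, h, sub_self])]; linarith
  · have := softplus_im_pos (p := X - Real.pi * I) (by linarith) (by linarith)
    rw [logExpQuot_im]; linarith

theorem conj_expQuot (X : ℂ) : (starRingEnd ℂ) (expQuot X) = expQuot ((starRingEnd ℂ) X) := by
  simp [expQuot, exp_conj]

theorem expQuot_neg (X : ℂ) : expQuot (-X) = exp (-X) * expQuot X := by
  have := exp_ne_zero X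
  by_cases hX : X = 0
  · simp [hX, expQuot]
  rw [expQuot, expQuot, exp_neg]; field_simp; ring

/-- The reflection `X ↦ -conj X` preserves `Im X`, and `expQuot (-X) = e^{-X} expQuot X`. Positivity
of the imaginary part at the reflected point therefore controls the sine of `Im (logExpQuot X - X)`.
-/
theorem logExpQuot_im_lt {X : ℂ} (h0 : 0 < X.im) (h1 : X.im < 2 * Real.pi) :
    (logExpQuot X).im < X.im := by
  have ha := arg_neg_of_im_pos h0
  have him : (X - Real.pi * I).im = X.im - Real.pi := by simp
  have hmem := sub_pi_mul_I_mem h0 h1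
  have hl := logExpQuot_im_pos h0 h1
  rcases lt_trichotomy X.im Real.pi with h | h | h
  · have h6 : (softplus (X - Real.pi * I)).im < 0 := by
      have := softplus_im_pos (p := (starRingEnd ℂ) (X - Real.pi * I)) (by simp; linarith)
        (by simp; linarith)
      rw [softplus_conj hmem, conj_im] at this
      linarith
    have h4 := expQuot_im_pos (X := -(starRingEnd ℂ) X) (by simpa using h0) (by simpa using h)
    rw [expQuot_neg, ← conj_expQuot, ← map_neg, exp_conj, ← map_mul, conj_im,
      ← exp_logExpQuot h0 h1, ← exp_add, exp_im] at h4
    by_contra! h3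
    have h5 : 0 ≤ Real.sin (-X + logExpQuot X).im := by
      apply Real.sin_nonneg_of_nonneg_of_le_pi
      · simp; linarith
      · rw [add_im, logExpQuot_im, neg_im]; linarith
    have := mul_nonneg (Real.exp_pos (-X + logExpQuot X).re).le h5
    linarith
  · rw [logExpQuot_im, softplus_im_of_im_zero (by rw [him, h, sub_self])]; linarith
  · have := softplus_im_lt (p := X - Real.pi * I) (by linarith) (by linarith)
    rw [logExpQuot_im]; linarith

theorem expQuot_ne_of_im_pos {X Y : ℂ} (hX0 : 0 < X.im) (hX1 : X.im < 2 * Real.pi)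
    (hY0 : 0 < Y.im) (hY1 : Y.im < 2 * Real.pi) (hne : X ≠ Y) : expQuot X ≠ expQuot Y := by
  intro h
  rw [← exp_logExpQuot hX0 hX1, ← exp_logExpQuot hY0 hY1, exp_eq_exp_iff_exists_int] at h
  obtain ⟨n, hn⟩ := h
  have a1 := logExpQuot_im_pos hX0 hX1
  have a2 := logExpQuot_im_lt hX0 hX1
  have a3 := logExpQuot_im_pos hY0 hY1
  have a4 := logExpQuot_im_lt hY0 hY1
  have him := congrArg im hn
  -- Both logarithms have imaginary part in `(0, 2π)`, so they cannot differ by a nonzero multiple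
  -- of `2πi`.
  have hn0 : n = 0 := by
    simp at him
    have hpi := Real.pi_pos
    have h1 : (n : ℝ) < 1 := by
      by_contra! h
      nlinarith
    have h2 : (-1 : ℝ) < n := by
      by_contra! h
      nlinarith
    have h1' : n < 1 := by exact_mod_cast h1
    have h2' : -1 < n := by exact_mod_cast h2
    omega
  rw [hn0] at hn
  simp at hn
  -- monotonicity along the segment
  let φ : ℝ → ℝ := fun t => (logExpQuot (Y + t * (X - Y)) / (X - Y)).im
  have hsub : X - Y ≠ 0 := sub_ne_zero.2 hne
  have hφ : ∀ t ∈ Icc (0 : ℝ) 1, HasDerivAt φ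
      ((logistic (Y + t * (X - Y) - Real.pi * I) - 1 / (Y + t * (X - Y))).im) t := by
    intro t ht
    have him : (Y + t * (X - Y)).im = (1 - t) * Y.im + t * X.im := by simp; ring
    have b0 : 0 < (Y + t * (X - Y)).im := by
      rw [him]
      rcases ht.1.eq_or_lt with h | h
      · rw [← h]; simpa using hY0
      · nlinarith [ht.2, mul_pos h hX0, mul_nonneg (sub_nonneg.2 ht.2) hY0.le]
    have b1 : (Y + t * (X - Y)).im < 2 * Real.pi := by
      rw [him]
      rcases ht.1.eq_or_lt with h | h
      · rw [← h]; simpa using hY1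
      · nlinarith [ht.2, mul_pos h (sub_pos.2 hX1), mul_nonneg (sub_nonneg.2 ht.2) (sub_pos.2 hY1).le]
    have c1 : HasDerivAt (fun t : ℂ => Y + t * (X - Y)) (X - Y) t := by
      simpa using ((hasDerivAt_id (t : ℂ)).mul_const (X - Y)).const_add Y
    have c2 := ((hasDerivAt_logExpQuot b0 b1).comp (t : ℂ) c1).div_const (X - Y)
    rw [mul_div_assoc, div_self hsub, mul_one] at c2
    have c3 := c2.comp_ofReal
    exact (imCLM.hasFDerivAt (x := _)).comp_hasDerivAt t c3
  have hmono : φ 0 < φ 1 := by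
    apply strictMonoOn_of_deriv_pos (convex_Icc 0 1) (f := φ)
    · exact fun t ht => (hφ t ht).continuousAt.continuousWithinAt
    · intro t ht
      rw [interior_Icc] at ht
      have ht' : t ∈ Icc (0 : ℝ) 1 := Ioo_subset_Icc_self ht
      rw [(hφ t ht').deriv]
      have him : (Y + t * (X - Y)).im = (1 - t) * Y.im + t * X.im := by simp; ring
      apply deriv_logExpQuot_im_pos
      · rw [him]; nlinarith [mul_pos ht.1 hX0, mul_pos (sub_pos.2 ht.2) hY0]
      · rw [him]; nlinarith [mul_pos ht.1 (sub_pos.2 hX1), mul_pos (sub_pos.2 ht.2) (sub_pos.2 hY1)]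
    · simp
    · simp
    · norm_num
  simp [φ, hn] at hmono

/-- The logarithm at `X` has imaginary part in `(0, Im X)`; by conjugation, the one at `Y` has
imaginary part in `(Im Y, 0)`. Their difference lies strictly between `0` and `2π`. -/
theorem expQuot_ne_of_im_pos_of_im_neg {X Y : ℂ} (hX0 : 0 < X.im) (hY0 : Y.im < 0)
    (hXY : X.im - Y.im < 2 * Real.pi) : expQuot X ≠ expQuot Y := by
  intro h
  have hY0' : 0 < ((starRingEnd ℂ) Y).im := by simpa using hY0
  have hY1' : ((starRingEnd ℂ) Y).im < 2 * Real.pi := by simp; linarith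
  have hX1 : X.im < 2 * Real.pi := by linarith
  have e : expQuot Y = exp ((starRingEnd ℂ) (logExpQuot ((starRingEnd ℂ) Y))) := by
    rw [exp_conj, exp_logExpQuot hY0' hY1', conj_expQuot, conj_conj]
  rw [e, ← exp_logExpQuot hX0 hX1, exp_eq_exp_iff_exists_int] at h
  obtain ⟨n, hn⟩ := h
  have a1 := logExpQuot_im_pos hX0 hX1
  have a2 := logExpQuot_im_lt hX0 hX1
  have a3 := logExpQuot_im_pos hY0' hY1'
  have a4 := logExpQuot_im_lt hY0' hY1'
  have him := congrArg im hn
  simp at him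
  rw [conj_im] at a4
  have hpi := Real.pi_pos
  have h1 : (n : ℝ) < 1 := by
    by_contra! h
    nlinarith
  have h2 : (0 : ℝ) < n := by
    by_contra! h
    nlinarith
  have h1' : n < 1 := by exact_mod_cast h1
  have h2' : 0 < n := by exact_mod_cast h2
  omega

theorem expQuot_re_pos_of_im_zero {X : ℂ} (hX : X.im = 0) (h0 : X ≠ 0) :
    expQuot X = ((Real.exp X.re - 1) / X.re : ℝ) ∧ 0 < (Real.exp X.re - 1) / X.re := by
  have e : X = (X.re : ℂ) := by apply Complex.ext <;> simp [hX]
  refine ⟨by rw [expQuot, e]; simp, ?_⟩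
  have hr : X.re ≠ 0 := by
    intro h; apply h0; rw [e, h]; simp
  rcases hr.lt_or_gt with h | h
  · exact div_pos_of_neg_of_neg (by have := Real.exp_lt_exp.2 h; rw [Real.exp_zero] at this; linarith) h
  · exact div_pos (by have := Real.one_lt_exp_iff.2 h; linarith) h

theorem expQuot_ne_of_im_pos_of_im_zero {X Y : ℂ} (hX0 : 0 < X.im) (hX1 : X.im < 2 * Real.pi)
    (hY : Y.im = 0) (hY0 : Y ≠ 0) : expQuot X ≠ expQuot Y := by
  intro h
  obtain ⟨e, hpos⟩ := expQuot_re_pos_of_im_zero hY hY0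
  rw [e, ← exp_logExpQuot hX0 hX1] at h
  have a1 := logExpQuot_im_pos hX0 hX1
  have a2 := logExpQuot_im_lt hX0 hX1
  rw [← Real.exp_log hpos, ofReal_exp, exp_eq_exp_iff_exists_int] at h
  obtain ⟨n, hn⟩ := h
  have him := congrArg im hn
  simp at him
  have hpi := Real.pi_pos
  have h1 : (n : ℝ) < 1 := by
    by_contra! h
    nlinarith
  have h2 : (0 : ℝ) < n := by
    by_contra! h
    nlinarith
  have h1' : n < 1 := by exact_mod_cast h1
  have h2' : 0 < n := by exact_mod_cast h2
  omega

theorem expQuot_ne_of_im_zero {X Y : ℂ} (hX : X.im = 0) (hX0 : X ≠ 0)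
    (hY : Y.im = 0) (hY0 : Y ≠ 0) (hne : X ≠ Y) : expQuot X ≠ expQuot Y := by
  intro h
  rw [(expQuot_re_pos_of_im_zero hX hX0).1, (expQuot_re_pos_of_im_zero hY hY0).1] at h
  have h := ofReal_injective h
  have hre : ∀ {Z : ℂ}, Z.im = 0 → Z ≠ 0 → Z.re ≠ 0 := fun hZ hZ0 h => hZ0 (Complex.ext h hZ)
  have aux : ∀ a b : ℝ, a ≠ 0 → b ≠ 0 → a < b →
      (Real.exp a - 1) / a ≠ (Real.exp b - 1) / b := by
    intro a b ha hb hab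
    have := strictConvexOn_exp.secant_strict_mono (a := 0) (x := a) (y := b) trivial trivial trivial
      ha hb hab
    simp at this
    exact this.ne
  rcases lt_trichotomy X.re Y.re with h1 | h1 | h1
  · exact aux _ _ (hre hX hX0) (hre hY hY0) h1 h
  · exact hne (Complex.ext h1 (hX.trans hY.symm))
  · exact aux _ _ (hre hY hY0) (hre hX hX0) h1 h.symm

/-- The function `(e^X - 1) / X` separates any two nonzero points of the strip `|Im X| < 2π`
whose imaginary parts differ by less than `2π`. -/
theorem expQuot_ne {X Y : ℂ} (hX : |X.im| < 2 * Real.pi) (hY : |Y.im| < 2 * Real.pi)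
    (hXY : |X.im - Y.im| < 2 * Real.pi) (hX0 : X ≠ 0) (hY0 : Y ≠ 0) (hne : X ≠ Y) :
    expQuot X ≠ expQuot Y := by
  have hc0 : ∀ {Z : ℂ}, Z ≠ 0 → (starRingEnd ℂ) Z ≠ 0 := fun h => by simpa using h
  have conjred : ∀ {Z W : ℂ}, expQuot ((starRingEnd ℂ) Z) ≠ expQuot ((starRingEnd ℂ) W) →
      expQuot Z ≠ expQuot W := fun h h' => h (by rw [← conj_expQuot, ← conj_expQuot, h'])
  rw [abs_lt] at hX hY hXY
  rcases lt_trichotomy X.im 0 with hx | hx | hx <;> rcases lt_trichotomy Y.im 0 with hy | hy | hy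
  · exact conjred (expQuot_ne_of_im_pos (by simpa) (by simp; linarith) (by simpa)
      (by simp; linarith) ((starRingEnd ℂ).injective.ne hne))
  · exact conjred (expQuot_ne_of_im_pos_of_im_zero (by simpa) (by simp; linarith) (by simpa)
      (hc0 hY0))
  · exact (expQuot_ne_of_im_pos_of_im_neg hy hx (by linarith)).symm
  · exact (conjred (expQuot_ne_of_im_pos_of_im_zero (by simpa) (by simp; linarith) (by simpa)
      (hc0 hX0))).symm
  · exact expQuot_ne_of_im_zero hx hX0 hy hY0 hne
  · exact (expQuot_ne_of_im_pos_of_im_zero hy hY.2 hx hX0).symm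
  · exact expQuot_ne_of_im_pos_of_im_neg hx hy (by linarith)
  · exact expQuot_ne_of_im_pos_of_im_zero hx hX.2 hy hY0
  · exact expQuot_ne_of_im_pos hx hX.2 hy hY.2 hne

/-- The remainder `log (1 + e^p)` minus its tangent at `p₀`. -/
def tangentGap (p₀ p : ℂ) : ℂ := softplus p - softplus p₀ - logistic p₀ * (p - p₀)

/-- If the gap vanished at `p ≠ p₀`, the differences `X` of the values of `-softplus` and `Y` of the
values of `p - softplus p` would be `-σ(p₀)(p - p₀)` and `(1 - σ(p₀))(p - p₀)`. Since `e^X` and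
`e^Y` are rational in `e^p` and `e^{p₀}`, this gives `expQuot X = expQuot Y`. But `X` and `Y` are
distinct and nonzero, and their imaginary parts differ by that of `p₀ - p`, so `expQuot_ne` applies.
-/
theorem tangentGap_ne_zero {p₀ p : ℂ} (h₀ : p₀ ∈ logStrip) (hp : p ∈ logStrip) (hne : p ≠ p₀) :
    tangentGap p₀ p ≠ 0 := by
  intro h
  have hl := logistic_ne_zero h₀
  have hl1 := one_sub_logistic_ne_zero h₀
  have hw : p - p₀ ≠ 0 := sub_ne_zero.2 hne
  have eX : softplus p₀ - softplus p = -(logistic p₀ * (p - p₀)) := by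
    rw [tangentGap] at h; linear_combination -h
  have eY : (p - softplus p) - (p₀ - softplus p₀) = (1 - logistic p₀) * (p - p₀) := by
    rw [tangentGap] at h; linear_combination -h
  set X := softplus p₀ - softplus p with hXdef
  set Y := (p - softplus p) - (p₀ - softplus p₀) with hYdef
  have b1 := abs_lt.1 (mem_logStrip.1 (softplus_mem_logStrip hp))
  have b2 := abs_lt.1 (mem_logStrip.1 (softplus_mem_logStrip h₀))
  have b3 := abs_lt.1 (mem_logStrip.1 (sub_softplus_mem_logStrip hp))
  have b4 := abs_lt.1 (mem_logStrip.1 (sub_softplus_mem_logStrip h₀))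
  have b5 := abs_lt.1 (mem_logStrip.1 hp)
  have b6 := abs_lt.1 (mem_logStrip.1 h₀)
  have n1 := one_add_exp_ne_zero hp
  have n2 := one_add_exp_ne_zero h₀
  have n3 := exp_ne_zero p₀
  refine expQuot_ne (X := X) (Y := Y) ?_ ?_ ?_ ?_ ?_ ?_ ?_
  · rw [hXdef, sub_im, abs_lt]; constructor <;> linarith
  · rw [hYdef, sub_im, abs_lt]; constructor <;> linarith
  · have : X.im - Y.im = p₀.im - p.im := by simp [hXdef, hYdef]; ring
    rw [this, abs_lt]; constructor <;> linarith
  · rw [eX]; exact neg_ne_zero.2 (mul_ne_zero hl hw)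
  · rw [eY]; exact mul_ne_zero hl1 hw
  · intro h
    apply hw
    have : Y - X = p - p₀ := by rw [hXdef, hYdef]; ring
    rw [← this, h, sub_self]
  · have e1 : exp X = (1 + exp p₀) / (1 + exp p) := by
      rw [hXdef, exp_sub, exp_softplus hp, exp_softplus h₀]
    have e2 : exp Y = logistic p / logistic p₀ := by
      rw [hYdef, exp_sub, exp_sub_softplus hp, exp_sub_softplus h₀]
    rw [expQuot, expQuot, e1, e2, eX, eY, one_sub_logistic h₀, logistic, logistic]
    field_simp
    ring

end

/-! ### Slopes of chords of `softplus`. -/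

noncomputable section

theorem segment_im_mem {p q : ℂ} (t : ℝ) (p' : ℂ) (h : p' = q + t * (p - q)) :
    p'.im = (1 - t) * q.im + t * p.im := by
  rw [h]; simp; ring

theorem segment_mem_logStrip {p q : ℂ} (hp : p ∈ logStrip) (hq : q ∈ logStrip) {t : ℝ}
    (ht : t ∈ Icc (0 : ℝ) 1) : q + t * (p - q) ∈ logStrip := by
  have := convex_logStrip.add_smul_sub_mem hq hp ht
  simpa using this

theorem hasDerivAt_softplus_segment {p q : ℂ} (hp : p ∈ logStrip) (hq : q ∈ logStrip) {t : ℝ}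
    (ht : t ∈ Icc (0 : ℝ) 1) :
    HasDerivAt (fun t : ℝ => softplus (q + t * (p - q))) (logistic (q + t * (p - q)) * (p - q)) t := by
  have c1 : HasDerivAt (fun t : ℂ => q + t * (p - q)) (p - q) t := by
    simpa using ((hasDerivAt_id (t : ℂ)).mul_const (p - q)).const_add q
  exact ((hasDerivAt_softplus (segment_mem_logStrip hp hq ht)).comp (t : ℂ) c1).comp_ofReal

theorem hasDerivAt_logistic_segment {p q : ℂ} (hp : p ∈ logStrip) (hq : q ∈ logStrip) {t : ℝ}
    (ht : t ∈ Icc (0 : ℝ) 1) :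
    HasDerivAt (fun t : ℝ => logistic (q + t * (p - q)))
      (exp (q + t * (p - q)) / (1 + exp (q + t * (p - q))) ^ 2 * (p - q)) t := by
  have c1 : HasDerivAt (fun t : ℂ => q + t * (p - q)) (p - q) t := by
    simpa using ((hasDerivAt_id (t : ℂ)).mul_const (p - q)).const_add q
  exact ((hasDerivAt_logistic (segment_mem_logStrip hp hq ht)).comp (t : ℂ) c1).comp_ofReal

/-- The slope is the mean of `logistic` over the segment, and `logistic` maps the upper half of the
strip into the upper half-plane. -/
theorem slope_softplus_not_real {p q : ℂ} (hp : p ∈ logStrip) (hq : q ∈ logStrip)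
    (hp0 : 0 < p.im) (hq0 : 0 < q.im) (hne : p ≠ q) (r : ℝ) :
    softplus p - softplus q ≠ r * (p - q) := by
  intro h
  have hsub : p - q ≠ 0 := sub_ne_zero.2 hne
  have hp1 := (abs_lt.1 (mem_logStrip.1 hp)).2
  have hq1 := (abs_lt.1 (mem_logStrip.1 hq)).2
  let φ : ℝ → ℝ := fun t => (softplus (q + t * (p - q)) / (p - q)).im
  have hφ : ∀ t ∈ Icc (0 : ℝ) 1, HasDerivAt φ ((logistic (q + t * (p - q))).im) t := by
    intro t ht
    have c2 := (hasDerivAt_softplus_segment hp hq ht).div_const (p - q)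
    rw [mul_div_assoc, div_self hsub, mul_one] at c2
    exact (imCLM.hasFDerivAt (x := _)).comp_hasDerivAt t c2
  have hmono : φ 0 < φ 1 := by
    apply strictMonoOn_of_deriv_pos (convex_Icc 0 1) (f := φ)
    · exact fun t ht => (hφ t ht).continuousAt.continuousWithinAt
    · intro t ht
      rw [interior_Icc] at ht
      rw [(hφ t (Ioo_subset_Icc_self ht)).deriv]
      have him := segment_im_mem (p := p) (q := q) t _ rfl
      apply logistic_im_pos
      · rw [him]; nlinarith [mul_pos ht.1 hp0, mul_pos (sub_pos.2 ht.2) hq0]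
      · rw [him]; nlinarith [mul_pos ht.1 (sub_pos.2 hp1), mul_pos (sub_pos.2 ht.2) (sub_pos.2 hq1)]
    · simp
    · simp
    · norm_num
  have h2 : softplus p / (p - q) = r + softplus q / (p - q) := by
    field_simp; linear_combination h
  simp [φ, h2] at hmono

theorem slope_softplus_im_zero {p q : ℂ} (hp : p.im = 0) (hq : q.im = 0) (hlt : q.re < p.re)
    {r : ℝ} (h : softplus p - softplus q = r * (p - q)) : 0 < r ∧ r < 1 := by
  have e : ∀ {z : ℂ}, z.im = 0 → (softplus z).re = Real.log (1 + Real.exp z.re) := by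
    intro z hz
    have e : z = (z.re : ℂ) := Complex.ext (by simp) (by simp [hz])
    rw [softplus, log_re]
    congr 1
    rw [e, ← ofReal_exp, ← ofReal_one, ← ofReal_add, norm_real, Real.norm_eq_abs, abs_of_pos]
    · simp
    · positivity
  have hre := congrArg re h
  rw [sub_re, e hp, e hq, re_ofReal_mul, sub_re] at hre
  have h1 : Real.log (1 + Real.exp q.re) < Real.log (1 + Real.exp p.re) := by
    apply Real.log_lt_log (by positivity)
    have := Real.exp_lt_exp.2 hlt
    linarith
  have h2 : Real.log (1 + Real.exp p.re) - Real.log (1 + Real.exp q.re) < p.re - q.re := by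
    rw [← Real.log_div (by positivity) (by positivity), Real.log_lt_iff_lt_exp (by positivity),
      div_lt_iff₀ (by positivity), mul_add, ← Real.exp_add, sub_add_cancel, mul_one]
    have := Real.exp_lt_exp.2 (sub_pos.2 hlt)
    rw [Real.exp_zero] at this
    linarith
  have hd : 0 < p.re - q.re := sub_pos.2 hlt
  constructor
  · by_contra! h; nlinarith
  · by_contra! h; nlinarith

theorem softplus_im_nonpos_bounds {q : ℂ} (hq : q ∈ logStrip) (h : q.im ≤ 0) :
    q.im ≤ (softplus q).im ∧ (softplus q).im ≤ 0 := by
  rcases h.lt_or_eq with h | h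
  · have hb := abs_lt.1 (mem_logStrip.1 hq)
    have h1 := softplus_im_pos (p := (starRingEnd ℂ) q) (by simpa) (by simp; linarith)
    have h2 := softplus_im_lt (p := (starRingEnd ℂ) q) (by simpa) (by simp; linarith)
    rw [softplus_conj hq, conj_im] at h1 h2
    rw [conj_im] at h2
    constructor <;> linarith
  · rw [softplus_im_of_im_zero h, h]; simp

/-- Taking imaginary parts is enough. `softplus` shrinks the positive imaginary part of `p` strictly
and does not enlarge the nonpositive one of `q`, while keeping both signs. -/
theorem slope_softplus_of_im_pos_of_im_nonpos {p q : ℂ} (hp : p ∈ logStrip) (hq : q ∈ logStrip)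
    (hp0 : 0 < p.im) (hq0 : q.im ≤ 0) {r : ℝ} (h : softplus p - softplus q = r * (p - q)) :
    0 < r ∧ r < 1 := by
  have him := congrArg im h
  rw [sub_im, im_ofReal_mul, sub_im] at him
  have hp1 := (abs_lt.1 (mem_logStrip.1 hp)).2
  have h1 := softplus_im_pos hp0 hp1
  have h2 := softplus_im_lt hp0 hp1
  obtain ⟨h3, h4⟩ := softplus_im_nonpos_bounds hq hq0
  constructor
  · by_contra! h; nlinarith
  · by_contra! h; nlinarith

theorem slope_softplus_real {p q : ℂ} (hp : p ∈ logStrip) (hq : q ∈ logStrip) (hne : p ≠ q)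
    {r : ℝ} (h : softplus p - softplus q = r * (p - q)) : 0 < r ∧ r < 1 := by
  have hsymm : softplus q - softplus p = r * (q - p) := by linear_combination -h
  have hconj : softplus ((starRingEnd ℂ) p) - softplus ((starRingEnd ℂ) q) =
      r * ((starRingEnd ℂ) p - (starRingEnd ℂ) q) := by
    rw [softplus_conj hp, softplus_conj hq, ← map_sub, h]; simp
  have hconj' : softplus ((starRingEnd ℂ) q) - softplus ((starRingEnd ℂ) p) =
      r * ((starRingEnd ℂ) q - (starRingEnd ℂ) p) := by linear_combination -hconj
  have hp' := conj_mem_logStrip hp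
  have hq' := conj_mem_logStrip hq
  rcases lt_trichotomy p.im 0 with h1 | h1 | h1 <;> rcases lt_trichotomy q.im 0 with h2 | h2 | h2
  · exact absurd hconj (slope_softplus_not_real hp' hq' (by simpa) (by simpa)
      ((starRingEnd ℂ).injective.ne hne) r)
  · exact slope_softplus_of_im_pos_of_im_nonpos hp' hq' (by simpa) (by simp [h2]) hconj
  · exact slope_softplus_of_im_pos_of_im_nonpos hq hp h2 h1.le hsymm
  · exact slope_softplus_of_im_pos_of_im_nonpos hq' hp' (by simpa) (by simp [h1]) hconj'
  · rcases lt_trichotomy p.re q.re with h3 | h3 | h3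
    · exact slope_softplus_im_zero h2 h1 h3 hsymm
    · exact absurd (Complex.ext h3 (h1.trans h2.symm)) hne
    · exact slope_softplus_im_zero h1 h2 h3 h
  · exact slope_softplus_of_im_pos_of_im_nonpos hq hp h2 h1.le hsymm
  · exact slope_softplus_of_im_pos_of_im_nonpos hp hq h1 h2.le h
  · exact slope_softplus_of_im_pos_of_im_nonpos hp hq h1 h2.le h
  · exact absurd h (slope_softplus_not_real hp hq h1 h2 hne r)

/-- The map `m ↦ m/(1 - m)` recovers `e^c` from `m = logistic c`. Its values on the cut come only
from real `m` outside `(0, 1)`, so every chord slope of `softplus` is the slope of a tangent. -/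
theorem div_one_sub_mem_slitPlane {m : ℂ} (h : m.im = 0 → 0 < m.re ∧ m.re < 1) :
    m / (1 - m) ∈ slitPlane := by
  have h1 : 1 - m ≠ 0 := by
    intro h0
    have : m = 1 := by linear_combination -h0
    have := h (by simp [this])
    simp_all
  have hn : 0 < normSq (1 - m) := normSq_pos.2 h1
  rw [mem_slitPlane_iff]
  by_cases him : m.im = 0
  · left
    obtain ⟨h2, h3⟩ := h him
    rw [div_re]
    simp only [sub_re, sub_im, one_re, one_im, him]
    simp only [sub_self, mul_zero, zero_div, add_zero]
    exact div_pos (mul_pos h2 (by linarith)) hn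
  · right
    rw [div_im, ← sub_div]
    apply div_ne_zero _ hn.ne'
    simp only [sub_re, sub_im, one_re, one_im]
    intro h; apply him; linarith

/-- The point of the strip at which the tangent of `softplus` is parallel to the chord
through two given points. -/
def chordPoint (p q : ℂ) : ℂ :=
  log ((softplus p - softplus q) / (p - q) / (1 - (softplus p - softplus q) / (p - q)))

theorem chord_mem_slitPlane {p q : ℂ} (hp : p ∈ logStrip) (hq : q ∈ logStrip) (hne : p ≠ q) :
    (softplus p - softplus q) / (p - q) / (1 - (softplus p - softplus q) / (p - q)) ∈
      slitPlane := by
  apply div_one_sub_mem_slitPlane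
  intro h
  refine slope_softplus_real hp hq hne ?_
  have hsub : p - q ≠ 0 := sub_ne_zero.2 hne
  rw [← div_eq_iff hsub]
  exact Complex.ext (by simp) (by simp [h])

theorem chordPoint_mem {p q : ℂ} (hp : p ∈ logStrip) (hq : q ∈ logStrip) (hne : p ≠ q) :
    chordPoint p q ∈ logStrip := log_mem_logStrip (chord_mem_slitPlane hp hq hne)

theorem chordPoint_eq {p q c : ℂ} (hc : c ∈ logStrip) (hne : p ≠ q)
    (h : softplus p - softplus q = logistic c * (p - q)) : chordPoint p q = c := by
  have hsub : p - q ≠ 0 := sub_ne_zero.2 hne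
  rw [chordPoint, h, mul_div_assoc, div_self hsub, mul_one, logistic_div_one_sub hc,
    log_exp_of_mem_logStrip hc]

theorem softplus_sub_eq_logistic_chordPoint {p q : ℂ} (hp : p ∈ logStrip) (hq : q ∈ logStrip)
    (hne : p ≠ q) : softplus p - softplus q = logistic (chordPoint p q) * (p - q) := by
  have hsub : p - q ≠ 0 := sub_ne_zero.2 hne
  have hm := chord_mem_slitPlane hp hq hne
  have e : exp (chordPoint p q) = _ := exp_log (slitPlane_ne_zero hm)
  rw [logistic, e]
  set m := (softplus p - softplus q) / (p - q) with hmdef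
  have h1 : 1 - m ≠ 0 := fun h => by
    rw [h, div_zero] at hm; exact slitPlane_ne_zero hm rfl
  have h2 : m = softplus p - softplus q - m * (p - q) + m := by
    rw [hmdef]; field_simp; ring
  have : softplus p - softplus q = m * (p - q) := by linear_combination -h2
  rw [this]; field_simp; ring

end

/-! ### The uniformizing coordinate at the saddle and its global injectivity. -/

noncomputable section

/-- The derivative of the logistic function. -/
def logisticDeriv (p : ℂ) : ℂ := exp p / (1 + exp p) ^ 2

theorem logisticDeriv_ne_zero {p : ℂ} (hp : p ∈ logStrip) : logisticDeriv p ≠ 0 :=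
  div_ne_zero (exp_ne_zero p) (pow_ne_zero 2 (one_add_exp_ne_zero hp))

theorem continuousOn_logisticDeriv : ContinuousOn logisticDeriv logStrip := by
  unfold logisticDeriv
  exact continuous_exp.continuousOn.div (by fun_prop)
    fun p hp => pow_ne_zero 2 (one_add_exp_ne_zero hp)

/-- The quotient of the tangent gap by its leading term `logistic' p₀ · (p - p₀)² / 2`. -/
def gapQuot (x : ℂ × ℂ) : ℂ :=
  2 * (∫ t in (0 : ℝ)..1, (1 - t) * logisticDeriv (x.1 + t * (x.2 - x.1))) / logisticDeriv x.1

/-- Taylor's formula of order two with integral remainder along the segment from `p₀` to `p`. -/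
theorem gapQuot_mul {p₀ p : ℂ} (h₀ : p₀ ∈ logStrip) (hp : p ∈ logStrip) :
    logisticDeriv p₀ / 2 * ((p - p₀) ^ 2 * gapQuot (p₀, p)) = tangentGap p₀ p := by
  have hd : ∀ t ∈ uIcc (0 : ℝ) 1, HasDerivAt
      (fun t : ℝ => (1 - t) * ((p - p₀) * logistic (p₀ + t * (p - p₀))) +
        softplus (p₀ + t * (p - p₀)))
      ((p - p₀) ^ 2 * ((1 - t) * logisticDeriv (p₀ + t * (p - p₀)))) t := by
    intro t ht
    rw [uIcc_of_le zero_le_one] at ht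
    have a := (hasDerivAt_logistic_segment hp h₀ ht).const_mul (p - p₀)
    have b := hasDerivAt_softplus_segment hp h₀ ht
    have c : HasDerivAt (fun t : ℝ => (1 : ℂ) - t) (-1) t := by
      simpa using ((hasDerivAt_id (t : ℂ)).const_sub 1).comp_ofReal
    exact ((c.mul a).add b).congr_deriv (by rw [logisticDeriv]; ring)
  have hcont : ContinuousOn (fun t : ℝ => (p - p₀) ^ 2 *
      ((1 - t) * logisticDeriv (p₀ + t * (p - p₀)))) (uIcc 0 1) := by
    refine continuousOn_const.mul (ContinuousOn.mul (by fun_prop) ?_)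
    refine continuousOn_logisticDeriv.comp (by fun_prop) fun t ht => ?_
    rw [uIcc_of_le zero_le_one] at ht
    exact segment_mem_logStrip hp h₀ ht
  have := intervalIntegral.integral_eq_sub_of_hasDerivAt hd hcont.intervalIntegrable
  rw [intervalIntegral.integral_const_mul] at this
  simp only [ofReal_one, ofReal_zero, sub_self, zero_mul, zero_add, sub_zero, one_mul, add_zero,
    add_sub_cancel] at this
  have hne := logisticDeriv_ne_zero h₀
  rw [gapQuot, tangentGap]
  simp only
  rw [show logisticDeriv p₀ / 2 * ((p - p₀) ^ 2 * (2 * (∫ t in (0 : ℝ)..1,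
    (1 - t) * logisticDeriv (p₀ + t * (p - p₀))) / logisticDeriv p₀)) = (p - p₀) ^ 2 *
    ∫ t in (0 : ℝ)..1, (1 - t) * logisticDeriv (p₀ + t * (p - p₀)) by field_simp, this]
  ring

theorem gapQuot_self {p : ℂ} (hp : p ∈ logStrip) : gapQuot (p, p) = 1 := by
  have hne := logisticDeriv_ne_zero hp
  have e : ∫ t in (0 : ℝ)..1, (1 - (t : ℂ)) = 1 / 2 := by
    have : ∫ t in (0 : ℝ)..1, (1 - t) = 1 / 2 := by
      rw [intervalIntegral.integral_sub (by simp) (by simp)]; simp; norm_num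
    have h2 : ∫ t in (0 : ℝ)..1, ((1 - t : ℝ) : ℂ) = ((1 / 2 : ℝ) : ℂ) := by
      rw [intervalIntegral.integral_ofReal, this]
    simpa using h2
  simp only [gapQuot, sub_self, mul_zero, add_zero]
  rw [intervalIntegral.integral_mul_const, e]
  field_simp

theorem gapQuot_ne_zero {x : ℂ × ℂ} (hx : x ∈ logStrip ×ˢ logStrip) : gapQuot x ≠ 0 := by
  obtain ⟨p₀, p⟩ := x
  obtain ⟨h₀, hp⟩ := hx
  by_cases h : p = p₀
  · rw [h, gapQuot_self h₀]; exact one_ne_zero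
  · intro h0
    apply tangentGap_ne_zero h₀ hp h
    rw [← gapQuot_mul h₀ hp, h0]; simp

theorem continuousOn_gapQuot : ContinuousOn gapQuot (logStrip ×ˢ logStrip) := by
  have h1 : ContinuousOn (fun x : ℂ × ℂ =>
      ∫ t in (0 : ℝ)..1, (1 - t) * logisticDeriv (x.1 + t * (x.2 - x.1)))
      (logStrip ×ˢ logStrip) := by
    rw [continuousOn_iff_continuous_domRestrict]
    have hc : Continuous (Function.uncurry fun (x : ↥(logStrip ×ˢ logStrip)) (t : ℝ) =>
        (1 - ((projIcc (0 : ℝ) 1 zero_le_one t : ℝ) : ℂ)) *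
          logisticDeriv (x.1.1 + (projIcc (0 : ℝ) 1 zero_le_one t : ℝ) * (x.1.2 - x.1.1))) := by
      have hpr : Continuous fun y : ↥(logStrip ×ˢ logStrip) × ℝ =>
          ((projIcc (0 : ℝ) 1 zero_le_one y.2 : ℝ) : ℂ) :=
        continuous_ofReal.comp (continuous_subtype_val.comp (continuous_projIcc.comp continuous_snd))
      have hc1 : Continuous fun y : ↥(logStrip ×ˢ logStrip) × ℝ => (y.1 : ℂ × ℂ) :=
        continuous_subtype_val.comp continuous_fst
      refine (continuous_const.sub hpr).mul ?_
      refine continuousOn_logisticDeriv.comp_continuous ?_ ?_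
      · exact hc1.fst.add (hpr.mul (hc1.snd.sub hc1.fst))
      · intro y
        exact segment_mem_logStrip y.1.2.2 y.1.2.1 (projIcc (0 : ℝ) 1 zero_le_one y.2).2
    have := intervalIntegral.continuous_parametric_intervalIntegral_of_continuous' hc 0 1
      (μ := volume)
    refine this.congr fun x => ?_
    refine intervalIntegral.integral_congr fun t ht => ?_
    rw [uIcc_of_le zero_le_one] at ht
    simp only [projIcc_of_mem zero_le_one ht]
  have h2 : ContinuousOn (fun x : ℂ × ℂ => logisticDeriv x.1) (logStrip ×ˢ logStrip) :=
    continuousOn_logisticDeriv.comp continuousOn_fst fun x hx => hx.1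
  exact (continuousOn_const.mul h1).div h2 fun x hx => logisticDeriv_ne_zero hx.1

/-- `gapQuot` is continuous and zero-free on a convex, hence simply connected, set. The root is
taken in both variables at once: the injectivity proof moves `p₀`, and the later uniform bounds need
joint continuity. -/
theorem exists_sqrt_gapQuot : ∃ g : ℂ × ℂ → ℂ, ContinuousOn g (logStrip ×ˢ logStrip) ∧
    (∀ x ∈ logStrip ×ˢ logStrip, g x ^ 2 = gapQuot x) ∧ ∀ p ∈ logStrip, g (p, p) = 1 := by
  have hconv : Convex ℝ (logStrip ×ˢ logStrip) := convex_logStrip.prod convex_logStrip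
  have hsc : IsSimplyConnected (logStrip ×ˢ logStrip) := by
    have := hconv.contractibleSpace ⟨(0, 0), zero_mem_logStrip, zero_mem_logStrip⟩
    exact SimplyConnectedSpace.ofContractible _
  obtain ⟨f, hfc, hf⟩ := exists_continuousOn_pow_eq hsc (isOpen_logStrip.prod isOpen_logStrip)
    continuousOn_gapQuot (by rintro ⟨x, hx, h⟩; exact gapQuot_ne_zero hx h) two_ne_zero
  have hdiag : ∀ p ∈ logStrip, f (p, p) = f (0, 0) := by
    intro p hp
    have hne : f (0, 0) ≠ 0 := fun h => gapQuot_ne_zero (x := (0, 0))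
      ⟨zero_mem_logStrip, zero_mem_logStrip⟩ (by rw [← hf, h]; simp)
    refine convex_logStrip.isPreconnected.eq_of_sq_eq (f := fun p => f (p, p))
      (g := fun _ => f (0, 0)) (hfc.comp (by fun_prop) fun q hq => ⟨hq, hq⟩) continuousOn_const
      (fun q hq => ?_) (fun _ => hne) zero_mem_logStrip rfl hp
    simp only [Pi.pow_apply]
    rw [hf, hf, gapQuot_self hq, gapQuot_self zero_mem_logStrip]
  -- On the diagonal `f` is the constant `f (0, 0)`, whose square is one; multiplying by it
  -- normalizes the sign.
  refine ⟨fun x => f (0, 0) * f x, continuousOn_const.mul hfc, fun x hx => ?_, fun p hp => ?_⟩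
  · simp only [mul_pow, hf]; rw [gapQuot_self zero_mem_logStrip, one_mul]
  · simp only [hdiag p hp]; rw [← sq, hf, gapQuot_self zero_mem_logStrip]


/-- A continuous square root of `gapQuot` on the square of the strip, equal to `1` on the
diagonal. -/
def gapRoot : ℂ × ℂ → ℂ := Classical.choose exists_sqrt_gapQuot

theorem continuousOn_gapRoot : ContinuousOn gapRoot (logStrip ×ˢ logStrip) :=
  (Classical.choose_spec exists_sqrt_gapQuot).1

theorem gapRoot_sq {x : ℂ × ℂ} (hx : x ∈ logStrip ×ˢ logStrip) : gapRoot x ^ 2 = gapQuot x :=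
  (Classical.choose_spec exists_sqrt_gapQuot).2.1 x hx

theorem gapRoot_self {p : ℂ} (hp : p ∈ logStrip) : gapRoot (p, p) = 1 :=
  (Classical.choose_spec exists_sqrt_gapQuot).2.2 p hp

/-- The uniformizing coordinate at the saddle `p₀`: the tangent gap equals
`logistic' p₀ · u² / 2`. -/
def saddleCoord (p₀ p : ℂ) : ℂ := (p - p₀) * gapRoot (p₀, p)

theorem saddleCoord_self (p₀ : ℂ) : saddleCoord p₀ p₀ = 0 := by simp [saddleCoord]

theorem saddleCoord_sq {p₀ p : ℂ} (h₀ : p₀ ∈ logStrip) (hp : p ∈ logStrip) :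
    logisticDeriv p₀ / 2 * saddleCoord p₀ p ^ 2 = tangentGap p₀ p := by
  rw [saddleCoord, mul_pow, gapRoot_sq ⟨h₀, hp⟩, gapQuot_mul h₀ hp]

theorem saddleCoord_ne_zero {p₀ p : ℂ} (h₀ : p₀ ∈ logStrip) (hp : p ∈ logStrip) (hne : p ≠ p₀) :
    saddleCoord p₀ p ≠ 0 := by
  intro h
  apply tangentGap_ne_zero h₀ hp hne
  rw [← saddleCoord_sq h₀ hp, h]; simp

theorem continuousOn_saddleCoord :
    ContinuousOn (fun x : ℂ × ℂ => saddleCoord x.1 x.2) (logStrip ×ˢ logStrip) := by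
  unfold saddleCoord
  exact (continuousOn_snd.sub continuousOn_fst).mul continuousOn_gapRoot

/-- `softplus p - p/2` is even, so the tangent gap at `0` is even. Its two square roots agree at
`0`, hence everywhere on the strip. -/
theorem gapRoot_zero_neg {d : ℂ} (hd : d ∈ logStrip) : gapRoot (0, -d) = gapRoot (0, d) := by
  have hm : ∀ q ∈ logStrip, ((0 : ℂ), q) ∈ logStrip ×ˢ logStrip := fun q hq =>
    ⟨zero_mem_logStrip, hq⟩
  refine convex_logStrip.isPreconnected.eq_of_sq_eq (f := fun p => gapRoot (0, -p))
      (g := fun p => gapRoot (0, p)) (continuousOn_gapRoot.comp (by fun_prop)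
        fun q hq => hm _ (neg_mem_logStrip hq))
      (continuousOn_gapRoot.comp (by fun_prop) fun q hq => hm _ hq)
      (fun q hq => ?_) (fun {q} hq h => gapQuot_ne_zero (hm q hq) ?_) zero_mem_logStrip
      (by simp) hd
  · simp only [Pi.pow_apply]
    rw [gapRoot_sq (hm _ hq), gapRoot_sq (hm _ (neg_mem_logStrip hq))]
    by_cases h : q = 0
    · simp [h]
    have h1 := gapQuot_mul zero_mem_logStrip hq
    have h2 := gapQuot_mul zero_mem_logStrip (neg_mem_logStrip hq)
    have h3 : tangentGap 0 (-q) = tangentGap 0 q := by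
      rw [tangentGap, tangentGap, softplus_neg hq, logistic]; simp; ring
    have hne := logisticDeriv_ne_zero zero_mem_logStrip
    rw [h3, ← h1] at h2
    have hq2 : logisticDeriv 0 / 2 * q ^ 2 ≠ 0 :=
      mul_ne_zero (div_ne_zero hne two_ne_zero) (pow_ne_zero 2 h)
    apply mul_left_cancel₀ hq2
    linear_combination h2
  · rw [← gapRoot_sq (hm q hq), h]; simp

/-- The uniformizing coordinate is injective on the whole strip. -/
theorem saddleCoord_injOn {p₀ : ℂ} (h₀ : p₀ ∈ logStrip) : InjOn (saddleCoord p₀) logStrip := by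
  intro p hp q hq heq
  -- Equal coordinates give equal gaps, so the chord through `p` and `q` is parallel to the tangent
  -- at `p₀`. The plan is to follow the coordinates of both ends while the chord is translated, `p₀`
  -- being replaced by its chord point, and to show that they are always opposite.
  by_contra hne
  have hsub : p - q ≠ 0 := sub_ne_zero.2 hne
  have hgap : tangentGap p₀ p = tangentGap p₀ q := by
    rw [← saddleCoord_sq h₀ hp, ← saddleCoord_sq h₀ hq, heq]
  have hchord : softplus p - softplus q = logistic p₀ * (p - q) := by
    rw [tangentGap, tangentGap] at hgap; linear_combination hgap
  have hp₀ := chordPoint_eq h₀ hne hchord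
  -- translate the pair until its midpoint is the origin
  let P : ℝ → ℂ := fun t => p + t * ((p - q) / 2 - p)
  let Q : ℝ → ℂ := fun t => q + t * (-((p - q) / 2) - q)
  have hd : (p - q) / 2 ∈ logStrip := by
    have h1 := abs_lt.1 (mem_logStrip.1 hp)
    have h2 := abs_lt.1 (mem_logStrip.1 hq)
    have : ((p - q) / 2).im = (p.im - q.im) / 2 := by simp
    rw [mem_logStrip, this, abs_lt]; constructor <;> linarith
  have hP : ∀ t ∈ Icc (0 : ℝ) 1, P t ∈ logStrip := fun t ht => segment_mem_logStrip hd hp ht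
  have hQ : ∀ t ∈ Icc (0 : ℝ) 1, Q t ∈ logStrip := fun t ht =>
    segment_mem_logStrip (neg_mem_logStrip hd) hq ht
  have hPQ : ∀ t, P t - Q t = p - q := fun t => by simp only [P, Q]; ring
  have hPQne : ∀ t, P t ≠ Q t := fun t h => hsub (by rw [← hPQ t, h, sub_self])
  have hPc : Continuous P := by simp only [P]; fun_prop
  have hQc : Continuous Q := by simp only [Q]; fun_prop
  let c : ℝ → ℂ := fun t => chordPoint (P t) (Q t)
  have hc : ∀ t ∈ Icc (0 : ℝ) 1, c t ∈ logStrip := fun t ht =>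
    chordPoint_mem (hP t ht) (hQ t ht) (hPQne t)
  have hcc : ContinuousOn c (Icc 0 1) := by
    have hsp : ∀ R : ℝ → ℂ, Continuous R → (∀ t ∈ Icc (0 : ℝ) 1, R t ∈ logStrip) →
        ContinuousOn (fun t => softplus (R t)) (Icc 0 1) := fun R hR hR' t ht =>
      (hasDerivAt_softplus (hR' t ht)).continuousAt.comp_continuousWithinAt
        hR.continuousWithinAt
    have hm : ContinuousOn (fun t => (softplus (P t) - softplus (Q t)) / (P t - Q t))
        (Icc 0 1) :=
      ((hsp P hPc hP).sub (hsp Q hQc hQ)).div (hPc.sub hQc).continuousOn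
        fun t _ => sub_ne_zero.2 (hPQne t)
    refine (hm.div (continuousOn_const.sub hm) fun t ht h => ?_).clog fun t ht =>
      chord_mem_slitPlane (hP t ht) (hQ t ht) (hPQne t)
    have := chord_mem_slitPlane (hP t ht) (hQ t ht) (hPQne t)
    have h' : 1 - (softplus (P t) - softplus (Q t)) / (P t - Q t) = 0 := h
    rw [h', div_zero] at this
    exact slitPlane_ne_zero this rfl
  have hcP : ContinuousOn (fun t => saddleCoord (c t) (P t)) (Icc 0 1) :=
    continuousOn_saddleCoord.comp (hcc.prodMk hPc.continuousOn) fun t ht => ⟨hc t ht, hP t ht⟩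
  have hcQ : ContinuousOn (fun t => saddleCoord (c t) (Q t)) (Icc 0 1) :=
    continuousOn_saddleCoord.comp (hcc.prodMk hQc.continuousOn) fun t ht => ⟨hc t ht, hQ t ht⟩
  have hch : ∀ t ∈ Icc (0 : ℝ) 1, softplus (P t) - softplus (Q t) =
      logistic (c t) * (P t - Q t) := fun t ht =>
    softplus_sub_eq_logistic_chordPoint (hP t ht) (hQ t ht) (hPQne t)
  -- The two coordinates have equal squares along the deformation, so the relative sign is constant
  -- as long as they do not vanish. It can be read off from the symmetric chord, where the chord
  -- point is `0` and the coordinate is odd.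
  have key : saddleCoord (c 0) (P 0) = -saddleCoord (c 0) (Q 0) := by
    refine isPreconnected_Icc.eq_of_sq_eq (f := fun t => saddleCoord (c t) (P t))
      (g := fun t => -saddleCoord (c t) (Q t)) hcP hcQ.neg (fun t ht => ?_)
      (fun {t} ht h => ?_) (right_mem_Icc.2 zero_le_one) ?_ (left_mem_Icc.2 zero_le_one)
    · have h1 := saddleCoord_sq (hc t ht) (hP t ht)
      have h2 := saddleCoord_sq (hc t ht) (hQ t ht)
      have h3 : tangentGap (c t) (P t) = tangentGap (c t) (Q t) := by
        rw [tangentGap, tangentGap]; linear_combination hch t ht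
      have hne := logisticDeriv_ne_zero (hc t ht)
      simp only [Pi.pow_apply, neg_sq]
      rw [h3, ← h2] at h1
      exact mul_left_cancel₀ (div_ne_zero hne two_ne_zero) h1
    -- A vanishing coordinate puts the chord point at `Q t`; the chord would then be tangent to
    -- `softplus` at its own end, which `tangentGap_ne_zero` forbids.
    · have hQc' : Q t = c t := by
        by_contra h'
        exact saddleCoord_ne_zero (hc t ht) (hQ t ht) h' (neg_eq_zero.1 h)
      apply tangentGap_ne_zero (hQ t ht) (hP t ht) (hPQne t)
      have := hch t ht
      rw [← hQc'] at this
      rw [tangentGap]; linear_combination this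
    · have hP1 : P 1 = (p - q) / 2 := by simp [P]
      have hQ1 : Q 1 = -((p - q) / 2) := by simp [Q]
      have hc1 : c 1 = 0 := by
        apply chordPoint_eq zero_mem_logStrip (hPQne 1)
        rw [hP1, hQ1, softplus_neg hd, logistic]; simp; ring
      simp only [hP1, hQ1, hc1, saddleCoord]
      rw [gapRoot_zero_neg hd]; ring
  have hP0 : P 0 = p := by simp [P]
  have hQ0 : Q 0 = q := by simp [Q]
  have hc0 : c 0 = p₀ := by simp only [c, hP0, hQ0, hp₀]
  rw [hP0, hQ0, hc0, ← heq] at key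
  have hz : saddleCoord p₀ p = 0 := by linear_combination key / 2
  have e1 : p = p₀ := by
    by_contra h; exact saddleCoord_ne_zero h₀ hp h hz
  have e2 : q = p₀ := by
    by_contra h; exact saddleCoord_ne_zero h₀ hq h (heq ▸ hz)
  exact hne (e1.trans e2.symm)

/-- The difference quotient of `v` is that of `v²` divided by `v p + v q`. -/
theorem hasDerivAt_of_sq {v : ℂ → ℂ} {w' q : ℂ} (hc : ContinuousAt v q) (hv : v q ≠ 0)
    (hd : HasDerivAt (fun p => v p ^ 2) w' q) : HasDerivAt v (w' / (2 * v q)) q := by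
  rw [hasDerivAt_iff_tendsto_slope] at hd ⊢
  have h1 : Tendsto (fun p => v p + v q) (𝓝[≠] q) (𝓝 (2 * v q)) := by
    rw [two_mul]
    exact (hc.tendsto.mono_left nhdsWithin_le_nhds).add_const _
  refine (hd.div h1 (mul_ne_zero two_ne_zero hv)).congr' ?_
  filter_upwards [h1.eventually_ne (mul_ne_zero two_ne_zero hv), self_mem_nhdsWithin] with p hp hne
  have : p - q ≠ 0 := sub_ne_zero.2 hne
  simp only [Pi.div_apply, slope_def_field]
  field_simp
  ring

theorem hasDerivAt_tangentGap {p₀ p : ℂ} (hp : p ∈ logStrip) :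
    HasDerivAt (tangentGap p₀) (logistic p - logistic p₀) p := by
  have := ((hasDerivAt_softplus hp).sub_const (softplus p₀)).sub
    (((hasDerivAt_id p).sub_const p₀).const_mul (logistic p₀))
  exact this.congr_deriv (by simp)

theorem hasDerivAt_saddleCoord_of_ne {p₀ p : ℂ} (h₀ : p₀ ∈ logStrip) (hp : p ∈ logStrip)
    (hne : p ≠ p₀) : HasDerivAt (saddleCoord p₀)
      ((logistic p - logistic p₀) / (logisticDeriv p₀ * saddleCoord p₀ p)) p := by
  have hl := logisticDeriv_ne_zero h₀
  have hcont : ContinuousAt (saddleCoord p₀) p :=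
    (continuousOn_saddleCoord.comp (f := fun q => (p₀, q)) (by fun_prop)
      (fun q hq => ⟨h₀, hq⟩)).continuousAt (isOpen_logStrip.mem_nhds hp)
  have hne' := saddleCoord_ne_zero h₀ hp hne
  have hd : HasDerivAt (fun q => saddleCoord p₀ q ^ 2)
      (2 / logisticDeriv p₀ * (logistic p - logistic p₀)) p := by
    refine ((hasDerivAt_tangentGap hp).const_mul (2 / logisticDeriv p₀)).congr_of_eventuallyEq ?_
    filter_upwards [isOpen_logStrip.mem_nhds hp] with q hq
    rw [← saddleCoord_sq h₀ hq]; field_simp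
  exact (hasDerivAt_of_sq hcont hne' hd).congr_deriv (by field_simp)

theorem hasDerivAt_saddleCoord_self {p₀ : ℂ} (h₀ : p₀ ∈ logStrip) :
    HasDerivAt (saddleCoord p₀) 1 p₀ := by
  rw [hasDerivAt_iff_tendsto_slope]
  have h1 : ContinuousAt (fun q => gapRoot (p₀, q)) p₀ :=
    (continuousOn_gapRoot.comp (f := fun q => (p₀, q)) (by fun_prop)
      (fun q hq => ⟨h₀, hq⟩)).continuousAt (isOpen_logStrip.mem_nhds h₀)
  have h2 := h1.tendsto.mono_left (nhdsWithin_le_nhds (s := {p₀}ᶜ))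
  simp only [gapRoot_self h₀] at h2
  refine h2.congr' ?_
  filter_upwards [self_mem_nhdsWithin] with q hq
  have : q - p₀ ≠ 0 := sub_ne_zero.2 hq
  rw [slope_def_field, saddleCoord_self, saddleCoord]
  field_simp; simp

theorem differentiableOn_saddleCoord {p₀ : ℂ} (h₀ : p₀ ∈ logStrip) :
    DifferentiableOn ℂ (saddleCoord p₀) logStrip := by
  intro p hp
  by_cases h : p = p₀
  · rw [h]; exact (hasDerivAt_saddleCoord_self h₀).differentiableAt.differentiableWithinAt
  · exact (hasDerivAt_saddleCoord_of_ne h₀ hp h).differentiableAt.differentiableWithinAt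

theorem deriv_saddleCoord_self {p₀ : ℂ} (h₀ : p₀ ∈ logStrip) : deriv (saddleCoord p₀) p₀ = 1 :=
  (hasDerivAt_saddleCoord_self h₀).deriv

/-- The derivative of `saddleCoord_sq`. It trades the product `u u'` for an elementary function,
which serves later both for bounds and for eliminating `u'`. -/
theorem saddleCoord_mul_deriv {p₀ p : ℂ} (h₀ : p₀ ∈ logStrip) (hp : p ∈ logStrip) :
    logisticDeriv p₀ * (saddleCoord p₀ p * deriv (saddleCoord p₀) p) =
      logistic p - logistic p₀ := by
  by_cases h : p = p₀
  · rw [h, saddleCoord_self]; ring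
  · rw [(hasDerivAt_saddleCoord_of_ne h₀ hp h).deriv]
    have := saddleCoord_ne_zero h₀ hp h
    have := logisticDeriv_ne_zero h₀
    field_simp

theorem deriv_saddleCoord_ne_zero {p₀ p : ℂ} (h₀ : p₀ ∈ logStrip) (hp : p ∈ logStrip) :
    deriv (saddleCoord p₀) p ≠ 0 := by
  by_cases h : p = p₀
  · rw [h, deriv_saddleCoord_self h₀]; exact one_ne_zero
  · intro h0
    have := saddleCoord_mul_deriv h₀ hp
    rw [h0, mul_zero, mul_zero] at this
    exact h (logistic_injOn hp h₀ (sub_eq_zero.1 this.symm))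

end

/-! ### Existence and uniqueness of the branch `γ`. -/

noncomputable section

theorem cpow_neg_half_sq {x : ℂ} : (x ^ (-(1 / 2) : ℂ)) ^ 2 = x⁻¹ := by
  rw [← cpow_mul_nat, ← cpow_neg_one]; norm_num

/-- The factor `-I` fixes the sign: `log (s e^{iν}) - log s = iν` for small `ν`, and `u` has
derivative one at its zero. -/
theorem isGammaBranch_saddleCoord {s : ℂ} (hs : s ∈ slitPlane) :
    IsGammaBranch s fun β => -I * saddleCoord (log s) (log β) * (1 + s) ^ (-(1 / 2) : ℂ) := by
  have h₀ := log_mem_logStrip hs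
  have hs0 := slitPlane_ne_zero hs
  have h1s := slitPlane_ne_zero (one_add_mem_slitPlane hs)
  refine ⟨?_, fun β hβ => ?_, ?_⟩
  · refine DifferentiableOn.mul_const (DifferentiableOn.const_mul ?_ _) _
    exact (differentiableOn_saddleCoord h₀).comp (fun β hβ => (differentiableAt_log hβ).differentiableWithinAt)
      fun β hβ => log_mem_logStrip hβ
  · have h2 := saddleCoord_sq h₀ (log_mem_logStrip hβ)
    have hβ0 := slitPlane_ne_zero hβ
    rw [tangentGap, softplus, softplus, logisticDeriv, logistic, exp_log hs0, exp_log hβ0] at h2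
    rw [mul_pow, mul_pow, cpow_neg_half_sq, neg_sq, I_sq]
    have h3 : saddleCoord (log s) (log β) ^ 2 = 2 * (1 + s) ^ 2 / s *
        (log (1 + β) - log (1 + s) - s / (1 + s) * (log β - log s)) := by
      rw [← h2]; field_simp
    rw [h3]; field_simp; ring
  · have hlog : ∀ᶠ ν : ℂ in 𝓝[≠] 0, log (s * exp (I * ν)) = log s + I * ν := by
      have hc : ContinuousAt (fun ν : ℂ => log s + I * ν) 0 := by fun_prop
      have := hc.eventually_mem (isOpen_logStrip.mem_nhds (by simpa using h₀))
      filter_upwards [this.filter_mono nhdsWithin_le_nhds] with ν hν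
      rw [← log_exp_of_mem_logStrip hν, exp_add, exp_log hs0]
    have h1 : ContinuousAt (fun ν : ℂ => gapRoot (log s, log s + I * ν)) 0 := by
      have : ContinuousAt (fun q => gapRoot (log s, q)) (log s + I * 0) :=
        (continuousOn_gapRoot.comp (f := fun q => (log s, q)) (by fun_prop)
          (fun q hq => ⟨h₀, hq⟩)).continuousAt (isOpen_logStrip.mem_nhds (by simpa using h₀))
      exact ContinuousAt.comp (f := fun ν : ℂ => log s + I * ν) this (by fun_prop)
    have h2 := (h1.tendsto.mono_left (nhdsWithin_le_nhds (s := {0}ᶜ))).mul_const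
      ((1 + s) ^ (-(1 / 2) : ℂ))
    simp only [mul_zero, add_zero, gapRoot_self h₀, one_mul] at h2
    refine h2.congr' ?_
    filter_upwards [hlog, self_mem_nhdsWithin] with ν hν hne
    have : ν ≠ 0 := hne
    rw [hν, saddleCoord, eq_div_iff this]
    linear_combination (ν * gapRoot (log s, log s + I * ν) * (1 + s) ^ (-(1 / 2) : ℂ)) * I_sq

/-- Two branches agree up to sign at each point. Near `s` the opposite sign is impossible, because
the sum of the two normalized quotients has a nonzero limit; the identity theorem then applies. -/
theorem IsGammaBranch.eqOn {s : ℂ} (hs : s ∈ slitPlane) {γ₁ γ₂ : ℂ → ℂ} (h₁ : IsGammaBranch s γ₁)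
    (h₂ : IsGammaBranch s γ₂) : EqOn γ₁ γ₂ slitPlane := by
  have hs0 := slitPlane_ne_zero hs
  have h1s := slitPlane_ne_zero (one_add_mem_slitPlane hs)
  have hc : (1 + s) ^ (-(1 / 2) : ℂ) ≠ 0 := by simp [cpow_eq_zero_iff, h1s]
  have hd : HasDerivAt (fun ν : ℂ => s * exp (I * ν)) (s * I) 0 := by
    have h1 : HasDerivAt (fun ν : ℂ => I * ν) I 0 := by
      simpa using (hasDerivAt_id (0 : ℂ)).const_mul I
    simpa using h1.cexp.const_mul s
  have ht : Tendsto (fun ν : ℂ => s * exp (I * ν)) (𝓝[≠] 0) (𝓝[≠] s) := by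
    simpa using hd.tendsto_nhdsNE (mul_ne_zero hs0 I_ne_zero)
  have hmem : ∀ᶠ β in 𝓝[≠] s, β ∈ slitPlane :=
    mem_nhdsWithin_of_mem_nhds (isOpen_slitPlane.mem_nhds hs)
  refine AnalyticOnNhd.eqOn_of_preconnected_of_frequently_eq (h₁.1.analyticOnNhd isOpen_slitPlane)
    (h₂.1.analyticOnNhd isOpen_slitPlane) ?_ hs ?_
  · exact (starConvex_one_slitPlane.isPathConnected one_mem_slitPlane).isConnected.isPreconnected
  refine ht.frequently (Eventually.frequently ?_)
  have hsum := (h₁.2.2.add h₂.2.2).eventually_ne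
    (show (1 + s) ^ (-(1 / 2) : ℂ) + (1 + s) ^ (-(1 / 2) : ℂ) ≠ 0 by
      rw [← two_mul]; exact mul_ne_zero two_ne_zero hc)
  filter_upwards [hsum, ht.eventually hmem] with ν hν hβ
  have h3 := h₁.2.1 _ hβ
  rw [← h₂.2.1 _ hβ] at h3
  rcases sq_eq_sq_iff_eq_or_eq_neg.1 (mul_left_cancel₀ (by norm_num) h3) with h | h
  · exact h
  · exact absurd (by rw [h, ← add_div, neg_add_cancel, zero_div]) hν

theorem isGammaBranch_gammaBranch {s : ℂ} (hs : s ∈ slitPlane) :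
    IsGammaBranch s (gammaBranch s) :=
  Classical.epsilon_spec ⟨_, isGammaBranch_saddleCoord hs⟩

theorem gammaBranch_eq {s β : ℂ} (hs : s ∈ slitPlane) (hβ : β ∈ slitPlane) :
    gammaBranch s β = -I * saddleCoord (log s) (log β) * (1 + s) ^ (-(1 / 2) : ℂ) :=
  (isGammaBranch_gammaBranch hs).eqOn hs (isGammaBranch_saddleCoord hs) hβ

end

/-! ### Parameter integrals and integrals along horizontal lines. -/

noncomputable section

theorem integrable_exp_neg_mul_abs {c : ℝ} (hc : 0 < c) :
    Integrable fun x : ℝ => Real.exp (-c * |x|) := by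
  rw [← integrableOn_univ, ← Iic_union_Ioi (a := (0 : ℝ))]
  refine IntegrableOn.union ?_ ?_
  · refine (integrableOn_exp_mul_Iic hc 0).congr_fun (fun x hx => ?_) measurableSet_Iic
    simp only [mem_Iic] at hx
    simp only [abs_of_nonpos hx]; congr 1; ring
  · refine (integrableOn_exp_mul_Ioi (neg_neg_of_pos hc) 0).congr_fun (fun x hx => ?_)
      measurableSet_Ioi
    simp only [mem_Ioi] at hx
    simp only [abs_of_pos hx]

theorem integral_exp_neg_abs : ∫ x : ℝ, Real.exp (-|x|) = 2 := by
  have := integral_comp_abs (f := fun x => Real.exp (-x))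
  rw [this, integral_exp_neg_Ioi_zero]; norm_num

/-- A holomorphic parameter integral, under a locally uniform domination. -/
theorem differentiableOn_integral_of_locally_dominated {α : Type*} [MeasurableSpace α]
    {μ : Measure α} {U : Set ℂ} (hU : IsOpen U) {F : ℂ → α → ℂ}
    (hmeas : ∀ b ∈ U, AEStronglyMeasurable (F b) μ)
    (hdiff : ∀ a, DifferentiableOn ℂ (fun b => F b a) U)
    (hdom : ∀ b ∈ U, ∃ bound : α → ℝ, Integrable bound μ ∧
      ∀ᶠ b' in 𝓝 b, ∀ a, ‖F b' a‖ ≤ bound a) :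
    DifferentiableOn ℂ (fun b => ∫ a, F b a ∂μ) U := by
  intro b hb
  obtain ⟨bound, hint, hev⟩ := hdom b hb
  obtain ⟨r, hr, hball⟩ := Metric.mem_nhds_iff.1 (hev.and (hU.mem_nhds hb))
  have hder : ∀ a, ∀ x ∈ Metric.ball b (r / 2),
      HasDerivAt (fun b => F b a) (deriv (fun b => F b a) x) x := fun a x hx =>
    ((hdiff a).differentiableAt (hU.mem_nhds
      (hball (Metric.ball_subset_ball (by linarith) hx)).2)).hasDerivAt
  -- Cauchy's estimate on circles of radius `r/4`, which stay inside the ball where the domination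
  -- holds.
  have hbd : ∀ a, ∀ x ∈ Metric.ball b (r / 2),
      ‖deriv (fun b => F b a) x‖ ≤ bound a / (r / 4) := fun a x hx => by
    have hsub : Metric.closedBall x (r / 4) ⊆ Metric.ball b r := fun y hy => by
      have h1 := Metric.mem_closedBall.1 hy
      have h2 := Metric.mem_ball.1 hx
      exact Metric.mem_ball.2 ((dist_triangle y x b).trans_lt (by linarith))
    refine norm_deriv_le_of_forall_mem_sphere_norm_le (by linarith) ?_ fun z hz =>
      (hball (hsub (Metric.sphere_subset_closedBall hz))).1 a
    refine DifferentiableOn.diffContOnCl ((hdiff a).mono fun y hy => ?_)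
    exact (hball (hsub (Metric.closure_ball_subset_closedBall hy))).2
  refine (hasDerivAt_integral_of_dominated_loc_of_deriv_le (F := F)
    (F' := fun b a => deriv (fun b => F b a) b)
    (Metric.ball_mem_nhds b (half_pos hr)) ?_ ?_ ?_ (Eventually.of_forall hbd)
    (hint.div_const _)
    (Eventually.of_forall hder)).2.differentiableAt.differentiableWithinAt
  · filter_upwards [hU.mem_nhds hb] with x hx using hmeas x hx
  · exact hint.mono' (hmeas b hb) (Eventually.of_forall fun a =>
      (hball (Metric.mem_ball_self hr)).1 a)
  -- The derivative is measurable in `a` as a pointwise limit of difference quotients along a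
  -- sequence.
  · have hseq : Tendsto (fun n : ℕ => b + (r / 2 * (1 / ((n : ℝ) + 1)) : ℝ)) atTop (𝓝[≠] b) := by
      rw [tendsto_nhdsWithin_iff]
      constructor
      · have h1 : Tendsto (fun n : ℕ => (r / 2 * (1 / ((n : ℝ) + 1)) : ℝ)) atTop (𝓝 0) := by
          simpa using tendsto_one_div_add_atTop_nhds_zero_nat.const_mul (r / 2)
        have h2 := (continuous_ofReal.tendsto 0).comp h1
        simpa using h2.const_add b
      · refine Eventually.of_forall fun n => ?_
        simp only [mem_compl_iff, mem_singleton_iff, add_eq_left, ofReal_eq_zero]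
        positivity
    refine aestronglyMeasurable_of_tendsto_ae atTop
      (f := fun (n : ℕ) a => slope (fun b => F b a) b (b + (r / 2 * (1 / ((n : ℝ) + 1)) : ℝ)))
      (fun n => ?_) (Eventually.of_forall fun a => ?_)
    · simp only [slope, vsub_eq_sub]
      have hm : b + ((r / 2 * (1 / ((n : ℝ) + 1)) : ℝ) : ℂ) ∈ U → AEStronglyMeasurable
          (fun a => F (b + ((r / 2 * (1 / ((n : ℝ) + 1)) : ℝ) : ℂ)) a - F b a) μ := fun h =>
        (hmeas _ h).sub (hmeas b hb)
      refine AEStronglyMeasurable.fun_const_smul (hm (hball ?_).2) _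
      rw [Metric.mem_ball, dist_eq, add_sub_cancel_left, norm_real, Real.norm_eq_abs,
        abs_of_pos (by positivity)]
      have : 1 / ((n : ℝ) + 1) ≤ 1 := by
        rw [div_le_one (by positivity)]; have := n.cast_nonneg (α := ℝ); linarith
      nlinarith
    · exact (hasDerivAt_iff_tendsto_slope.1
        (hder a b (Metric.mem_ball_self (half_pos hr)))).comp hseq

/-- The closed horizontal strip `θ₁ ≤ Im p ≤ θ₂`. -/
def closedStrip (θ₁ θ₂ : ℝ) : Set ℂ := {p | θ₁ ≤ p.im ∧ p.im ≤ θ₂}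

theorem closedStrip_subset_logStrip {θ₁ θ₂ : ℝ} (h₁ : -Real.pi < θ₁) (h₂ : θ₂ < Real.pi) :
    closedStrip θ₁ θ₂ ⊆ logStrip := fun p hp => by
  rw [mem_logStrip, abs_lt]; constructor <;> linarith [hp.1, hp.2]

theorem isClosed_closedStrip (θ₁ θ₂ : ℝ) : IsClosed (closedStrip θ₁ θ₂) :=
  (isClosed_le continuous_const continuous_im).inter (isClosed_le continuous_im continuous_const)

theorem isCompact_closedStrip_inter (θ₁ θ₂ X : ℝ) :
    IsCompact (closedStrip θ₁ θ₂ ∩ {p | |p.re| ≤ X}) := by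
  have : closedStrip θ₁ θ₂ ∩ {p | |p.re| ≤ X} = Icc (-X) X ×ℂ Icc θ₁ θ₂ := by
    ext p; simp only [closedStrip, mem_inter_iff, mem_ofPred_eq, abs_le, mem_reProdIm, mem_Icc]
    tauto
  rw [this]
  exact isCompact_Icc.reProdIm isCompact_Icc

theorem ofReal_add_mul_I_mem_closedStrip (x θ : ℝ) : (x + θ * I : ℂ) ∈ closedStrip θ θ := by
  simp [closedStrip]

/-- A function continuous on a closed strip, jointly with a parameter in a compact set, is bounded
as soon as it is bounded near the two ends of the strip. -/
theorem exists_bound_of_tails {θ₁ θ₂ : ℝ} {P : Type*} [TopologicalSpace P] {k : Set P}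
    (hk : IsCompact k) {G : ℂ × P → ℂ} (hG : ContinuousOn G (closedStrip θ₁ θ₂ ×ˢ k)) {C X : ℝ}
    (ht : ∀ p ∈ closedStrip θ₁ θ₂, X ≤ |p.re| → ∀ b ∈ k, ‖G (p, b)‖ ≤ C) :
    ∃ C', 0 ≤ C' ∧ ∀ p ∈ closedStrip θ₁ θ₂, ∀ b ∈ k, ‖G (p, b)‖ ≤ C' := by
  obtain ⟨D, hD⟩ := ((isCompact_closedStrip_inter θ₁ θ₂ X).prod hk).exists_bound_of_continuousOn
    (hG.mono (prod_mono_left inter_subset_left))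
  refine ⟨max (max C D) 0, le_max_right _ _, fun p hp b hb => ?_⟩
  rcases le_total X |p.re| with h | h
  · exact (ht p hp h b hb).trans ((le_max_left _ _).trans (le_max_left _ _))
  · exact (hD (p, b) ⟨⟨hp, h⟩, hb⟩).trans ((le_max_right _ _).trans (le_max_left _ _))

theorem continuous_line (θ : ℝ) : Continuous fun x : ℝ => (x + θ * I : ℂ) := by fun_prop

theorem integrable_line_of_decay {G : ℂ → ℂ} {θ C c X : ℝ} (hc : 0 < c)
    (hG : ContinuousOn G (closedStrip θ θ))
    (ht : ∀ p ∈ closedStrip θ θ, X ≤ |p.re| → ‖G p‖ ≤ C * Real.exp (-c * |p.re|)) :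
    Integrable fun x : ℝ => G (x + θ * I) := by
  have hcont : Continuous fun x : ℝ => G (x + θ * I) :=
    hG.comp_continuous (continuous_line θ) fun x => ofReal_add_mul_I_mem_closedStrip x θ
  have hle : ∀ x : ℝ, X ≤ |x| → ‖G (x + θ * I)‖ ≤ C * ‖Real.exp (-c * |x|)‖ := fun x hx => by
    have := ht _ (ofReal_add_mul_I_mem_closedStrip x θ) (by simpa using hx)
    rw [Real.norm_eq_abs, Real.abs_exp]
    simpa using this
  refine hcont.locallyIntegrable.integrable_of_isBigO_atBot_atTop
    (g := fun x => Real.exp (-c * |x|)) (g' := fun x => Real.exp (-c * |x|))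
    (Asymptotics.IsBigO.of_bound C ?_) ((integrable_exp_neg_mul_abs hc).integrableAtFilter _)
    (Asymptotics.IsBigO.of_bound C ?_) ((integrable_exp_neg_mul_abs hc).integrableAtFilter _)
  · filter_upwards [tendsto_abs_atBot_atTop.eventually_ge_atTop X] with x hx using hle x hx
  · filter_upwards [tendsto_abs_atTop_atTop.eventually_ge_atTop X] with x hx using hle x hx

/-- A horizontal line of integration may be shifted across a strip in which the integrand is
holomorphic and decays exponentially. -/
theorem integral_line_eq_of_decay {G : ℂ → ℂ} {θ₁ θ₂ C c X : ℝ} (hθ : θ₁ ≤ θ₂) (hc : 0 < c)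
    (hG : DifferentiableOn ℂ G (closedStrip θ₁ θ₂))
    (ht : ∀ p ∈ closedStrip θ₁ θ₂, X ≤ |p.re| → ‖G p‖ ≤ C * Real.exp (-c * |p.re|)) :
    ∫ x : ℝ, G (x + θ₁ * I) = ∫ x : ℝ, G (x + θ₂ * I) := by
  have hsub₁ : closedStrip θ₁ θ₁ ⊆ closedStrip θ₁ θ₂ := fun p hp => ⟨hp.1, hp.2.trans hθ⟩
  have hsub₂ : closedStrip θ₂ θ₂ ⊆ closedStrip θ₁ θ₂ := fun p hp => ⟨hθ.trans hp.1, hp.2⟩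
  have hi₁ := integrable_line_of_decay hc (hG.continuousOn.mono hsub₁) fun p hp => ht p (hsub₁ hp)
  have hi₂ := integrable_line_of_decay hc (hG.continuousOn.mono hsub₂) fun p hp => ht p (hsub₂ hp)
  have h₁ := intervalIntegral_tendsto_integral hi₁ tendsto_neg_atTop_atBot tendsto_id
  have h₂ := intervalIntegral_tendsto_integral hi₂ tendsto_neg_atTop_atBot tendsto_id
  -- Cauchy's theorem on the rectangle `[-T, T] × [θ₁, θ₂]`; the vertical sides vanish as `T → ∞` by
  -- the exponential decay.
  have hrect : ∀ T : ℝ, (∫ x in (-T)..T, G (x + θ₁ * I)) - (∫ x in (-T)..T, G (x + θ₂ * I)) =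
      I • (∫ y in θ₁..θ₂, G ((-T : ℝ) + y * I)) - I • (∫ y in θ₁..θ₂, G ((T : ℝ) + y * I)) := by
    intro T
    have := integral_boundary_rect_eq_zero_of_differentiableOn G ((-T : ℝ) + θ₁ * I)
      ((T : ℝ) + θ₂ * I) (hG.mono fun p hp => by
        have := hp.2
        simp only [add_im, ofReal_im, mul_im, ofReal_re, I_im, mul_one, I_re, mul_zero, add_zero,
          zero_add, uIcc_of_le hθ, mem_preimage] at this
        exact this)
    simp only [add_im, ofReal_im, mul_im, ofReal_re, I_im, mul_one, I_re, mul_zero, add_zero,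
          zero_add, add_re, mul_re, sub_self] at this
    linear_combination this
  have hside : ∀ σ : ℝ, |σ| = 1 →
      Tendsto (fun T : ℝ => ∫ y in θ₁..θ₂, G ((σ * T : ℝ) + y * I)) atTop (𝓝 0) := by
    intro σ hσ
    have hlim : Tendsto (fun T : ℝ => C * Real.exp (-c * T) * |θ₂ - θ₁|) atTop (𝓝 0) := by
      have h3 : Tendsto (fun T : ℝ => Real.exp (-c * T)) atTop (𝓝 0) := by
        refine Real.tendsto_exp_atBot.comp ?_
        exact (tendsto_id (α := ℝ)).const_mul_atTop_of_neg (neg_neg_of_pos hc)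
      simpa using (h3.const_mul C).mul_const |θ₂ - θ₁|
    refine squeeze_zero_norm' ?_ hlim
    filter_upwards [eventually_ge_atTop X, eventually_ge_atTop 0] with T hT hT0
    refine intervalIntegral.norm_integral_le_of_norm_le_const fun y hy => ?_
    rw [uIoc_of_le hθ] at hy
    have habs : |σ * T| = T := by rw [abs_mul, hσ, one_mul, abs_of_nonneg hT0]
    have := ht ((σ * T : ℝ) + y * I) (by
      constructor <;> simp [hy.1.le, hy.2]) (by simpa [habs, ← ofReal_mul] using hT)
    have hre : (((σ * T : ℝ) : ℂ) + y * I).re = σ * T := by simp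
    rwa [hre, habs] at this
  have hdiff := h₁.sub h₂
  simp only [id] at hdiff
  have hz : Tendsto (fun T : ℝ => (∫ x in (-T)..T, G (x + θ₁ * I)) -
      (∫ x in (-T)..T, G (x + θ₂ * I))) atTop (𝓝 0) := by
    simp only [hrect]
    have a := (hside (-1) (by simp)).const_smul I
    have b := (hside 1 (by simp)).const_smul I
    simpa using a.sub b
  exact sub_eq_zero.1 (tendsto_nhds_unique hdiff hz)

end

/-! ### Decay of `e^φ` and bounds for the kernels near the ends of the strip. -/

noncomputable section

/-- The exponent `N₁ p - (N₀ + N₁) log (1 + e^p)`. -/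
def phase (N₀ N₁ p : ℂ) : ℂ := N₁ * p - (N₀ + N₁) * softplus p

theorem norm_softplus_le {p : ℂ} (hp : p.re ≤ -1) : ‖softplus p‖ ≤ 1 := by
  have h : ‖exp p‖ ≤ 1 / 2 := by
    rw [norm_exp]
    have h1 : Real.exp p.re ≤ Real.exp (-1) := Real.exp_le_exp.2 hp
    have h2 := Real.exp_neg_one_lt_d9
    linarith
  have := norm_log_one_add_half_le_self h
  rw [softplus]; linarith

theorem norm_softplus_sub_self_le {p : ℂ} (hp : p ∈ logStrip) (h : 1 ≤ p.re) :
    ‖softplus p - p‖ ≤ 1 := by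
  rw [← softplus_neg hp]; exact norm_softplus_le (by simpa using h)

theorem norm_logistic_le {p : ℂ} (h : 1 ≤ |p.re|) : ‖logistic p‖ ≤ 2 := by
  have h2 := Real.exp_neg_one_lt_d9
  have key : ∀ q : ℂ, q.re ≤ -1 → ‖exp q‖ ≤ 1 / 2 ∧ 1 / 2 ≤ ‖1 + exp q‖ := fun q hq => by
    have h1 : ‖exp q‖ ≤ 1 / 2 := by
      rw [norm_exp]
      have h1 : Real.exp q.re ≤ Real.exp (-1) := Real.exp_le_exp.2 hq
      linarith
    have h3 := norm_sub_norm_le 1 (-exp q)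
    rw [sub_neg_eq_add, norm_neg, norm_one] at h3
    exact ⟨h1, by linarith⟩
  rcases le_abs'.1 h with h | h
  · obtain ⟨h1, h3⟩ := key p h
    rw [logistic, norm_div, div_le_iff₀ (by linarith)]; linarith
  · obtain ⟨h1, h3⟩ := key (-p) (by simpa using h)
    have : logistic p = 1 / (1 + exp (-p)) := by
      have h5 : 1 + exp p = exp p * (1 + exp (-p)) := by
        rw [mul_add, ← exp_add]; simp; ring
      rw [logistic, h5]
      have := exp_ne_zero p
      field_simp
    rw [this, norm_div, norm_one, div_le_iff₀ (by linarith)]; linarith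

/-- At the left end `softplus p` is bounded and the exponent behaves like `N₁ p`. At the right end
`softplus p - p` is bounded and it behaves like `-N₀ p`. -/
theorem norm_exp_phase_le {N₀ N₁ p : ℂ} (hp : p ∈ logStrip) (h : 1 ≤ |p.re|) :
    ‖exp (phase N₀ N₁ p)‖ ≤ Real.exp (Real.pi * (‖N₀‖ + ‖N₁‖) + ‖N₀ + N₁‖) *
      Real.exp (-min N₀.re N₁.re * |p.re|) := by
  have him := mem_logStrip.1 hp
  have hprod : ∀ N : ℂ, |N.im * p.im| ≤ ‖N‖ * Real.pi := fun N => by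
    rw [abs_mul]; exact mul_le_mul (abs_im_le_norm N) him.le (abs_nonneg _) (norm_nonneg _)
  rw [norm_exp, ← Real.exp_add, Real.exp_le_exp]
  have hn₀ := mul_nonneg Real.pi_pos.le (norm_nonneg N₀)
  have hn₁ := mul_nonneg Real.pi_pos.le (norm_nonneg N₁)
  rcases le_abs'.1 h with h | h
  · have e : (phase N₀ N₁ p).re = N₁.re * p.re - N₁.im * p.im -
        ((N₀ + N₁) * softplus p).re := by rw [phase]; simp
    have h1 : |((N₀ + N₁) * softplus p).re| ≤ ‖N₀ + N₁‖ := (abs_re_le_norm _).trans (by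
      rw [norm_mul]; exact mul_le_of_le_one_right (norm_nonneg _) (norm_softplus_le h))
    have h2 := abs_le.1 h1
    have h3 := abs_le.1 (hprod N₁)
    rw [e, abs_of_neg (by linarith)]
    nlinarith [mul_nonneg (sub_nonneg.2 (min_le_right N₀.re N₁.re)) (show 0 ≤ -p.re by linarith)]
  · have e : (phase N₀ N₁ p).re = -(N₀.re * p.re) + N₀.im * p.im -
        ((N₀ + N₁) * (softplus p - p)).re := by rw [phase]; simp; ring
    have h1 : |((N₀ + N₁) * (softplus p - p)).re| ≤ ‖N₀ + N₁‖ := (abs_re_le_norm _).trans (by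
      rw [norm_mul]
      exact mul_le_of_le_one_right (norm_nonneg _) (norm_softplus_sub_self_le hp h))
    have h2 := abs_le.1 h1
    have h3 := abs_le.1 (hprod N₀)
    rw [e, abs_of_pos (by linarith)]
    nlinarith [mul_nonneg (sub_nonneg.2 (min_le_left N₀.re N₁.re)) (show 0 ≤ p.re by linarith)]

theorem differentiableOn_phase (N₀ N₁ : ℂ) : DifferentiableOn ℂ (phase N₀ N₁) logStrip :=
  fun _ hp => ((differentiableAt_id.const_mul _).sub
    ((hasDerivAt_softplus hp).differentiableAt.const_mul _)).differentiableWithinAt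

section weight

variable {N₀ N₁ : ℂ}

theorem norm_exp_phase_mul_le {G : ℂ → ℂ} {θ₁ θ₂ C X : ℝ} (h₁ : -Real.pi < θ₁)
    (h₂ : θ₂ < Real.pi) (ht : ∀ p ∈ closedStrip θ₁ θ₂, X ≤ |p.re| → ‖G p‖ ≤ C) :
    ∀ p ∈ closedStrip θ₁ θ₂, max X 1 ≤ |p.re| → ‖exp (phase N₀ N₁ p) * G p‖ ≤
      Real.exp (Real.pi * (‖N₀‖ + ‖N₁‖) + ‖N₀ + N₁‖) * C *
        Real.exp (-min N₀.re N₁.re * |p.re|) := by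
  intro p hp hX
  have h3 := norm_exp_phase_le (N₀ := N₀) (N₁ := N₁) (closedStrip_subset_logStrip h₁ h₂ hp)
    ((le_max_right _ _).trans hX)
  have h4 := ht p hp ((le_max_left _ _).trans hX)
  rw [norm_mul]
  calc _ ≤ _ := mul_le_mul h3 h4 (norm_nonneg _) (by positivity)
    _ = _ := by ring

theorem integrable_exp_phase_mul (hN₀ : 0 < N₀.re) (hN₁ : 0 < N₁.re) {G : ℂ → ℂ} {θ C X : ℝ}
    (h₁ : -Real.pi < θ) (h₂ : θ < Real.pi) (hG : ContinuousOn G (closedStrip θ θ))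
    (ht : ∀ p ∈ closedStrip θ θ, X ≤ |p.re| → ‖G p‖ ≤ C) :
    Integrable fun x : ℝ => exp (phase N₀ N₁ (x + θ * I)) * G (x + θ * I) :=
  integrable_line_of_decay (G := fun p => exp (phase N₀ N₁ p) * G p) (lt_min hN₀ hN₁)
    (((differentiableOn_phase N₀ N₁).continuousOn.mono
      (closedStrip_subset_logStrip h₁ h₂)).cexp.mul hG) (norm_exp_phase_mul_le h₁ h₂ ht)

theorem integral_exp_phase_mul_shift (hN₀ : 0 < N₀.re) (hN₁ : 0 < N₁.re) {G : ℂ → ℂ}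
    {θ₁ θ₂ C X : ℝ} (hθ : θ₁ ≤ θ₂)
    (h₁ : -Real.pi < θ₁) (h₂ : θ₂ < Real.pi) (hG : DifferentiableOn ℂ G (closedStrip θ₁ θ₂))
    (ht : ∀ p ∈ closedStrip θ₁ θ₂, X ≤ |p.re| → ‖G p‖ ≤ C) :
    ∫ x : ℝ, exp (phase N₀ N₁ (x + θ₁ * I)) * G (x + θ₁ * I) =
      ∫ x : ℝ, exp (phase N₀ N₁ (x + θ₂ * I)) * G (x + θ₂ * I) :=
  integral_line_eq_of_decay (G := fun p => exp (phase N₀ N₁ p) * G p) hθ (lt_min hN₀ hN₁)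
    (((differentiableOn_phase N₀ N₁).mono
      (closedStrip_subset_logStrip h₁ h₂)).cexp.mul hG) (norm_exp_phase_mul_le h₁ h₂ ht)

theorem differentiableOn_integral_exp_phase_mul (hN₀ : 0 < N₀.re) (hN₁ : 0 < N₁.re)
    {G : ℂ × ℂ → ℂ} {U : Set ℂ} (hU : IsOpen U) {θ : ℝ} (h₁ : -Real.pi < θ) (h₂ : θ < Real.pi)
    (hG : ContinuousOn G (closedStrip θ θ ×ˢ U))
    (hd : ∀ p ∈ closedStrip θ θ, DifferentiableOn ℂ (fun b => G (p, b)) U)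
    (ht : ∀ k ⊆ U, IsCompact k → ∃ C X : ℝ, ∀ p ∈ closedStrip θ θ, X ≤ |p.re| → ∀ b ∈ k,
      ‖G (p, b)‖ ≤ C) :
    DifferentiableOn ℂ
      (fun b => ∫ x : ℝ, exp (phase N₀ N₁ (x + θ * I)) * G (x + θ * I, b)) U := by
  have hline := ofReal_add_mul_I_mem_closedStrip
  have hw : Integrable fun x : ℝ => exp (phase N₀ N₁ (x + θ * I)) * 1 :=
    integrable_exp_phase_mul hN₀ hN₁ (G := fun _ => 1) (C := 1) (X := 0) h₁ h₂
      continuousOn_const (by simp)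
  simp only [mul_one] at hw
  refine differentiableOn_integral_of_locally_dominated hU (fun b hb => ?_) (fun x => ?_)
    fun b hb => ?_
  · refine hw.1.mul (Continuous.aestronglyMeasurable ?_)
    exact hG.comp_continuous (by fun_prop) fun x => ⟨hline x θ, hb⟩
  · exact (hd _ (hline x θ)).const_mul _
  · obtain ⟨r, hr, hball⟩ := Metric.nhds_basis_closedBall.mem_iff.1 (hU.mem_nhds hb)
    obtain ⟨C, X, hCX⟩ := ht _ hball (isCompact_closedBall b r)
    obtain ⟨C', -, hC'⟩ := exists_bound_of_tails (isCompact_closedBall b r)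
      (hG.mono (prod_mono_right hball)) hCX
    refine ⟨fun x => ‖exp (phase N₀ N₁ (x + θ * I))‖ * C', hw.norm.mul_const C', ?_⟩
    filter_upwards [Metric.closedBall_mem_nhds b hr] with b' hb' x
    rw [norm_mul]
    exact mul_le_mul_of_nonneg_left (hC' _ (hline x θ) _ hb') (norm_nonneg _)

end weight

theorem exists_abs_re_le_of_isCompact {k : Set ℂ} (hk : IsCompact k) :
    ∃ B : ℝ, 0 ≤ B ∧ ∀ b ∈ k, |b.re| ≤ B := by
  obtain ⟨B, hB⟩ := hk.exists_bound_of_continuousOn (f := id) continuousOn_id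
  exact ⟨max B 0, le_max_right _ _, fun b hb => (abs_re_le_norm b).trans ((hB b hb).trans (le_max_left _ _))⟩

theorem norm_exp_sub_exp_ge {B : ℝ} (hB : 0 ≤ B) {p b : ℂ} (hp : B + 1 ≤ |p.re|)
    (hb : |b.re| ≤ B) : Real.exp (-B) / 2 ≤ ‖exp p - exp b‖ := by
  have h0 := Real.exp_neg_one_lt_d9
  have h1 := norm_sub_norm_le (exp p) (exp b)
  have h2 := norm_sub_norm_le (exp b) (exp p)
  rw [norm_sub_rev (exp b)] at h2
  rw [norm_exp, norm_exp] at h1 h2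
  have hb' := abs_le.1 hb
  have e1 : Real.exp (-B - 1) = Real.exp (-B) * Real.exp (-1) := by
    rw [← Real.exp_add]; ring_nf
  have e2 : Real.exp B = Real.exp (B + 1) * Real.exp (-1) := by
    rw [← Real.exp_add]; ring_nf
  rcases le_abs'.1 hp with h | h
  · have h3 : Real.exp (-B) ≤ Real.exp b.re := Real.exp_le_exp.2 hb'.1
    have h4 : Real.exp p.re ≤ Real.exp (-B - 1) := Real.exp_le_exp.2 (by linarith)
    nlinarith [Real.exp_pos (-B)]
  · have h3 : Real.exp b.re ≤ Real.exp B := Real.exp_le_exp.2 hb'.2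
    have h4 : Real.exp (B + 1) ≤ Real.exp p.re := Real.exp_le_exp.2 h
    have h5 : Real.exp (-B) ≤ Real.exp (B + 1) := Real.exp_le_exp.2 (by linarith)
    nlinarith [Real.exp_pos (B + 1)]

/-- The kernel `σ(p) / (e^p - e^b)` is bounded near the ends of the strip. -/
theorem exists_tail_bound_logistic_div {k : Set ℂ} (hk : IsCompact k) :
    ∃ C X : ℝ, ∀ p : ℂ, X ≤ |p.re| → ∀ b ∈ k, ‖logistic p / (exp p - exp b)‖ ≤ C := by
  obtain ⟨B, hB, hb⟩ := exists_abs_re_le_of_isCompact hk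
  refine ⟨2 / (Real.exp (-B) / 2), B + 1, fun p hp b hbk => ?_⟩
  rw [norm_div]
  exact div_le_div₀ zero_le_two (norm_logistic_le (by linarith)) (by positivity)
    (norm_exp_sub_exp_ge hB hp (hb b hbk))

theorem IsCompact.exists_norm_ge {k : Set ℂ} (hk : IsCompact k) {f : ℂ → ℂ}
    (hf : ContinuousOn f k) (h0 : ∀ x ∈ k, f x ≠ 0) : ∃ m > 0, ∀ x ∈ k, m ≤ ‖f x‖ := by
  obtain ⟨C, hC⟩ := hk.exists_bound_of_continuousOn (hf.inv₀ h0)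
  refine ⟨(max C 1)⁻¹, by positivity, fun x hx => ?_⟩
  have h1 := (hC x hx).trans (le_max_left C 1)
  rw [Pi.inv_apply, norm_inv] at h1
  exact inv_le_of_inv_le₀ (norm_pos_iff.2 (h0 x hx)) h1

theorem continuousOn_softplus : ContinuousOn softplus logStrip := fun _ hp =>
  (hasDerivAt_softplus hp).continuousAt.continuousWithinAt

theorem continuousOn_logistic : ContinuousOn logistic logStrip := fun _ hp =>
  (hasDerivAt_logistic hp).continuousAt.continuousWithinAt

/-- Up to bounded terms the gap is linear near the ends, with slope `-logistic p₀` on the left and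
`1 - logistic p₀` on the right. Both slopes are bounded away from zero on a compact set. -/
theorem exists_tangentGap_ge {k : Set ℂ} (hk : IsCompact k) (hks : k ⊆ logStrip) :
    ∃ m > 0, ∃ C : ℝ, ∀ p₀ ∈ k, ∀ p ∈ logStrip, 1 ≤ |p.re| →
      m * |p.re| - C ≤ ‖tangentGap p₀ p‖ := by
  obtain ⟨m₁, hm₁, h₁⟩ := hk.exists_norm_ge (continuousOn_logistic.mono hks)
    fun p hp => logistic_ne_zero (hks hp)
  obtain ⟨m₂, hm₂, h₂⟩ := hk.exists_norm_ge
    (continuousOn_const.sub (continuousOn_logistic.mono hks))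
    fun p hp => one_sub_logistic_ne_zero (hks hp)
  obtain ⟨C, hC⟩ := hk.exists_bound_of_continuousOn
    (f := fun p₀ => logistic p₀ * p₀ - softplus p₀)
    (((continuousOn_logistic.mono hks).mul continuousOn_id).sub (continuousOn_softplus.mono hks))
  refine ⟨min m₁ m₂, lt_min hm₁ hm₂, 1 + C, fun p₀ h₀ p hp hre => ?_⟩
  have hn := abs_re_le_norm p
  have hC' := hC p₀ h₀
  have key : ∀ (a r : ℂ) (m : ℝ), 0 ≤ m → m ≤ ‖a‖ → ‖r‖ ≤ 1 → tangentGap p₀ p =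
      r + a * p + (logistic p₀ * p₀ - softplus p₀) → m * |p.re| - (1 + C) ≤ ‖tangentGap p₀ p‖ := by
    intro a r m hm ha hr h
    have e : a * p = tangentGap p₀ p - (r + (logistic p₀ * p₀ - softplus p₀)) := by rw [h]; ring
    have h3 := (norm_sub_le _ _).trans (add_le_add_right (norm_add_le r
      (logistic p₀ * p₀ - softplus p₀)) ‖tangentGap p₀ p‖)
    rw [← e, norm_mul] at h3
    have := mul_le_mul ha hn (abs_nonneg _) (norm_nonneg _)
    linarith
  have hle : min m₁ m₂ * |p.re| ≤ m₁ * |p.re| :=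
    mul_le_mul_of_nonneg_right (min_le_left _ _) (abs_nonneg _)
  have hle' : min m₁ m₂ * |p.re| ≤ m₂ * |p.re| :=
    mul_le_mul_of_nonneg_right (min_le_right _ _) (abs_nonneg _)
  rcases le_abs'.1 hre with h | h
  · have := key (-logistic p₀) (softplus p) m₁ hm₁.le (by rw [norm_neg]; exact h₁ p₀ h₀)
      (norm_softplus_le h) (by rw [tangentGap]; ring)
    linarith
  · have := key (1 - logistic p₀) (softplus p - p) m₂ hm₂.le (h₂ p₀ h₀)
      (norm_softplus_sub_self_le hp h) (by rw [tangentGap]; ring)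
    linarith

/-- The uniformizing coordinate tends to infinity at the ends of the strip. -/
theorem exists_saddleCoord_ge {k : Set ℂ} (hk : IsCompact k) (hks : k ⊆ logStrip) (M : ℝ) :
    ∃ X : ℝ, 1 ≤ X ∧ ∀ p₀ ∈ k, ∀ p ∈ logStrip, X ≤ |p.re| → M ≤ ‖saddleCoord p₀ p‖ := by
  obtain ⟨m, hm, C, h⟩ := exists_tangentGap_ge hk hks
  obtain ⟨S, hS⟩ := hk.exists_bound_of_continuousOn (continuousOn_logisticDeriv.mono hks)
  refine ⟨max 1 ((C + max S 0 * M ^ 2) / m), le_max_left _ _, fun p₀ h₀ p hp hre => ?_⟩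
  have h1 := h p₀ h₀ p hp ((le_max_left _ _).trans hre)
  have h2 := (div_le_iff₀ hm).1 ((le_max_right _ _).trans hre)
  rw [← saddleCoord_sq (hks h₀) hp, norm_mul, norm_div, norm_pow, Complex.norm_ofNat] at h1
  have h3 : max S 0 * M ^ 2 ≤ max S 0 / 2 * ‖saddleCoord p₀ p‖ ^ 2 := by
    have : ‖logisticDeriv p₀‖ / 2 * ‖saddleCoord p₀ p‖ ^ 2 ≤
        max S 0 / 2 * ‖saddleCoord p₀ p‖ ^ 2 := by
      have := (hS p₀ h₀).trans (le_max_left S 0)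
      gcongr
    linarith
  have hpos : 0 < max S 0 := lt_of_lt_of_le (norm_pos_iff.2 (logisticDeriv_ne_zero (hks h₀)))
    ((hS p₀ h₀).trans (le_max_left S 0))
  have h4 : M ^ 2 ≤ ‖saddleCoord p₀ p‖ ^ 2 := by
    have : max S 0 * M ^ 2 ≤ max S 0 * ‖saddleCoord p₀ p‖ ^ 2 := by
      have := mul_nonneg hpos.le (sq_nonneg ‖saddleCoord p₀ p‖)
      linarith
    exact le_of_mul_le_mul_left this hpos
  exact (le_abs_self M).trans (abs_le_of_sq_le_sq h4 (norm_nonneg _))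

/-- By `saddleCoord_mul_deriv` the product is a difference of logistic values over `logisticDeriv
p₀`. -/
theorem exists_tail_bound_mul_deriv {k : Set ℂ} (hk : IsCompact k) (hks : k ⊆ logStrip) :
    ∃ C : ℝ, 0 ≤ C ∧ ∀ p₀ ∈ k, ∀ p ∈ logStrip, 1 ≤ |p.re| →
      ‖saddleCoord p₀ p * deriv (saddleCoord p₀) p‖ ≤ C := by
  obtain ⟨m, hm, h⟩ := hk.exists_norm_ge (continuousOn_logisticDeriv.mono hks)
    fun p hp => logisticDeriv_ne_zero (hks hp)
  obtain ⟨S, hS⟩ := hk.exists_bound_of_continuousOn (continuousOn_logistic.mono hks)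
  refine ⟨(2 + max S 0) / m, by positivity, fun p₀ h₀ p hp hre => ?_⟩
  have h1 := saddleCoord_mul_deriv (hks h₀) hp
  rw [eq_div_of_mul_eq (logisticDeriv_ne_zero (hks h₀)) ((mul_comm _ _).trans h1), norm_div]
  refine div_le_div₀ (by positivity) ?_ hm (h p₀ h₀)
  exact (norm_sub_le _ _).trans (add_le_add (norm_logistic_le hre)
    ((hS p₀ h₀).trans (le_max_left _ _)))

theorem exists_tail_bound_deriv_saddleCoord {k : Set ℂ} (hk : IsCompact k) (hks : k ⊆ logStrip) :
    ∃ C X : ℝ, 0 ≤ C ∧ 1 ≤ X ∧ ∀ p₀ ∈ k, ∀ p ∈ logStrip, X ≤ |p.re| →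
      ‖deriv (saddleCoord p₀) p‖ ≤ C := by
  obtain ⟨C, hC0, hC⟩ := exists_tail_bound_mul_deriv hk hks
  obtain ⟨X, hX1, hX⟩ := exists_saddleCoord_ge hk hks 1
  refine ⟨C, X, hC0, hX1, fun p₀ h₀ p hp hre => ?_⟩
  have h1 := hC p₀ h₀ p hp (hX1.trans hre)
  rw [norm_mul] at h1
  have := hX p₀ h₀ p hp hre
  nlinarith [norm_nonneg (deriv (saddleCoord p₀) p)]

theorem exists_tail_saddleCoord_sub_ge {k l : Set ℂ} (hk : IsCompact k) (hks : k ⊆ logStrip)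
    (hl : IsCompact l) (hls : l ⊆ logStrip) (M : ℝ) :
    ∃ X : ℝ, 1 ≤ X ∧ ∀ p₀ ∈ k, ∀ b ∈ l, ∀ p ∈ logStrip, X ≤ |p.re| →
      M ≤ ‖saddleCoord p₀ p - saddleCoord p₀ b‖ := by
  obtain ⟨B, hB⟩ := (hk.prod hl).exists_bound_of_continuousOn
    (continuousOn_saddleCoord.mono (prod_mono hks hls))
  obtain ⟨X, hX1, hX⟩ := exists_saddleCoord_ge hk hks (M + B)
  refine ⟨X, hX1, fun p₀ h₀ b hb p hp hre => ?_⟩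
  have h1 := hX p₀ h₀ p hp hre
  have h2 := hB (p₀, b) ⟨h₀, hb⟩
  have h3 := norm_sub_norm_le (saddleCoord p₀ p) (saddleCoord p₀ b)
  linarith

/-- The kernel `u'(p) / (u(p) - u(b))` is bounded near the ends of the strip. -/
theorem exists_tail_bound_deriv_div {k l : Set ℂ} (hk : IsCompact k) (hks : k ⊆ logStrip)
    (hl : IsCompact l) (hls : l ⊆ logStrip) :
    ∃ C X : ℝ, ∀ p₀ ∈ k, ∀ b ∈ l, ∀ p ∈ logStrip, X ≤ |p.re| →
      ‖deriv (saddleCoord p₀) p / (saddleCoord p₀ p - saddleCoord p₀ b)‖ ≤ C := by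
  obtain ⟨C, X₁, hC0, -, hC⟩ := exists_tail_bound_deriv_saddleCoord hk hks
  obtain ⟨X₂, -, hX⟩ := exists_tail_saddleCoord_sub_ge hk hks hl hls 1
  refine ⟨C, max X₁ X₂, fun p₀ h₀ b hb p hp hre => ?_⟩
  have h1 := hC p₀ h₀ p hp ((le_max_left _ _).trans hre)
  have h2 := hX p₀ h₀ b hb p hp ((le_max_right _ _).trans hre)
  rw [norm_div, div_le_iff₀ (by linarith)]
  nlinarith

end

/-! ### Euler's integral in the variable `x` with `t = 1/(1+e^x)`. -/

noncomputable section

section beta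

variable {N₀ N₁ : ℂ}

theorem one_add_exp_ofReal (x : ℝ) : 1 + exp (x : ℂ) = ((1 + Real.exp x : ℝ) : ℂ) := by
  push_cast; rfl

theorem ofReal_mem_logStrip (x : ℝ) : (x : ℂ) ∈ logStrip := by
  simp [mem_logStrip, Real.pi_pos]

theorem exp_phase_ofReal (x : ℝ) : exp (phase N₀ N₁ x) =
    (((1 + Real.exp x)⁻¹ : ℝ) : ℂ) ^ N₀ * ((1 - (1 + Real.exp x)⁻¹ : ℝ) : ℂ) ^ N₁ := by
  have hpos : (0 : ℝ) < 1 + Real.exp x := by positivity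
  have h1 : softplus x = (Real.log (1 + Real.exp x) : ℂ) := by
    rw [softplus, one_add_exp_ofReal, ofReal_log hpos.le]
  have e2 : 1 - (1 + Real.exp x)⁻¹ = Real.exp (x - Real.log (1 + Real.exp x)) := by
    rw [Real.exp_sub, Real.exp_log hpos]; field_simp; ring
  have e1 : (1 + Real.exp x)⁻¹ = Real.exp (-Real.log (1 + Real.exp x)) := by
    rw [Real.exp_neg, Real.exp_log hpos]
  rw [e2, e1, phase, h1, cpow_def_of_ne_zero (by simp),
    cpow_def_of_ne_zero (by simp), ← ofReal_log (Real.exp_pos _).le,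
    ← ofReal_log (Real.exp_pos _).le, Real.log_exp, Real.log_exp, ← exp_add]
  congr 1; push_cast; ring

/-- Under `t = 1/(1+e^x)` the weight `t^{N₀}(1-t)^{N₁}` becomes `e^{φ(x)}`, the Jacobian is
`logisticDeriv`, and the last factor is `t^n`. -/
theorem betaIntegral_eq_integral_exp_phase (n : ℕ) : betaIntegral (N₀ + 1 + n) (N₁ + 1) =
    ∫ x : ℝ, exp (phase N₀ N₁ x) * (logisticDeriv x * (1 / (1 + exp (x : ℂ))) ^ n) := by
  have himg : (fun x : ℝ => (1 + Real.exp x)⁻¹) '' univ = Ioo 0 1 := by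
    ext t
    simp only [image_univ, mem_range, mem_Ioo]
    constructor
    · rintro ⟨x, rfl⟩
      exact ⟨by positivity, inv_lt_one_of_one_lt₀ (by linarith [Real.exp_pos x])⟩
    · rintro ⟨h0, h1⟩
      refine ⟨Real.log (t⁻¹ - 1), ?_⟩
      rw [Real.exp_log (by linarith [(one_lt_inv₀ h0).2 h1])]; simp
  have hder : ∀ x ∈ (univ : Set ℝ), HasDerivWithinAt (fun x : ℝ => (1 + Real.exp x)⁻¹)
      (-Real.exp x / (1 + Real.exp x) ^ 2) univ x := fun x _ =>
    (((Real.hasDerivAt_exp x).const_add 1).inv (by positivity)).hasDerivWithinAt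
  have hinj : InjOn (fun x : ℝ => (1 + Real.exp x)⁻¹) univ := fun x _ y _ h =>
    Real.exp_injective (add_left_cancel (inv_injective h))
  have := integral_image_eq_integral_abs_deriv_smul MeasurableSet.univ hder hinj
    (fun t : ℝ => (t : ℂ) ^ (N₀ + 1 + n - 1) * (1 - (t : ℂ)) ^ (N₁ + 1 - 1))
  rw [betaIntegral, intervalIntegral.integral_of_le zero_le_one,
    integral_Ioc_eq_integral_Ioo, ← himg, this, setIntegral_univ]
  refine integral_congr_ae (Eventually.of_forall fun x => ?_)
  have hpos : (0 : ℝ) < 1 + Real.exp x := by positivity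
  have hne : (((1 + Real.exp x)⁻¹ : ℝ) : ℂ) ≠ 0 := ofReal_ne_zero.2 (by positivity)
  simp only
  rw [exp_phase_ofReal, abs_div, abs_neg, Real.abs_exp, abs_of_pos (by positivity),
    show N₀ + 1 + n - 1 = N₀ + n by ring, add_sub_cancel_right, cpow_add _ _ hne, cpow_natCast,
    logisticDeriv, one_add_exp_ofReal, real_smul]
  push_cast
  rw [one_div]
  ring

theorem Gamma_mul_ascPochhammer_div (hN₀ : 0 < N₀.re) (hN₁ : 0 < N₁.re) (n : ℕ) :
    Gamma (N₀ + 1) * Gamma (N₁ + 1) / Gamma (N₀ + N₁ + 2) *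
      ((n.factorial : ℂ)⁻¹ * (ascPochhammer ℂ n).eval 1 * (ascPochhammer ℂ n).eval (N₀ + 1) *
        ((ascPochhammer ℂ n).eval (N₀ + N₁ + 2))⁻¹) = betaIntegral (N₀ + 1 + n) (N₁ + 1) := by
  have hre : ∀ z : ℂ, 0 < z.re → ∀ m : ℕ, z ≠ -m := fun z hz m h => by
    rw [h] at hz; simp at hz; linarith [m.cast_nonneg (α := ℝ)]
  have hc : 0 < (N₀ + N₁ + 2).re := by simp; linarith
  have ha : 0 < (N₀ + 1).re := by simp; linarith
  have hcn : 0 < (N₀ + N₁ + 2 + n).re := by simp; positivity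
  have h1 := Gamma_mul_Gamma_eq_betaIntegral (s := N₀ + 1 + n) (t := N₁ + 1)
    (by simp; positivity) (by simp; linarith)
  have hG := Gamma_ne_zero (hre _ hcn)
  have hGc := Gamma_ne_zero (hre _ hc)
  have hGa := Gamma_ne_zero (hre _ ha)
  rw [show N₀ + 1 + n + (N₁ + 1) = N₀ + N₁ + 2 + n by ring] at h1
  rw [← Gamma_add_nat_div_Gamma_eq _ (hre _ hc), ← Gamma_add_nat_div_Gamma_eq _ (hre _ ha),
    ascPochhammer_eval_one]
  have hf : (n.factorial : ℂ) ≠ 0 := by exact_mod_cast n.factorial_ne_zero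
  field_simp
  linear_combination h1

/-- Euler's integral, in the exponential variable. -/
theorem Gamma_mul_ordinaryHypergeometric (hN₀ : 0 < N₀.re) (hN₁ : 0 < N₁.re) {z : ℂ}
    (hz : ‖z‖ < 1) :
    Gamma (N₀ + 1) * Gamma (N₁ + 1) / Gamma (N₀ + N₁ + 2) *
      ordinaryHypergeometric 1 (N₀ + 1) (N₀ + N₁ + 2) z =
      ∫ x : ℝ, exp (phase N₀ N₁ x) * (logistic x / (exp x - (z - 1))) := by
  have hpos : ∀ x : ℝ, (0 : ℝ) < 1 + Real.exp x := fun x => by positivity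
  have hle : ∀ x : ℝ, ‖1 / (1 + exp (x : ℂ))‖ ≤ 1 := fun x => by
    rw [one_add_exp_ofReal, norm_div, norm_one, norm_real, Real.norm_eq_abs, abs_of_pos (hpos x),
      div_le_one (hpos x)]
    linarith [Real.exp_pos x]
  have hD : ∀ x : ℝ, ‖logisticDeriv x‖ ≤ 1 := fun x => by
    rw [logisticDeriv, one_add_exp_ofReal, norm_div, norm_pow, norm_real, Real.norm_eq_abs,
      abs_of_pos (hpos x), norm_exp, ofReal_re, div_le_one (by positivity)]
    nlinarith [Real.exp_pos x]
  have hw : Integrable fun x : ℝ => exp (phase N₀ N₁ x) := by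
    have := integrable_exp_phase_mul hN₀ hN₁ (G := fun _ => 1) (θ := 0) (C := 1) (X := 0)
      (by linarith [Real.pi_pos]) Real.pi_pos continuousOn_const (by simp)
    simpa using this
  have hcont : ∀ n : ℕ, Continuous fun x : ℝ =>
      logisticDeriv x * (1 / (1 + exp (x : ℂ))) ^ n := fun n => by
    refine (continuousOn_logisticDeriv.comp_continuous continuous_ofReal
      ofReal_mem_logStrip).mul (Continuous.pow ?_ n)
    exact continuous_const.div (by fun_prop) fun x => one_add_exp_ne_zero (ofReal_mem_logStrip x)
  -- The terms of the geometric series of `1/(1 - zt)` against the beta weight. Since `0 < t < 1`,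
  -- they are dominated by those of the series in `‖z‖`, and their integrals are the hypergeometric
  -- coefficients times the gamma quotient.
  let f : ℕ → ℝ → ℂ := fun n x => z ^ n *
    (exp (phase N₀ N₁ x) * (logisticDeriv x * (1 / (1 + exp (x : ℂ))) ^ n))
  have hbd : ∀ n x, ‖f n x‖ ≤ ‖z‖ ^ n * ‖exp (phase N₀ N₁ x)‖ := fun n x => by
    simp only [f]
    rw [norm_mul, norm_mul, norm_mul, norm_pow, norm_pow]
    have h1 := mul_le_one₀ (hD x) (by positivity) (pow_le_one₀ (norm_nonneg _) (hle x) (n := n))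
    exact mul_le_mul_of_nonneg_left (mul_le_of_le_one_right (norm_nonneg _) h1) (by positivity)
  have hint : ∀ n, Integrable (f n) := fun n =>
    (hw.norm.const_mul (‖z‖ ^ n)).mono' ((hw.1.mul (hcont n).aestronglyMeasurable).const_mul _)
      (Eventually.of_forall (hbd n))
  have hsum : Summable fun n => ∫ x, ‖f n x‖ := by
    refine Summable.of_nonneg_of_le (fun n => integral_nonneg fun x => norm_nonneg _) (fun n => ?_)
      ((summable_geometric_of_lt_one (norm_nonneg z) hz).mul_right
        (∫ x : ℝ, ‖exp (phase N₀ N₁ x)‖))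
    rw [← integral_const_mul]
    exact integral_mono (hint n).norm (hw.norm.const_mul _) (hbd n)
  have h := (hasSum_integral_of_summable_integral_norm hint hsum).tsum_eq
  have hterm : ∀ n, ∫ x, f n x = z ^ n * betaIntegral (N₀ + 1 + n) (N₁ + 1) := fun n => by
    rw [betaIntegral_eq_integral_exp_phase, ← integral_const_mul]
  simp only [hterm] at h
  rw [ordinaryHypergeometric_eq_tsum]
  simp only [smul_eq_mul]
  rw [← tsum_mul_left]
  convert h using 1
  · refine tsum_congr fun n => ?_
    rw [← Gamma_mul_ascPochhammer_div hN₀ hN₁ n]; ring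
  · refine integral_congr_ae (Eventually.of_forall fun x => ?_)
    have h1 := one_add_exp_ne_zero (ofReal_mem_logStrip x)
    have hlt : ‖z * (1 / (1 + exp (x : ℂ)))‖ < 1 := by
      rw [norm_mul]
      exact (mul_le_of_le_one_right (norm_nonneg _) (hle x)).trans_lt hz
    have h2 : 1 - z * (1 / (1 + exp (x : ℂ))) ≠ 0 := fun h => by
      rw [← sub_eq_zero.1 h] at hlt; simp at hlt
    have h3 : exp (x : ℂ) - (z - 1) ≠ 0 := fun h => h2 (by
      have : z = 1 + exp (x : ℂ) := by linear_combination -h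
      rw [this]; field_simp; ring)
    have hg := tsum_geometric_of_norm_lt_one hlt
    have : ∀ n, f n x = exp (phase N₀ N₁ x) * logisticDeriv x *
        (z * (1 / (1 + exp (x : ℂ)))) ^ n := fun n => by simp only [f]; rw [mul_pow]; ring
    simp only [this]
    rw [tsum_mul_left, hg, logistic, logisticDeriv]
    have h4 : 1 - z * (1 / (1 + exp (x : ℂ))) = (exp x - (z - 1)) / (1 + exp x) := by
      field_simp; ring
    rw [h4]; field_simp

end beta

end

/-! ### Analytic continuation of `I` by moving the line of integration. -/

noncomputable section

/-- The integral of Euler's integrand in the exponential variable, along the line `Im p = θ`. -/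
def lineEuler (N₀ N₁ : ℂ) (θ : ℝ) (b : ℂ) : ℂ :=
  ∫ x : ℝ, exp (phase N₀ N₁ (x + θ * I)) *
    (logistic (x + θ * I) / (exp (x + θ * I) - exp b))

theorem exp_sub_exp_ne_zero {p b : ℂ} (hp : p ∈ logStrip) (hb : b ∈ logStrip) (h : p ≠ b) :
    exp p - exp b ≠ 0 := fun h0 => h (exp_injOn_logStrip hp hb (sub_eq_zero.1 h0))

section branch

variable {N₀ N₁ : ℂ}

/-- In the strip the only pole of the integrand is `b`, and both lines run below it. -/
theorem lineEuler_eq_of_le (hN₀ : 0 < N₀.re) (hN₁ : 0 < N₁.re) {θ₁ θ₂ : ℝ} {b : ℂ}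
    (h₁ : -Real.pi < θ₁) (hθ : θ₁ ≤ θ₂) (h₂ : θ₂ < b.im) (hb : b ∈ logStrip) :
    lineEuler N₀ N₁ θ₁ b = lineEuler N₀ N₁ θ₂ b := by
  have hb2 := (abs_lt.1 (mem_logStrip.1 hb)).2
  obtain ⟨C, X, h⟩ := exists_tail_bound_logistic_div (k := {b}) isCompact_singleton
  refine integral_exp_phase_mul_shift hN₀ hN₁ (G := fun p => logistic p / (exp p - exp b)) hθ h₁
    (h₂.trans hb2) (fun p hp => ?_) (C := C) (X := X) fun p _ hX => h p hX b rfl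
  have hpS := closedStrip_subset_logStrip h₁ (h₂.trans hb2) hp
  refine ((hasDerivAt_logistic hpS).differentiableAt.div (by fun_prop)
    (exp_sub_exp_ne_zero hpS hb ?_)).differentiableWithinAt
  intro h; rw [h] at hp; exact absurd hp.2 (not_le.2 h₂)

theorem lineEuler_eq (hN₀ : 0 < N₀.re) (hN₁ : 0 < N₁.re) {θ₁ θ₂ : ℝ} {b : ℂ}
    (h₁ : -Real.pi < θ₁) (h₂ : -Real.pi < θ₂) (hb₁ : θ₁ < b.im) (hb₂ : θ₂ < b.im)
    (hb : b ∈ logStrip) : lineEuler N₀ N₁ θ₁ b = lineEuler N₀ N₁ θ₂ b := by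
  rcases le_total θ₁ θ₂ with h | h
  · exact lineEuler_eq_of_le hN₀ hN₁ h₁ h hb₂ hb
  · exact (lineEuler_eq_of_le hN₀ hN₁ h₂ h hb₁ hb).symm

theorem isOpen_logStrip_above (θ : ℝ) : IsOpen (logStrip ∩ {b | θ < b.im}) :=
  isOpen_logStrip.inter (isOpen_lt continuous_const continuous_im)

theorem differentiableOn_lineEuler (hN₀ : 0 < N₀.re) (hN₁ : 0 < N₁.re) {θ : ℝ}
    (h₁ : -Real.pi < θ) (h₂ : θ < Real.pi) :
    DifferentiableOn ℂ (lineEuler N₀ N₁ θ) (logStrip ∩ {b | θ < b.im}) := by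
  have hne : ∀ p ∈ closedStrip θ θ, ∀ b ∈ logStrip ∩ {b : ℂ | θ < b.im}, exp p - exp b ≠ 0 :=
    fun p hp b hb => by
      refine exp_sub_exp_ne_zero (closedStrip_subset_logStrip h₁ h₂ hp) hb.1 fun h => ?_
      rw [h] at hp; exact absurd hp.2 (not_le.2 hb.2)
  refine differentiableOn_integral_exp_phase_mul hN₀ hN₁
    (G := fun x => logistic x.1 / (exp x.1 - exp x.2)) (isOpen_logStrip_above θ) h₁ h₂ ?_ ?_ ?_
  · refine ContinuousOn.div ?_ (by fun_prop) fun x hx => hne x.1 hx.1 x.2 hx.2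
    exact continuousOn_logistic.comp continuousOn_fst
      fun x hx => closedStrip_subset_logStrip h₁ h₂ hx.1
  · intro p hp
    exact DifferentiableOn.div (differentiableOn_const (logistic p)) (by fun_prop) fun b hb => hne p hp b hb
  · intro k hk hkc
    obtain ⟨C, X, h⟩ := exists_tail_bound_logistic_div hkc
    exact ⟨C, X, fun p _ hX b hb => h p hX b hb⟩

theorem isPreconnected_slitPlane_sub_one : IsPreconnected {z : ℂ | z - 1 ∈ slitPlane} := by
  have h := (starConvex_one_slitPlane.isPathConnected one_mem_slitPlane).isConnected.isPreconnected
  have := h.image (fun z => z + 1) (by fun_prop)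
  convert this using 1
  ext z
  simp only [mem_ofPred_eq, mem_image]
  exact ⟨fun hz => ⟨z - 1, hz, by ring⟩, by rintro ⟨w, hw, rfl⟩; simpa using hw⟩

theorem isOpen_slitPlane_sub_one : IsOpen {z : ℂ | z - 1 ∈ slitPlane} :=
  isOpen_slitPlane.preimage (continuous_id.sub continuous_const)

theorem IsHypergeometricBranch.eqOn {a b c : ℂ} {F₁ F₂ : ℂ → ℂ}
    (h₁ : IsHypergeometricBranch a b c F₁) (h₂ : IsHypergeometricBranch a b c F₂) :
    EqOn F₁ F₂ {z | z - 1 ∈ slitPlane} := by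
  refine AnalyticOnNhd.eqOn_of_preconnected_of_eventuallyEq
    (h₁.1.analyticOnNhd isOpen_slitPlane_sub_one) (h₂.1.analyticOnNhd isOpen_slitPlane_sub_one)
    isPreconnected_slitPlane_sub_one (z₀ := I / 2) ?_ ?_
  · simp [mem_slitPlane_iff]
  · have hU : IsOpen {z : ℂ | ‖z‖ < 1 ∧ 0 < z.im} :=
      (isOpen_lt continuous_norm continuous_const).inter (isOpen_lt continuous_const continuous_im)
    filter_upwards [hU.mem_nhds (show I / 2 ∈ _ by simp; norm_num)] with z hz
    rw [h₁.2 z hz.1 hz.2, h₂.2 z hz.1 hz.2]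

theorem Gamma_quotient_ne_zero (hN₀ : 0 < N₀.re) (hN₁ : 0 < N₁.re) :
    Gamma (N₀ + 1) * Gamma (N₁ + 1) / Gamma (N₀ + N₁ + 2) ≠ 0 := by
  refine div_ne_zero (mul_ne_zero ?_ ?_) ?_ <;> refine Gamma_ne_zero_of_re_pos ?_ <;> simp <;>
    linarith

/-- The Euler integral along a line half-way between `Im b` and `-π`, in terms of `1 + e^b`. -/
def eulerBranch (N₀ N₁ z : ℂ) : ℂ :=
  (Gamma (N₀ + 1) * Gamma (N₁ + 1) / Gamma (N₀ + N₁ + 2))⁻¹ *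
    lineEuler N₀ N₁ (((log (z - 1)).im - Real.pi) / 2) (log (z - 1))

theorem isHypergeometricBranch_eulerBranch (hN₀ : 0 < N₀.re) (hN₁ : 0 < N₁.re) :
    IsHypergeometricBranch 1 (N₀ + 1) (N₀ + N₁ + 2) (eulerBranch N₀ N₁) := by
  constructor
  · intro z hz
    have hz' : z - 1 ∈ slitPlane := hz
    set b := log (z - 1) with hbdef
    have hb := log_mem_logStrip hz'
    have hb' := abs_lt.1 (mem_logStrip.1 hb)
    have hlog : DifferentiableAt ℂ (fun z => log (z - 1)) z :=
      (differentiableAt_id.sub_const 1).clog hz'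
    -- The line is frozen at its position for the point `z`. For nearby points the integral along
    -- their own line is the same, since both lines stay below the pole.
    set θ := (b.im - Real.pi) / 2 with hθ
    have hθ₁ : -Real.pi < θ := by rw [hθ]; linarith
    have hθ₂ : θ < b.im := by rw [hθ]; linarith
    have hbU : b ∈ logStrip ∩ {b : ℂ | θ < b.im} := ⟨hb, hθ₂⟩
    have h1 : DifferentiableAt ℂ (fun z => lineEuler N₀ N₁ θ (log (z - 1))) z :=
      DifferentiableAt.comp (g := lineEuler N₀ N₁ θ) z
        ((differentiableOn_lineEuler hN₀ hN₁ hθ₁ (hθ₂.trans hb'.2)).differentiableAt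
        ((isOpen_logStrip_above θ).mem_nhds hbU)) hlog
    refine DifferentiableAt.differentiableWithinAt (DifferentiableAt.const_mul
      (h1.congr_of_eventuallyEq ?_) _)
    filter_upwards [hlog.continuousAt.eventually_mem ((isOpen_logStrip_above θ).mem_nhds hbU)]
      with w hw
    have hw' := abs_lt.1 (mem_logStrip.1 hw.1)
    have hw2 : θ < (log (w - 1)).im := hw.2
    exact lineEuler_eq hN₀ hN₁ (by linarith) hθ₁ (by linarith) hw2 hw.1
  · intro z hz him
    have him' : 0 < (z - 1).im := by simpa using him
    have hz' : z - 1 ∈ slitPlane := by rw [mem_slitPlane_iff]; right; exact him'.ne'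
    have hb := log_mem_logStrip hz'
    have hb' := abs_lt.1 (mem_logStrip.1 hb)
    have h0 : 0 < (log (z - 1)).im := by
      rw [log_im, ← not_le]
      intro h
      rcases h.lt_or_eq with h | h
      · exact absurd (arg_neg_iff.1 h) (not_lt.2 him'.le)
      · exact him'.ne' (arg_eq_zero_iff.1 h).2
    -- For `Im z > 0` the pole lies above the real axis, so the line may be raised to the axis
    -- itself, where the power series is known.
    rw [eulerBranch, lineEuler_eq hN₀ hN₁ (θ₂ := 0) (by linarith) (by linarith [Real.pi_pos])
      (by linarith) h0 hb, inv_mul_eq_iff_eq_mul₀ (Gamma_quotient_ne_zero hN₀ hN₁),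
      Gamma_mul_ordinaryHypergeometric hN₀ hN₁ hz, lineEuler, exp_log (slitPlane_ne_zero hz')]
    simp

theorem isHypergeometricBranch_hypergeometricBranch (hN₀ : 0 < N₀.re) (hN₁ : 0 < N₁.re) :
    IsHypergeometricBranch 1 (N₀ + 1) (N₀ + N₁ + 2)
      (hypergeometricBranch 1 (N₀ + 1) (N₀ + N₁ + 2)) :=
  Classical.epsilon_spec ⟨_, isHypergeometricBranch_eulerBranch hN₀ hN₁⟩

theorem hypergeometricI_eq_lineEuler (hN₀ : 0 < N₀.re) (hN₁ : 0 < N₁.re) {b : ℂ} {θ : ℝ}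
    (hb : b ∈ logStrip) (h₁ : -Real.pi < θ) (h₂ : θ < b.im) :
    hypergeometricI N₀ N₁ (exp b) = lineEuler N₀ N₁ θ b := by
  have hb' := abs_lt.1 (mem_logStrip.1 hb)
  have hz : 1 + exp b - 1 ∈ slitPlane := by
    rw [add_sub_cancel_left]; exact exp_mem_slitPlane_of_mem hb
  have := (isHypergeometricBranch_hypergeometricBranch hN₀ hN₁).eqOn
    (isHypergeometricBranch_eulerBranch hN₀ hN₁) hz
  rw [hypergeometricI, this, eulerBranch, mul_inv_cancel_left₀ (Gamma_quotient_ne_zero hN₀ hN₁),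
    add_sub_cancel_left, log_exp_of_mem_logStrip hb]
  exact lineEuler_eq hN₀ hN₁ (by linarith) h₁ (by linarith) h₂ hb

end branch

end

/-! ### The complementary error function and Gaussian integrals along paths. -/

noncomputable section

theorem norm_exp_neg_add_sq (z : ℂ) (x : ℝ) :
    ‖exp (-(z + x) ^ 2)‖ = Real.exp (-(z ^ 2).re - 2 * x * z.re - x ^ 2) := by
  rw [norm_exp]; congr 1; simp [sq]; ring

theorem norm_exp_neg_add_sq_le {B : ℝ} {z : ℂ} (hz : ‖z‖ ≤ B) (x : ℝ) :
    ‖exp (-(z + x) ^ 2)‖ ≤ Real.exp (3 * B ^ 2) * Real.exp (-(1 / 2) * x ^ 2) := by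
  rw [norm_exp_neg_add_sq, ← Real.exp_add, Real.exp_le_exp]
  have h1 := abs_le.1 ((abs_re_le_norm z).trans hz)
  have h2 : -(z ^ 2).re ≤ B ^ 2 := by
    have := (abs_le.1 (abs_re_le_norm (z ^ 2))).1
    rw [norm_pow] at this
    nlinarith [norm_nonneg z]
  nlinarith [sq_nonneg (x + 2 * z.re)]

theorem differentiable_erfc : Differentiable ℂ erfc := by
  have h : DifferentiableOn ℂ (fun z : ℂ => ∫ x in Ioi (0 : ℝ), exp (-(z + (x : ℂ)) ^ 2)) univ := by
    refine differentiableOn_integral_of_locally_dominated isOpen_univ (fun z _ => ?_)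
      (fun x => by fun_prop) fun z _ => ?_
    · exact Continuous.aestronglyMeasurable (by fun_prop)
    · refine ⟨fun x => Real.exp (3 * (‖z‖ + 1) ^ 2) * Real.exp (-(1 / 2) * x ^ 2),
        ((integrable_exp_neg_mul_sq (by norm_num)).const_mul _).integrableOn, ?_⟩
      filter_upwards [continuous_norm.continuousAt.eventually_lt continuousAt_const
        (show ‖z‖ < ‖z‖ + 1 by linarith)] with w hw x
      exact norm_exp_neg_add_sq_le hw.le x
  exact (differentiableOn_univ.1 h).const_mul _

theorem integrable_exp_neg_add_sq (z : ℂ) : Integrable fun x : ℝ => exp (-(z + (x : ℂ)) ^ 2) :=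
  ((integrable_exp_neg_mul_sq (by norm_num)).const_mul _).mono'
    (Continuous.aestronglyMeasurable (by fun_prop))
    (Eventually.of_forall (norm_exp_neg_add_sq_le le_rfl))

/-- A real shift of `z` only moves the lower end of the integral. As `erfc` is already known to be
complex differentiable, its derivative along the real direction suffices. -/
theorem hasDerivAt_erfc (z : ℂ) :
    HasDerivAt erfc (-(2 / (Real.sqrt Real.pi : ℂ)) * exp (-z ^ 2)) z := by
  have hd := (differentiable_erfc z).hasDerivAt
  have h1 : HasDerivAt (fun h : ℝ => erfc (z + h)) (deriv erfc z) 0 := by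
    have h2 : HasDerivAt (fun h : ℂ => erfc (z + h)) (deriv erfc z) ((0 : ℝ) : ℂ) := by
      have hd' : HasDerivAt erfc (deriv erfc z) (z + ((0 : ℝ) : ℂ)) := by simpa using hd
      exact hd'.comp_const_add z _
    exact h2.comp_ofReal
  have h3 : ∀ h : ℝ, erfc (z + h) = 2 / (Real.sqrt Real.pi : ℂ) *
      ((∫ x in Ioi (0 : ℝ), exp (-(z + (x : ℂ)) ^ 2)) -
        ∫ x in (0 : ℝ)..h, exp (-(z + (x : ℂ)) ^ 2)) := fun h => by
    have e : (∫ x in Ioi (0 : ℝ), exp (-(z + h + (x : ℂ)) ^ 2)) =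
        ∫ x in Ioi h, exp (-(z + (x : ℂ)) ^ 2) := by
      have := (measurePreserving_add_right volume h).setIntegral_preimage_emb
        (measurableEmbedding_addRight h) (fun x : ℝ => exp (-(z + (x : ℂ)) ^ 2)) (Ioi h)
      rw [preimage_add_const_Ioi, sub_self] at this
      rw [← this]
      refine integral_congr_ae (Eventually.of_forall fun x => ?_)
      simp only; push_cast; ring_nf
    rw [erfc, e, ← intervalIntegral.integral_Ioi_sub_Ioi'
      (integrable_exp_neg_add_sq z).integrableOn (integrable_exp_neg_add_sq z).integrableOn]
    ring
  have h4 : HasDerivAt (fun h : ℝ => erfc (z + h))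
      (2 / (Real.sqrt Real.pi : ℂ) * (0 - exp (-(z + ((0 : ℝ) : ℂ)) ^ 2))) 0 := by
    simp only [h3]
    have hcont : Continuous fun x : ℝ => exp (-(z + (x : ℂ)) ^ 2) := by fun_prop
    exact ((hasDerivAt_const _ _).sub
      (intervalIntegral.integral_hasDerivAt_right (hcont.intervalIntegrable 0 0)
        (hcont.stronglyMeasurableAtFilter _ _) hcont.continuousAt)).const_mul _
  rw [h1.unique h4] at hd
  exact hd.congr_deriv (by simp)

theorem erfc_zero : erfc 0 = 1 := by
  have h := integral_gaussian_Ioi 1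
  have h2 : (∫ x in Ioi (0 : ℝ), exp (-(0 + (x : ℂ)) ^ 2)) =
      ((∫ x in Ioi (0 : ℝ), Real.exp (-1 * x ^ 2) : ℝ) : ℂ) := by
    rw [← integral_complex_ofReal]
    refine integral_congr_ae (Eventually.of_forall fun x => ?_)
    simp
  rw [erfc, h2, h]
  have : (Real.sqrt Real.pi : ℂ) ≠ 0 := by
    rw [ofReal_ne_zero]; positivity
  push_cast; rw [div_one]; field_simp

theorem erfc_neg (z : ℂ) : erfc (-z) = 2 - erfc z := by
  have hd : ∀ z, HasDerivAt (fun z => erfc z + erfc (-z)) 0 z := fun z => by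
    have h1 := (hasDerivAt_erfc (-z)).comp z (hasDerivAt_neg z)
    exact ((hasDerivAt_erfc z).add h1).congr_deriv (by rw [neg_sq]; ring)
  have := is_const_of_deriv_eq_zero (fun z => (hd z).differentiableAt) (fun z => (hd z).deriv) z 0
  simp only [neg_zero, erfc_zero] at this
  linear_combination this

/-- For `Re z ≥ 0` and `x > 0` the cross term in `(z + x)²` only helps, leaving `e^{-Re z²}` times a
real Gaussian. -/
theorem norm_erfc_le {z : ℂ} (hz : 0 ≤ z.re) : ‖erfc z‖ ≤ Real.exp (-(z ^ 2).re) := by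
  have hg := integral_gaussian_Ioi 1
  have hsp : 0 < Real.sqrt Real.pi := Real.sqrt_pos.2 Real.pi_pos
  have h1 : ‖∫ x in Ioi (0 : ℝ), exp (-(z + (x : ℂ)) ^ 2)‖ ≤
      Real.exp (-(z ^ 2).re) * (Real.sqrt (Real.pi / 1) / 2) := by
    rw [← hg, ← integral_const_mul]
    refine norm_integral_le_of_norm_le
      ((integrable_exp_neg_mul_sq one_pos).const_mul _).integrableOn ?_
    refine (ae_restrict_iff' measurableSet_Ioi).2 (Eventually.of_forall fun x hx => ?_)
    rw [norm_exp_neg_add_sq, ← Real.exp_add, Real.exp_le_exp]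
    have : 0 < x := hx
    nlinarith [mul_nonneg this.le hz]
  rw [erfc, norm_mul, norm_div, norm_real, Complex.norm_ofNat, Real.norm_eq_abs, abs_of_pos hsp]
  rw [div_one] at h1
  calc _ ≤ 2 / Real.sqrt Real.pi * (Real.exp (-(z ^ 2).re) * (Real.sqrt Real.pi / 2)) := by gcongr
    _ = _ := by field_simp

/-- A path `Z` from `-∞` to `+∞` on which `e^{-Z²}` decays exponentially. -/
structure IsGaussPath (Z Z' : ℝ → ℂ) (C κ : ℝ) : Prop where
  hasDerivAt : ∀ x, HasDerivAt Z (Z' x) x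
  continuous : Continuous Z'
  re_sq_ge : ∀ x, |x| - κ ≤ (Z x ^ 2).re
  re_sq_nonneg : ∀ x, 0 ≤ (Z x ^ 2).re
  re_nonneg : ∀ x, 0 < x → 0 ≤ (Z x).re
  re_nonpos : ∀ x, x < 0 → (Z x).re ≤ 0
  norm_deriv_le : ∀ x, ‖Z' x‖ ≤ C
  norm_mul_deriv_le : ∀ x, ‖Z x * Z' x‖ ≤ C

namespace IsGaussPath

variable {Z Z' : ℝ → ℂ} {C κ : ℝ}

theorem continuous_path (h : IsGaussPath Z Z' C κ) : Continuous Z :=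
  continuous_iff_continuousAt.2 fun x => (h.hasDerivAt x).continuousAt

theorem norm_exp_le (h : IsGaussPath Z Z' C κ) {t : ℝ} (ht : 0 ≤ t) (x : ℝ) :
    ‖exp (-(t * Z x ^ 2))‖ ≤ Real.exp (t * κ) * Real.exp (-t * |x|) := by
  rw [norm_exp, ← Real.exp_add, Real.exp_le_exp, neg_re, re_ofReal_mul]
  have := h.re_sq_ge x
  nlinarith

theorem norm_exp_le_of_le (h : IsGaussPath Z Z' C κ) {t t₀ : ℝ} (ht₀ : 0 ≤ t₀) (ht : t₀ ≤ t)
    (x : ℝ) : ‖exp (-(t * Z x ^ 2))‖ ≤ Real.exp (t₀ * κ) * Real.exp (-t₀ * |x|) := by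
  refine le_trans ?_ (h.norm_exp_le ht₀ x)
  rw [norm_exp, norm_exp, Real.exp_le_exp, neg_re, re_ofReal_mul, neg_re, re_ofReal_mul]
  have := h.re_sq_nonneg x
  nlinarith

theorem integrable_mul (h : IsGaussPath Z Z' C κ) {t D : ℝ} (ht : 0 < t) {g : ℝ → ℂ}
    (hg : Continuous g) (hD : ∀ x, ‖g x‖ ≤ D) :
    Integrable fun x => exp (-(t * Z x ^ 2)) * g x := by
  have hc := h.continuous_path
  refine (((integrable_exp_neg_mul_abs ht).const_mul (Real.exp (t * κ))).mul_const D).mono'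
    (Continuous.aestronglyMeasurable (by fun_prop)) (Eventually.of_forall fun x => ?_)
  rw [norm_mul]
  exact mul_le_mul (h.norm_exp_le ht.le x) (hD x) (norm_nonneg _) (by positivity)

theorem tendsto_exp (h : IsGaussPath Z Z' C κ) {t : ℝ} (ht : 0 < t) {l : Filter ℝ}
    (hl : Tendsto (fun x : ℝ => |x|) l atTop) :
    Tendsto (fun x => exp (-(t * Z x ^ 2))) l (𝓝 0) := by
  refine squeeze_zero_norm (h.norm_exp_le ht.le) ?_
  have h3 : Tendsto (fun x : ℝ => Real.exp (-t * |x|)) l (𝓝 0) :=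
    Real.tendsto_exp_atBot.comp (hl.const_mul_atTop_of_neg (neg_neg_of_pos ht))
  simpa using h3.const_mul (Real.exp (t * κ))

/-- A primitive is a multiple of `erfc (√t Z)`. The sign of `Re Z` together with the decay of
`e^{-tZ²}` gives the limits `0` at `+∞` and, by reflection, `2` at `-∞`. -/
theorem integral_deriv (h : IsGaussPath Z Z' C κ) {t : ℝ} (ht : 0 < t) :
    ∫ x, exp (-(t * Z x ^ 2)) * Z' x = (Real.sqrt Real.pi / Real.sqrt t : ℂ) := by
  have hst : 0 < Real.sqrt t := Real.sqrt_pos.2 ht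
  have hst2 : (Real.sqrt t : ℂ) ^ 2 = t := by
    rw [← ofReal_pow, Real.sq_sqrt ht.le]
  have hst0 : (Real.sqrt t : ℂ) ≠ 0 := ofReal_ne_zero.2 hst.ne'
  have hsp0 : (Real.sqrt Real.pi : ℂ) ≠ 0 := by
    rw [ofReal_ne_zero]; positivity
  have hd : ∀ x, HasDerivAt (fun x => -(Real.sqrt Real.pi / (2 * Real.sqrt t) : ℂ) *
      erfc (Real.sqrt t * Z x)) (exp (-(t * Z x ^ 2)) * Z' x) x := fun x => by
    have h1 := ((hasDerivAt_erfc (Real.sqrt t * Z x)).comp x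
      ((h.hasDerivAt x).const_mul (Real.sqrt t : ℂ))).const_mul
      (-(Real.sqrt Real.pi / (2 * Real.sqrt t) : ℂ))
    refine h1.congr_deriv ?_
    rw [mul_pow, hst2]; field_simp
  have hsm : ∀ (σ : ℝ) {l : Filter ℝ}, Tendsto (fun x : ℝ => |x|) l atTop →
      (∀ᶠ x in l, 0 ≤ (σ * Z x).re) → σ ^ 2 = 1 →
      Tendsto (fun x => erfc (Real.sqrt t * (σ * Z x))) l (𝓝 0) := fun σ l hl hev hσ => by
    refine squeeze_zero_norm' ?_ ((h.tendsto_exp ht hl).norm.trans (by simp))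
    filter_upwards [hev] with x hx
    have := norm_erfc_le (z := Real.sqrt t * (σ * Z x)) (by
      rw [re_ofReal_mul]; exact mul_nonneg hst.le hx)
    rw [mul_pow, hst2, mul_pow, ← ofReal_pow, hσ, ofReal_one, one_mul] at this
    rwa [norm_exp]
  have htop : Tendsto (fun x => -(Real.sqrt Real.pi / (2 * Real.sqrt t) : ℂ) *
      erfc (Real.sqrt t * Z x)) atTop (𝓝 (-(Real.sqrt Real.pi / (2 * Real.sqrt t) : ℂ) * 0)) := by
    refine Tendsto.const_mul _ ?_
    have := hsm 1 tendsto_abs_atTop_atTop (by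
      filter_upwards [eventually_gt_atTop 0] with x hx
      simpa using h.re_nonneg x hx) (by norm_num)
    simpa using this
  have hbot : Tendsto (fun x => -(Real.sqrt Real.pi / (2 * Real.sqrt t) : ℂ) *
      erfc (Real.sqrt t * Z x)) atBot
      (𝓝 (-(Real.sqrt Real.pi / (2 * Real.sqrt t) : ℂ) * (2 - 0))) := by
    refine Tendsto.const_mul _ ?_
    have := hsm (-1) tendsto_abs_atBot_atTop (by
      filter_upwards [eventually_lt_atBot 0] with x hx
      simpa using h.re_nonpos x hx) (by norm_num)
    refine (this.const_sub 2).congr fun x => ?_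
    rw [← erfc_neg]; congr 1; push_cast; ring
  rw [integral_of_hasDerivAt_of_tendsto hd (h.integrable_mul ht h.continuous h.norm_deriv_le)
    hbot htop]
  field_simp; ring

theorem integral_mul_deriv (h : IsGaussPath Z Z' C κ) {t : ℝ} (ht : 0 < t) :
    ∫ x, exp (-(t * Z x ^ 2)) * (Z x * Z' x) = 0 := by
  have ht0 : (t : ℂ) ≠ 0 := ofReal_ne_zero.2 ht.ne'
  have hd : ∀ x, HasDerivAt (fun x => -(1 / (2 * t) : ℂ) * exp (-(t * Z x ^ 2)))
      (exp (-(t * Z x ^ 2)) * (Z x * Z' x)) x := fun x => by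
    have h1 := ((((h.hasDerivAt x).pow 2).const_mul (t : ℂ)).neg.cexp).const_mul
      (-(1 / (2 * t) : ℂ))
    refine h1.congr_deriv ?_
    simp only [Pi.pow_apply, Pi.neg_apply]
    field_simp; simp
  have hc := h.continuous
  have hc' := h.continuous_path
  rw [integral_of_hasDerivAt_of_tendsto hd (h.integrable_mul ht (by fun_prop) h.norm_mul_deriv_le)
    ((h.tendsto_exp ht tendsto_abs_atBot_atTop).const_mul _)
    ((h.tendsto_exp ht tendsto_abs_atTop_atTop).const_mul _)]
  simp

end IsGaussPath

end

/-! ### The Cauchy transform of a Gaussian along a path. -/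

noncomputable section

namespace IsGaussPath

variable {Z Z' : ℝ → ℂ} {C κ : ℝ}

theorem sub_ne_zero (h : IsGaussPath Z Z' C κ) {ζ : ℂ} (hζ : (ζ ^ 2).re < 0) (x : ℝ) :
    Z x - ζ ≠ 0 := fun h0 => by
  have := h.re_sq_nonneg x
  rw [_root_.sub_eq_zero.1 h0] at this
  linarith

/-- Multiplying by `Z + ζ` brings the denominator to `Z² - ζ²`, whose real part is at least `-Re ζ²
> 0`; the numerator is controlled by the bounds on `Z'` and `ZZ'`. -/
theorem norm_deriv_div_le (h : IsGaussPath Z Z' C κ) {ζ : ℂ} (hζ : (ζ ^ 2).re < 0) (x : ℝ) :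
    ‖Z' x / (Z x - ζ)‖ ≤ (C + C * ‖ζ‖) / -(ζ ^ 2).re := by
  have hC : 0 ≤ C := (norm_nonneg _).trans (h.norm_deriv_le 0)
  have h2 : -(ζ ^ 2).re ≤ ‖Z x ^ 2 - ζ ^ 2‖ := by
    have := (le_abs_self _).trans (abs_re_le_norm (Z x ^ 2 - ζ ^ 2))
    rw [sub_re] at this
    linarith [h.re_sq_nonneg x]
  have h0 := h.sub_ne_zero hζ x
  have hne : Z x ^ 2 - ζ ^ 2 ≠ 0 := fun h' => by rw [h', norm_zero] at h2; linarith
  have h1 : Z' x / (Z x - ζ) = (Z x * Z' x + Z' x * ζ) / (Z x ^ 2 - ζ ^ 2) := by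
    field_simp; ring
  rw [h1, norm_div]
  refine div_le_div₀ (by positivity) ((norm_add_le _ _).trans (add_le_add
    (h.norm_mul_deriv_le x) ?_)) (by linarith) h2
  rw [norm_mul]
  exact mul_le_mul_of_nonneg_right (h.norm_deriv_le x) (norm_nonneg _)

theorem continuous_deriv_div (h : IsGaussPath Z Z' C κ) {ζ : ℂ} (hζ : (ζ ^ 2).re < 0) :
    Continuous fun x => Z' x / (Z x - ζ) :=
  h.continuous.div (h.continuous_path.sub continuous_const) (h.sub_ne_zero hζ)

/-- The division `Z²/(Z - ζ) = Z + ζ + ζ²/(Z - ζ)` makes the integral satisfy a first-order linear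
differential equation in `t`: the term `Z` integrates to zero and `ζ` gives the Gaussian integral.
-/
theorem hasDerivAt_integral_exp (h : IsGaussPath Z Z' C κ) {ζ : ℂ} (hζ : (ζ ^ 2).re < 0)
    {t : ℝ} (ht : 0 < t) :
    HasDerivAt (fun t : ℝ => ∫ x, exp (-(t * Z x ^ 2)) * (Z' x / (Z x - ζ)))
      (-(ζ * (Real.sqrt Real.pi / Real.sqrt t) +
        ζ ^ 2 * ∫ x, exp (-(t * Z x ^ 2)) * (Z' x / (Z x - ζ)))) t := by
  have hC : 0 ≤ C := (norm_nonneg _).trans (h.norm_deriv_le 0)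
  have hZ := h.continuous_path
  have hZ' := h.continuous
  have hk := h.continuous_deriv_div hζ
  have hkb := h.norm_deriv_div_le hζ
  set D := (C + C * ‖ζ‖) / -(ζ ^ 2).re
  have hsplit : ∀ x, Z x ^ 2 * (Z' x / (Z x - ζ)) =
      Z x * Z' x + ζ * Z' x + ζ ^ 2 * (Z' x / (Z x - ζ)) := fun x => by
    have := h.sub_ne_zero hζ x
    field_simp; ring
  have hbd : ∀ x, ‖Z x ^ 2 * (Z' x / (Z x - ζ))‖ ≤ C + ‖ζ‖ * C + ‖ζ‖ ^ 2 * D := fun x => by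
    rw [hsplit x]
    refine (norm_add₃_le).trans ?_
    rw [norm_mul ζ, norm_mul (ζ ^ 2), norm_pow]
    gcongr
    exacts [h.norm_mul_deriv_le x, h.norm_deriv_le x, hkb x]
  have hder := (hasDerivAt_integral_of_dominated_loc_of_deriv_le (μ := volume)
    (F := fun (t : ℝ) x => exp (-(t * Z x ^ 2)) * (Z' x / (Z x - ζ)))
    (F' := fun (t : ℝ) x => exp (-(t * Z x ^ 2)) * -(Z x ^ 2 * (Z' x / (Z x - ζ))))
    (bound := fun x => Real.exp (t / 2 * κ) * Real.exp (-(t / 2) * |x|) *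
      (C + ‖ζ‖ * C + ‖ζ‖ ^ 2 * D))
    (Ioi_mem_nhds (show t / 2 < t by linarith))
    (Eventually.of_forall fun s => Continuous.aestronglyMeasurable (by fun_prop))
    (h.integrable_mul ht hk hkb) (Continuous.aestronglyMeasurable (by fun_prop))
    (Eventually.of_forall fun x s hs => ?_)
    (((integrable_exp_neg_mul_abs (half_pos ht)).const_mul _).mul_const _)
    (Eventually.of_forall fun x s _ => ?_)).2
  · refine hder.congr_deriv ?_
    have i₁ : Integrable fun x => exp (-(t * Z x ^ 2)) * (Z x * Z' x) :=
      h.integrable_mul ht (hZ.mul hZ') h.norm_mul_deriv_le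
    have i₂ := (h.integrable_mul ht hZ' h.norm_deriv_le).const_mul ζ
    have i₃ := (h.integrable_mul ht hk hkb).const_mul (ζ ^ 2)
    have i₁₂ : Integrable fun x => exp (-(t * Z x ^ 2)) * (Z x * Z' x) +
        ζ * (exp (-(t * Z x ^ 2)) * Z' x) := i₁.add i₂
    have e : ∀ x, exp (-(t * Z x ^ 2)) * -(Z x ^ 2 * (Z' x / (Z x - ζ))) =
        -(exp (-(t * Z x ^ 2)) * (Z x * Z' x) + ζ * (exp (-(t * Z x ^ 2)) * Z' x) +
          ζ ^ 2 * (exp (-(t * Z x ^ 2)) * (Z' x / (Z x - ζ)))) := fun x => by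
      rw [hsplit x]; ring
    simp only [e]
    rw [integral_neg, integral_add i₁₂ i₃, integral_add i₁ i₂, integral_const_mul,
      integral_const_mul, h.integral_mul_deriv ht, h.integral_deriv ht]
    ring
  · rw [norm_mul, norm_neg]
    exact mul_le_mul (h.norm_exp_le_of_le (half_pos ht).le (le_of_lt hs) x) (hbd x)
      (norm_nonneg _) (by positivity)
  · have h1 : HasDerivAt (fun s : ℝ => -((s : ℂ) * Z x ^ 2)) (-(Z x ^ 2)) s := by
      simpa using (((hasDerivAt_id (s : ℂ)).mul_const (Z x ^ 2)).neg).comp_ofReal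
    exact (h1.cexp.mul_const _).congr_deriv (by ring)

/-- The Cauchy transform of the Gaussian along a Gauss path, at a point above the path. -/
theorem integral_exp_mul_deriv_div_sub (h : IsGaussPath Z Z' C κ) {ζ : ℂ} (hζ : (ζ ^ 2).re < 0)
    (him : 0 < ζ.im) : ∫ x, exp (-Z x ^ 2) * (Z' x / (Z x - ζ)) =
      Real.pi * I * exp (-ζ ^ 2) * erfc (-I * ζ) := by
  set Y : ℝ → ℂ := fun t => ∫ x, exp (-(t * Z x ^ 2)) * (Z' x / (Z x - ζ)) with hY
  -- The difference of the two sides at scale `t`, multiplied by the integrating factor `e^{tζ²}`.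
  -- It is constant by the differential equation and tends to zero as `t → ∞` because `Re ζ² < 0`,
  -- so it vanishes at `t = 1`.
  let d : ℝ → ℂ := fun t => exp (t * ζ ^ 2) * Y t - Real.pi * I * erfc (-I * ζ * Real.sqrt t)
  have hkb := h.norm_deriv_div_le hζ
  set D := (C + C * ‖ζ‖) / -(ζ ^ 2).re
  have hsp0 : (Real.sqrt Real.pi : ℂ) ≠ 0 := by rw [ofReal_ne_zero]; positivity
  have hsp2 : (Real.pi : ℂ) = (Real.sqrt Real.pi : ℂ) ^ 2 := by
    rw [← ofReal_pow, Real.sq_sqrt Real.pi_pos.le]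
  have hsq : ∀ t : ℝ, 0 < t → (-I * ζ * Real.sqrt t) ^ 2 = -(t * ζ ^ 2) := fun t ht => by
    rw [mul_pow, mul_pow, ← ofReal_pow, Real.sq_sqrt ht.le, neg_sq, I_sq]; ring
  have hd : ∀ t ∈ Ioi (0 : ℝ), HasDerivAt d 0 t := fun t ht => by
    have hst0 : (Real.sqrt t : ℂ) ≠ 0 := ofReal_ne_zero.2 (Real.sqrt_pos.2 ht).ne'
    have h1 : HasDerivAt (fun t : ℝ => exp (t * ζ ^ 2)) (exp (t * ζ ^ 2) * ζ ^ 2) t := by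
      have : HasDerivAt (fun s : ℝ => (s : ℂ) * ζ ^ 2) (ζ ^ 2) t := by
        simpa using ((hasDerivAt_id (t : ℂ)).mul_const (ζ ^ 2)).comp_ofReal
      exact this.cexp
    have h2 : HasDerivAt (fun t : ℝ => erfc (-I * ζ * Real.sqrt t)) _ t :=
      (hasDerivAt_erfc _).comp t
        ((Real.hasDerivAt_sqrt (ne_of_gt ht)).ofReal_comp.const_mul (-I * ζ))
    refine ((h1.mul (h.hasDerivAt_integral_exp hζ ht)).sub
      (h2.const_mul (Real.pi * I))).congr_deriv ?_
    rw [hsq t ht, neg_neg, hsp2]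
    push_cast
    field_simp
    ring_nf
    rw [I_sq]; ring
  have hconst : ∀ t ∈ Ioi (0 : ℝ), d t = d 1 := fun t ht =>
    isOpen_Ioi.is_const_of_deriv_eq_zero isPreconnected_Ioi
      (fun s hs => (hd s hs).differentiableAt.differentiableWithinAt)
      (fun s hs => (hd s hs).deriv) ht (by simp : (1 : ℝ) ∈ Ioi 0)
  have hexp : Tendsto (fun t : ℝ => Real.exp (t * (ζ ^ 2).re)) atTop (𝓝 0) :=
    Real.tendsto_exp_atBot.comp (tendsto_id.atTop_mul_const_of_neg hζ)
  have hYb : ∀ t, 1 ≤ t → ‖Y t‖ ≤ ∫ x, Real.exp (1 * κ) * Real.exp (-1 * |x|) * D :=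
    fun t ht => norm_integral_le_of_norm_le
      (((integrable_exp_neg_mul_abs one_pos).const_mul _).mul_const _)
      (Eventually.of_forall fun x => by
        rw [norm_mul]
        exact mul_le_mul (h.norm_exp_le_of_le zero_le_one ht x) (hkb x) (norm_nonneg _)
          (by positivity))
  have hlim : Tendsto d atTop (𝓝 0) := by
    have hbound : ∀ᶠ t in atTop, ‖d t‖ ≤ Real.exp (t * (ζ ^ 2).re) *
        ((∫ x, Real.exp (1 * κ) * Real.exp (-1 * |x|) * D) + Real.pi) := by
      filter_upwards [eventually_ge_atTop 1] with t ht
      have ht0 : 0 < t := by linarith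
      refine (norm_sub_le _ _).trans ?_
      rw [mul_add]
      refine add_le_add ?_ ?_
      · rw [norm_mul, norm_exp, re_ofReal_mul]
        exact mul_le_mul_of_nonneg_left (hYb t ht) (Real.exp_pos _).le
      · have := norm_erfc_le (z := -I * ζ * Real.sqrt t) (by
          rw [mul_comm, re_ofReal_mul]
          have : (-I * ζ).re = ζ.im := by simp
          rw [this]; positivity)
        rw [hsq t ht0, neg_re, neg_neg, re_ofReal_mul] at this
        rw [norm_mul, norm_mul, norm_I, norm_real, Real.norm_eq_abs, abs_of_pos Real.pi_pos,
          mul_one, mul_comm]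
        exact mul_le_mul_of_nonneg_right this Real.pi_pos.le
    refine squeeze_zero_norm' hbound ?_
    simpa using hexp.mul_const _
  have hz : d 1 = 0 := by
    refine tendsto_nhds_unique (tendsto_const_nhds.congr' ?_) hlim
    filter_upwards [eventually_gt_atTop 0] with t ht using (hconst t ht).symm
  have hY1 : Y 1 = ∫ x, exp (-Z x ^ 2) * (Z' x / (Z x - ζ)) := by
    simp only [hY, ofReal_one, one_mul]
  simp only [d, ofReal_one, one_mul, Real.sqrt_one, mul_one] at hz
  rw [hY1] at hz
  have hee : exp (-ζ ^ 2) * exp (ζ ^ 2) = 1 := by rw [← exp_add]; simp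
  linear_combination exp (-ζ ^ 2) * hz -
    (∫ x, exp (-Z x ^ 2) * (Z' x / (Z x - ζ))) * hee

end IsGaussPath

end

/-! ### The exponent on the horizontal line through the saddle. -/

noncomputable section

section saddle

variable {N₀ N₁ p₀ : ℂ}

theorem ne_zero_of_re_pos' {z : ℂ} (h : 0 < z.re) : z ≠ 0 := fun h0 => by simp [h0] at h

theorem log_div_of_re_pos {a b : ℂ} (ha : 0 < a.re) (hb : 0 < b.re) :
    log (a / b) = log a - log b := by
  have h1 := abs_lt.1 (abs_arg_lt_pi_div_two_iff.2 (Or.inl ha))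
  have h2 := abs_lt.1 (abs_arg_lt_pi_div_two_iff.2 (Or.inl hb))
  have hm : log a - log b ∈ logStrip := by
    rw [mem_logStrip, sub_im, log_im, log_im, abs_lt]; constructor <;> linarith
  rw [← log_exp_of_mem_logStrip hm, exp_sub, exp_log (ne_zero_of_re_pos' ha),
    exp_log (ne_zero_of_re_pos' hb)]

theorem div_mem_slitPlane_of_re_pos {a b : ℂ} (ha : 0 < a.re) (hb : 0 < b.re) :
    a / b ∈ slitPlane := by
  have h1 := abs_lt.1 (abs_arg_lt_pi_div_two_iff.2 (Or.inl ha))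
  have h2 := abs_lt.1 (abs_arg_lt_pi_div_two_iff.2 (Or.inl hb))
  have hm : log a - log b ∈ logStrip := by
    rw [mem_logStrip, sub_im, log_im, log_im, abs_lt]; constructor <;> linarith
  have := exp_mem_slitPlane_of_mem hm
  rwa [exp_sub, exp_log (ne_zero_of_re_pos' ha), exp_log (ne_zero_of_re_pos' hb)] at this

theorem add_mul_logistic (hN₀ : 0 < N₀.re) (hN₁ : 0 < N₁.re) (he : exp p₀ = N₁ / N₀) :
    (N₀ + N₁) * logistic p₀ = N₁ := by
  have h0 := ne_zero_of_re_pos' hN₀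
  have h01 : N₀ + N₁ ≠ 0 := ne_zero_of_re_pos' (by rw [add_re]; linarith)
  rw [logistic, he, show 1 + N₁ / N₀ = (N₀ + N₁) / N₀ by field_simp]
  field_simp

theorem add_mul_logisticDeriv (hN₀ : 0 < N₀.re) (hN₁ : 0 < N₁.re) (he : exp p₀ = N₁ / N₀) :
    (N₀ + N₁) * logisticDeriv p₀ = N₀ * N₁ / (N₀ + N₁) := by
  have h0 := ne_zero_of_re_pos' hN₀
  have h01 : N₀ + N₁ ≠ 0 := ne_zero_of_re_pos' (by rw [add_re]; linarith)
  rw [logisticDeriv, he, show 1 + N₁ / N₀ = (N₀ + N₁) / N₀ by field_simp]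
  field_simp

theorem phase_sub_phase (hN₀ : 0 < N₀.re) (hN₁ : 0 < N₁.re) (h₀ : p₀ ∈ logStrip)
    (he : exp p₀ = N₁ / N₀) {p : ℂ} (hp : p ∈ logStrip) :
    phase N₀ N₁ p₀ - phase N₀ N₁ p = N₀ * N₁ / (N₀ + N₁) / 2 * saddleCoord p₀ p ^ 2 := by
  rw [← add_mul_logisticDeriv hN₀ hN₁ he, mul_div_assoc, mul_assoc, saddleCoord_sq h₀ hp,
    tangentGap, phase, phase]
  linear_combination (p₀ - p) * -(add_mul_logistic hN₀ hN₁ he)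

theorem add_ofReal_mem_logStrip (h₀ : p₀ ∈ logStrip) (x : ℝ) : p₀ + x ∈ logStrip := by
  rw [mem_logStrip] at *; simpa using h₀

/-- Inversion maps the half-plane `Re N ≥ 1` into the disc with diameter `[0, 1]`. -/
theorem inv_re_ge_normSq_inv {N : ℂ} (h : 1 ≤ N.re) : ‖N⁻¹‖ ^ 2 ≤ N⁻¹.re := by
  have h0 : 0 < normSq N := normSq_pos.2 (ne_zero_of_re_pos' (by linarith))
  rw [norm_inv, inv_pow, ← normSq_eq_norm_sq, inv_re, le_div_iff₀ h0, inv_mul_cancel₀ h0.ne']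
  exact h

/-- With `w = N₁⁻¹ + y N₀⁻¹`, Cauchy–Schwarz with weights `1` and `y` and the disc condition on each
inverse give `‖w‖² ≤ (1 + y) Re w`. -/
theorem re_inv_ge {N₀ N₁ : ℂ} (hN₀ : 1 ≤ N₀.re) (hN₁ : 1 ≤ N₁.re) {y : ℝ} (hy : 0 < y) :
    1 / (1 + y) ≤ (1 / (N₁⁻¹ + y * N₀⁻¹)).re := by
  have h0 := inv_re_ge_normSq_inv hN₀
  have h1 := inv_re_ge_normSq_inv hN₁
  set w := N₁⁻¹ + y * N₀⁻¹ with hw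
  have hre : w.re = N₁⁻¹.re + y * N₀⁻¹.re := by rw [hw, add_re, re_ofReal_mul]
  have hn : ‖w‖ ≤ ‖N₁⁻¹‖ + y * ‖N₀⁻¹‖ := by
    refine (norm_add_le _ _).trans ?_
    rw [norm_mul, norm_real, Real.norm_eq_abs, abs_of_pos hy]
  have hn2 : ‖w‖ ^ 2 ≤ (1 + y) * w.re := by
    have a := norm_nonneg N₁⁻¹
    have b := norm_nonneg N₀⁻¹
    calc ‖w‖ ^ 2 ≤ (‖N₁⁻¹‖ + y * ‖N₀⁻¹‖) ^ 2 := by gcongr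
      _ ≤ (1 + y) * (‖N₁⁻¹‖ ^ 2 + y * ‖N₀⁻¹‖ ^ 2) := by
        nlinarith [mul_nonneg hy.le (sq_nonneg (‖N₁⁻¹‖ - ‖N₀⁻¹‖))]
      _ ≤ (1 + y) * w.re := by rw [hre]; gcongr
  have hpos : 0 < w.re := by
    have a : 0 < ‖N₁⁻¹‖ := norm_pos_iff.2 (inv_ne_zero (ne_zero_of_re_pos' (by linarith)))
    rw [hre]
    have : 0 ≤ y * N₀⁻¹.re := mul_nonneg hy.le ((sq_nonneg _).trans h0)
    nlinarith
  have hs : 0 < normSq w := normSq_pos.2 (ne_zero_of_re_pos' hpos)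
  rw [one_div w, inv_re, div_le_div_iff₀ (by linarith) hs, normSq_eq_norm_sq]
  linarith

theorem hasDerivAt_phase_line (hN₀ : 0 < N₀.re) (hN₁ : 0 < N₁.re) (h₀ : p₀ ∈ logStrip)
    (he : exp p₀ = N₁ / N₀) (x : ℝ) :
    HasDerivAt (fun x : ℝ => phase N₀ N₁ p₀ - phase N₀ N₁ (p₀ + x))
      (((Real.exp x - 1 : ℝ) : ℂ) * (1 / (N₁⁻¹ + (Real.exp x : ℝ) * N₀⁻¹))) x := by
  have hp := add_ofReal_mem_logStrip h₀ x
  have n0 := ne_zero_of_re_pos' hN₀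
  have n1 := ne_zero_of_re_pos' hN₁
  have h1 : HasDerivAt (fun z : ℂ => phase N₀ N₁ p₀ - phase N₀ N₁ (p₀ + z))
      (-(N₁ * 1 - (N₀ + N₁) * logistic (p₀ + x))) (x : ℂ) :=
    ((((hasDerivAt_id (p₀ + x : ℂ)).const_mul N₁).sub
      ((hasDerivAt_softplus hp).const_mul (N₀ + N₁))).comp_const_add p₀ (x : ℂ)).const_sub _
  refine h1.comp_ofReal.congr_deriv ?_
  have hne := one_add_exp_ne_zero hp
  rw [exp_add, he, ← ofReal_exp] at hne
  have hne' : N₀ + N₁ * (Real.exp x : ℝ) ≠ 0 := fun h => hne (by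
    rw [show 1 + N₁ / N₀ * ((Real.exp x : ℝ) : ℂ) = (N₀ + N₁ * (Real.exp x : ℝ)) / N₀ by
      field_simp, h, zero_div])
  rw [logistic, exp_add, he, ← ofReal_exp, ofReal_sub, ofReal_one]
  have e1 : 1 + N₁ / N₀ * ((Real.exp x : ℝ) : ℂ) = (N₀ + N₁ * (Real.exp x : ℝ)) / N₀ := by
    field_simp
  have e2 : N₁⁻¹ + ((Real.exp x : ℝ) : ℂ) * N₀⁻¹ =
      (N₀ + N₁ * (Real.exp x : ℝ)) / (N₀ * N₁) := by field_simp
  rw [e1, e2]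
  generalize ((Real.exp x : ℝ) : ℂ) = y at *
  field_simp
  ring

/-- The lower bound is `2 log cosh(x/2)`, the exact value for `N₀ = N₁ = 1`. Both sides vanish at `x
= 0`, and by `re_inv_ge` the derivative of their difference has the sign of `e^x - 1`. -/
theorem re_phase_sub_ge (hN₀ : 1 ≤ N₀.re) (hN₁ : 1 ≤ N₁.re) (h₀ : p₀ ∈ logStrip)
    (he : exp p₀ = N₁ / N₀) (x : ℝ) :
    2 * Real.log (1 + Real.exp x) - x - 2 * Real.log 2 ≤
      (phase N₀ N₁ p₀ - phase N₀ N₁ (p₀ + x)).re := by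
  let h : ℝ → ℝ := fun x => (phase N₀ N₁ p₀ - phase N₀ N₁ (p₀ + x)).re -
    (2 * Real.log (1 + Real.exp x) - x - 2 * Real.log 2)
  have hd : ∀ x, HasDerivAt h ((Real.exp x - 1) * ((1 / (N₁⁻¹ + (Real.exp x : ℝ) * N₀⁻¹)).re -
      1 / (1 + Real.exp x))) x := fun x => by
    have h1 := reCLM.hasFDerivAt.comp_hasDerivAt x
      (hasDerivAt_phase_line (by linarith) (by linarith) h₀ he x)
    have hpos : (1 + Real.exp x) ≠ 0 := by positivity
    have h2 := (((((Real.hasDerivAt_exp x).const_add 1).log hpos).const_mul 2).sub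
      (hasDerivAt_id x)).sub_const (2 * Real.log 2)
    refine (h1.sub h2).congr_deriv ?_
    rw [reCLM_apply, re_ofReal_mul]
    field_simp; ring
  have hz : h 0 = 0 := by simp only [h]; norm_num
  have hc : Continuous h := continuous_iff_continuousAt.2 fun x => (hd x).continuousAt
  have hdiff : Differentiable ℝ h := fun x => (hd x).differentiableAt
  have hfac : ∀ x, 0 ≤ (1 / (N₁⁻¹ + (Real.exp x : ℝ) * N₀⁻¹)).re - 1 / (1 + Real.exp x) :=
    fun x => sub_nonneg.2 (re_inv_ge hN₀ hN₁ (Real.exp_pos x))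
  have hnn : 0 ≤ h x := by
    rcases le_total 0 x with hx | hx
    · have := monotoneOn_of_deriv_nonneg (convex_Ici (0 : ℝ)) hc.continuousOn
        hdiff.differentiableOn (fun y hy => by
          rw [(hd y).deriv]
          rw [interior_Ici] at hy
          exact mul_nonneg (by linarith [Real.one_le_exp (le_of_lt hy)]) (hfac y))
      simpa [hz] using this self_mem_Ici hx hx
    · have := antitoneOn_of_deriv_nonpos (convex_Iic (0 : ℝ)) hc.continuousOn
        hdiff.differentiableOn (fun y hy => by
          rw [(hd y).deriv]
          rw [interior_Iic] at hy
          exact mul_nonpos_of_nonpos_of_nonneg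
            (by linarith [Real.exp_le_one_iff.2 (le_of_lt hy)]) (hfac y))
      simpa [hz] using this hx self_mem_Iic hx
  simpa [h] using hnn

theorem abs_sub_le_log_cosh (x : ℝ) :
    |x| - 2 * Real.log 2 ≤ 2 * Real.log (1 + Real.exp x) - x - 2 * Real.log 2 := by
  have h1 : 0 ≤ Real.log (1 + Real.exp x) := Real.log_nonneg (by linarith [Real.exp_pos x])
  have h2 : x ≤ Real.log (1 + Real.exp x) := by
    rw [Real.le_log_iff_exp_le (by positivity)]; linarith
  rcases abs_cases x with ⟨h, _⟩ | ⟨h, _⟩ <;> rw [h] <;> linarith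

theorem log_cosh_pos {x : ℝ} (hx : x ≠ 0) :
    0 < 2 * Real.log (1 + Real.exp x) - x - 2 * Real.log 2 := by
  have hne : Real.exp x ≠ 1 := by rwa [Ne, Real.exp_eq_one_iff]
  have h1 : Real.exp (x + 2 * Real.log 2) < Real.exp (2 * Real.log (1 + Real.exp x)) := by
    rw [Real.exp_add, two_mul, two_mul, Real.exp_add, Real.exp_add, Real.exp_log two_pos,
      Real.exp_log (by positivity)]
    nlinarith [sq_pos_of_ne_zero (sub_ne_zero.2 hne)]
  have := Real.exp_lt_exp.1 h1
  linarith

theorem norm_exp_phase_sub_le (hN₀ : 1 ≤ N₀.re) (hN₁ : 1 ≤ N₁.re) (h₀ : p₀ ∈ logStrip)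
    (he : exp p₀ = N₁ / N₀) (x : ℝ) :
    ‖exp (phase N₀ N₁ (p₀ + x) - phase N₀ N₁ p₀)‖ ≤ 4 * Real.exp (-|x|) := by
  have h1 := (abs_sub_le_log_cosh x).trans (re_phase_sub_ge hN₀ hN₁ h₀ he x)
  have h4 : (4 : ℝ) = Real.exp (2 * Real.log 2) := by
    rw [two_mul, Real.exp_add, Real.exp_log two_pos]; norm_num
  rw [norm_exp, h4, ← Real.exp_add, Real.exp_le_exp, ← neg_sub, neg_re]
  linarith

/-- The scaled coordinate satisfies `Z² = phase p₀ - phase p`. -/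
def saddleScale (N₀ N₁ : ℂ) : ℂ := (N₀ * N₁ / (N₀ + N₁) / 2) ^ (1 / 2 : ℂ)

theorem cpow_half_sq (z : ℂ) : (z ^ (1 / 2 : ℂ)) ^ 2 = z := by
  rw [← cpow_mul_nat]; norm_num

theorem re_harmonic_pos (hN₀ : 0 < N₀.re) (hN₁ : 0 < N₁.re) :
    0 < (N₀ * N₁ / (N₀ + N₁) / 2).re := by
  have n0 := ne_zero_of_re_pos' hN₀
  have n1 := ne_zero_of_re_pos' hN₁
  have n01 : N₀ + N₁ ≠ 0 := ne_zero_of_re_pos' (by rw [add_re]; linarith)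
  have hi : ∀ N : ℂ, 0 < N.re → 0 < (2 * N⁻¹).re := fun N h => by
    rw [show (2 : ℂ) = ((2 : ℝ) : ℂ) by simp, re_ofReal_mul, inv_re]
    exact mul_pos two_pos (div_pos h (normSq_pos.2 (ne_zero_of_re_pos' h)))
  have e : N₀ * N₁ / (N₀ + N₁) / 2 = (2 * N₀⁻¹ + 2 * N₁⁻¹)⁻¹ := by
    rw [show 2 * N₀⁻¹ + 2 * N₁⁻¹ = 2 * (N₀ + N₁) / (N₀ * N₁) by field_simp; ring]
    field_simp
  have hp : 0 < (2 * N₀⁻¹ + 2 * N₁⁻¹).re := by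
    rw [add_re]; exact add_pos (hi _ hN₀) (hi _ hN₁)
  rw [e, inv_re]
  exact div_pos hp (normSq_pos.2 (ne_zero_of_re_pos' hp))

theorem re_cpow_half_pos {z : ℂ} (h : z ∈ slitPlane) : 0 < (z ^ (1 / 2 : ℂ)).re := by
  have hz := slitPlane_ne_zero h
  have hm := abs_lt.1 (mem_logStrip.1 (log_mem_logStrip h))
  rw [cpow_def_of_ne_zero hz, exp_re]
  have : (log z * (1 / 2)).im = (log z).im / 2 := by
    rw [show log z * (1 / 2) = log z / 2 by ring]; simp
  rw [this]
  refine mul_pos (Real.exp_pos _) (Real.cos_pos_of_mem_Ioo ⟨by linarith, by linarith⟩)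

theorem saddleScale_sq : saddleScale N₀ N₁ ^ 2 = N₀ * N₁ / (N₀ + N₁) / 2 := cpow_half_sq _

theorem re_saddleScale_pos (hN₀ : 0 < N₀.re) (hN₁ : 0 < N₁.re) : 0 < (saddleScale N₀ N₁).re :=
  re_cpow_half_pos (mem_slitPlane_iff.2 (Or.inl (re_harmonic_pos hN₀ hN₁)))

theorem saddleScale_mul_sq (hN₀ : 0 < N₀.re) (hN₁ : 0 < N₁.re) (h₀ : p₀ ∈ logStrip)
    (he : exp p₀ = N₁ / N₀) {p : ℂ} (hp : p ∈ logStrip) :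
    (saddleScale N₀ N₁ * saddleCoord p₀ p) ^ 2 = phase N₀ N₁ p₀ - phase N₀ N₁ p := by
  rw [mul_pow, saddleScale_sq, phase_sub_phase hN₀ hN₁ h₀ he hp]

/-- Matches the principal roots in the coordinate with those in the argument of `erfc`. Both sides
are continuous with equal nonzero squares on the product of two half-planes, and they agree at `(1,
1)`. -/
theorem saddleScale_eq (hN₀ : 0 < N₀.re) (hN₁ : 0 < N₁.re) :
    saddleScale N₀ N₁ = (N₁ / 2) ^ (1 / 2 : ℂ) * (1 + N₁ / N₀) ^ (-(1 / 2) : ℂ) := by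
  let D : Set (ℂ × ℂ) := {z : ℂ | 0 < z.re} ×ˢ {z : ℂ | 0 < z.re}
  have hD : ∀ x ∈ D, 0 < x.1.re ∧ 0 < x.2.re := fun x hx => hx
  have hconv : IsPreconnected D :=
    ((convex_halfSpace_re_gt 0).prod (convex_halfSpace_re_gt 0)).isPreconnected
  have hs : ∀ x ∈ D, 1 + x.2 / x.1 ∈ slitPlane :=
    fun x hx => one_add_mem_slitPlane (div_mem_slitPlane_of_re_pos (hD x hx).2 (hD x hx).1)
  have hh : ∀ x ∈ D, 0 < (x.2 / 2).re := fun x hx => by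
    have := (hD x hx).2
    rw [show x.2 / 2 = ((1 / 2 : ℝ) : ℂ) * x.2 by push_cast; ring, re_ofReal_mul]; linarith
  have hn : ∀ x ∈ D, x.1 + x.2 ≠ 0 := fun x hx => ne_zero_of_re_pos' (by
    rw [add_re]; exact add_pos (hD x hx).1 (hD x hx).2)
  have hf : ContinuousOn (fun x : ℂ × ℂ => saddleScale x.1 x.2) D := by
    have : ContinuousOn (fun x : ℂ × ℂ => x.1 * x.2 / (x.1 + x.2) / 2) D :=
      ContinuousOn.div_const (ContinuousOn.div (by fun_prop) (by fun_prop) hn) _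
    exact this.cpow_const fun x hx =>
        mem_slitPlane_iff.2 (Or.inl (re_harmonic_pos (hD x hx).1 (hD x hx).2))
  have hg : ContinuousOn (fun x : ℂ × ℂ => (x.2 / 2) ^ (1 / 2 : ℂ) *
      (1 + x.2 / x.1) ^ (-(1 / 2) : ℂ)) D := by
    have h1 : ContinuousOn (fun x : ℂ × ℂ => x.2 / 2) D := by fun_prop
    have h2 : ContinuousOn (fun x : ℂ × ℂ => 1 + x.2 / x.1) D :=
      continuousOn_const.add (continuousOn_snd.div continuousOn_fst
        fun x hx => ne_zero_of_re_pos' (hD x hx).1)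
    exact (h1.cpow_const fun x hx => mem_slitPlane_iff.2 (Or.inl (hh x hx))).mul
      (h2.cpow_const hs)
  have h1 : ((1, 1) : ℂ × ℂ) ∈ D := ⟨by simp, by simp⟩
  have h2 : (N₀, N₁) ∈ D := ⟨hN₀, hN₁⟩
  have key : ∀ f g : ℂ × ℂ → ℂ, ContinuousOn f D → ContinuousOn g D →
      (∀ x ∈ D, f x ^ 2 = g x ^ 2) → (∀ x ∈ D, g x ≠ 0) → f (1, 1) = g (1, 1) →
      f (N₀, N₁) = g (N₀, N₁) := fun f g hf hg hsq hne hone =>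
    hconv.eq_of_sq_eq hf hg hsq (fun {x} hx => hne x hx) h1 hone h2
  refine key _ _ hf hg ?_ ?_ ?_
  · intro x hx
    have n0 := ne_zero_of_re_pos' (hD x hx).1
    have n01 := hn x hx
    rw [saddleScale_sq, mul_pow, cpow_half_sq, cpow_neg_half_sq,
      show 1 + x.2 / x.1 = (x.1 + x.2) / x.1 by field_simp]
    field_simp
  · intro x hx
    refine mul_ne_zero ?_ ?_
    · rw [Ne, cpow_eq_zero_iff, not_and_or]
      exact Or.inl (ne_zero_of_re_pos' (hh x hx))
    · rw [Ne, cpow_eq_zero_iff, not_and_or]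
      exact Or.inl (slitPlane_ne_zero (hs x hx))
  · have h2 : (2 : ℂ) ^ (1 / 2 : ℂ) ≠ 0 := by simp [cpow_eq_zero_iff]
    have h3 : ((1 / 2 : ℂ)) ^ (1 / 2 : ℂ) = ((2 : ℂ) ^ (1 / 2 : ℂ))⁻¹ := by
      rw [one_div (2 : ℂ), inv_cpow]
      rw [show (2 : ℂ) = ((2 : ℝ) : ℂ) by simp, arg_ofReal_of_nonneg zero_le_two]
      exact Real.pi_pos.ne
    have h4 : ((1 : ℂ) * 1 / (1 + 1) / 2) = (1 / 2) ^ 2 := by norm_num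
    have h5 : ((1 / 2 : ℂ) ^ 2) ^ (1 / 2 : ℂ) = 1 / 2 := by
      have harg : (1 / 2 : ℂ).arg = 0 := by
        rw [show (1 / 2 : ℂ) = ((1 / 2 : ℝ) : ℂ) by push_cast; rfl,
          arg_ofReal_of_nonneg (by norm_num)]
      have := pow_cpow_ofNat_inv (x := (1 / 2 : ℂ)) (n := 2)
        (by rw [harg]; simp [Real.pi_pos]) (by rw [harg]; positivity)
      rwa [show ((OfNat.ofNat 2 : ℂ))⁻¹ = 1 / 2 by norm_num] at this
    simp only [saddleScale]
    rw [h4, h5, h3, div_one, show (1 : ℂ) + 1 = 2 by norm_num, cpow_neg, ← mul_inv, ← sq,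
      cpow_half_sq, one_div]

end saddle

end

/-! ### The saddle line as a Gaussian path. -/

noncomputable section

theorem differentiableOn_deriv_saddleCoord {p₀ : ℂ} (h₀ : p₀ ∈ logStrip) :
    DifferentiableOn ℂ (deriv (saddleCoord p₀)) logStrip :=
  (differentiableOn_saddleCoord h₀).deriv isOpen_logStrip

theorem add_ofReal_eq (p₀ : ℂ) (x : ℝ) : p₀ + x = ((x + p₀.re : ℝ) : ℂ) + p₀.im * I := by
  conv_lhs => rw [← re_add_im p₀]
  push_cast; ring

theorem integral_line_im (f : ℂ → ℂ) (p₀ : ℂ) :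
    ∫ x : ℝ, f (x + p₀.im * I) = ∫ x : ℝ, f (p₀ + x) := by
  rw [← integral_add_right_eq_self _ p₀.re]
  simp only [add_ofReal_eq]

theorem add_ofReal_mem_closedStrip (p₀ : ℂ) (x : ℝ) : p₀ + x ∈ closedStrip p₀.im p₀.im := by
  simp [closedStrip]

section path

variable {N₀ N₁ p₀ : ℂ}

/-- Here `Z = x · (scale · root)`. A zero real part of the second factor would make `Re Z²`
nonpositive, against the strict bound for `x ≠ 0`; so the sign at `x = 0` persists. It gives `Re Z`
the sign of `x`. -/
theorem re_saddleScale_mul_gapRoot_pos (hN₀ : 1 ≤ N₀.re) (hN₁ : 1 ≤ N₁.re) (h₀ : p₀ ∈ logStrip)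
    (he : exp p₀ = N₁ / N₀) (x : ℝ) :
    0 < (saddleScale N₀ N₁ * gapRoot (p₀, p₀ + x)).re := by
  have hp0 : 0 < N₀.re := by linarith
  have hp1 : 0 < N₁.re := by linarith
  have hc : Continuous fun x : ℝ => (saddleScale N₀ N₁ * gapRoot (p₀, p₀ + x)).re := by
    refine continuous_re.comp (continuous_const.mul ?_)
    exact continuousOn_gapRoot.comp_continuous (by fun_prop)
      fun x => ⟨h₀, add_ofReal_mem_logStrip h₀ x⟩
  have hne : ∀ x : ℝ, (saddleScale N₀ N₁ * gapRoot (p₀, p₀ + x)).re ≠ 0 := fun x => by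
    by_cases hx : x = 0
    · rw [hx, ofReal_zero, add_zero, gapRoot_self h₀, mul_one]
      exact (re_saddleScale_pos hp0 hp1).ne'
    · intro h
      have h1 := (log_cosh_pos hx).trans_le (re_phase_sub_ge hN₀ hN₁ h₀ he x)
      rw [← saddleScale_mul_sq hp0 hp1 h₀ he (add_ofReal_mem_logStrip h₀ x), saddleCoord] at h1
      have h2 : (saddleScale N₀ N₁ * ((p₀ + x - p₀) * gapRoot (p₀, p₀ + x))) ^ 2 =
          ((x ^ 2 : ℝ) : ℂ) * (saddleScale N₀ N₁ * gapRoot (p₀, p₀ + x)) ^ 2 := by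
        push_cast; ring
      rw [h2, re_ofReal_mul, sq (saddleScale N₀ N₁ * _), mul_re, h] at h1
      nlinarith [mul_nonneg (sq_nonneg x)
        (sq_nonneg (saddleScale N₀ N₁ * gapRoot (p₀, p₀ + x)).im)]
  by_contra! hx
  obtain ⟨y, hy⟩ := mem_range_of_exists_le_of_exists_ge hc ⟨x, hx⟩ ⟨0, by
    rw [ofReal_zero, add_zero, gapRoot_self h₀, mul_one]
    exact (re_saddleScale_pos hp0 hp1).le⟩
  exact hne y hy

theorem exists_isGaussPath (hN₀ : 1 ≤ N₀.re) (hN₁ : 1 ≤ N₁.re) (h₀ : p₀ ∈ logStrip)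
    (he : exp p₀ = N₁ / N₀) : ∃ C, IsGaussPath (fun x => saddleScale N₀ N₁ * saddleCoord p₀ (p₀ + x))
      (fun x => saddleScale N₀ N₁ * deriv (saddleCoord p₀) (p₀ + x)) C (2 * Real.log 2) := by
  have hp0 : 0 < N₀.re := by linarith
  have hp1 : 0 < N₁.re := by linarith
  have him := abs_lt.1 (mem_logStrip.1 h₀)
  have hmem := fun x : ℝ => add_ofReal_mem_logStrip h₀ x
  have hsub : closedStrip p₀.im p₀.im ⊆ logStrip := closedStrip_subset_logStrip him.1 him.2
  have hk : ({p₀} : Set ℂ) ⊆ logStrip := singleton_subset_iff.2 h₀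
  have hu := (differentiableOn_saddleCoord h₀).continuousOn
  have hu' := (differentiableOn_deriv_saddleCoord h₀).continuousOn
  obtain ⟨C₁, X₁, -, -, h1⟩ := exists_tail_bound_deriv_saddleCoord isCompact_singleton hk
  obtain ⟨C₂, -, h2⟩ := exists_tail_bound_mul_deriv isCompact_singleton hk
  obtain ⟨D₁, -, hD₁⟩ := exists_bound_of_tails (isCompact_singleton (x := p₀))
    (G := fun y : ℂ × ℂ => deriv (saddleCoord p₀) y.1) (hu'.comp continuousOn_fst fun y hy => hsub hy.1)
    (fun p hp hX b _ => h1 p₀ rfl p (hsub hp) hX)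
  obtain ⟨D₂, -, hD₂⟩ := exists_bound_of_tails (isCompact_singleton (x := p₀))
    (G := fun y : ℂ × ℂ => saddleCoord p₀ y.1 * deriv (saddleCoord p₀) y.1)
    ((hu.mul hu').comp continuousOn_fst fun y hy => hsub hy.1)
    (fun p hp hX b _ => h2 p₀ rfl p (hsub hp) hX)
  set a := saddleScale N₀ N₁
  have hsq : ∀ x : ℝ, ((a * saddleCoord p₀ (p₀ + x)) ^ 2).re =
      (phase N₀ N₁ p₀ - phase N₀ N₁ (p₀ + x)).re := fun x => by
    rw [saddleScale_mul_sq hp0 hp1 h₀ he (hmem x)]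
  have hre : ∀ x : ℝ, (a * saddleCoord p₀ (p₀ + x)).re = x * (a * gapRoot (p₀, p₀ + x)).re :=
    fun x => by rw [← re_ofReal_mul, saddleCoord]; congr 1; ring
  have hgap := re_saddleScale_mul_gapRoot_pos hN₀ hN₁ h₀ he
  refine ⟨max (‖a‖ * D₁) (‖a‖ ^ 2 * D₂), fun x => ?_, ?_, fun x => ?_, fun x => ?_, fun x hx => ?_,
    fun x hx => ?_, fun x => ?_, fun x => ?_⟩
  · have h3 := ((differentiableOn_saddleCoord h₀).differentiableAt
      (isOpen_logStrip.mem_nhds (hmem x))).hasDerivAt.comp_const_add p₀ (x : ℂ)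
    exact h3.comp_ofReal.const_mul a
  · exact continuous_const.mul (hu'.comp_continuous (by fun_prop) hmem)
  · rw [hsq]; exact (abs_sub_le_log_cosh x).trans (re_phase_sub_ge hN₀ hN₁ h₀ he x)
  · rw [hsq]
    refine le_trans ?_ (re_phase_sub_ge hN₀ hN₁ h₀ he x)
    by_cases hx : x = 0
    · rw [hx, Real.exp_zero]; norm_num
    · exact (log_cosh_pos hx).le
  · rw [hre]; exact mul_nonneg hx.le (hgap x).le
  · rw [hre]; exact mul_nonpos_of_nonpos_of_nonneg hx.le (hgap x).le
  · rw [norm_mul]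
    exact (mul_le_mul_of_nonneg_left (hD₁ _ (add_ofReal_mem_closedStrip p₀ x) p₀ rfl)
      (norm_nonneg a)).trans (le_max_left _ _)
  · rw [show a * saddleCoord p₀ (p₀ + x) * (a * deriv (saddleCoord p₀) (p₀ + x)) =
      a ^ 2 * (saddleCoord p₀ (p₀ + x) * deriv (saddleCoord p₀) (p₀ + x)) by ring, norm_mul,
      norm_pow]
    exact (mul_le_mul_of_nonneg_left (hD₂ _ (add_ofReal_mem_closedStrip p₀ x) p₀ rfl)
      (by positivity)).trans (le_max_right _ _)

theorem saddleScale_ne_zero (hN₀ : 0 < N₀.re) (hN₁ : 0 < N₁.re) : saddleScale N₀ N₁ ≠ 0 :=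
  ne_zero_of_re_pos' (re_saddleScale_pos hN₀ hN₁)

/-- The Gaussian integral along the saddle line. -/
theorem integral_exp_phase_mul_deriv (hN₀ : 1 ≤ N₀.re) (hN₁ : 1 ≤ N₁.re) (h₀ : p₀ ∈ logStrip)
    (he : exp p₀ = N₁ / N₀) :
    ∫ x : ℝ, exp (phase N₀ N₁ (p₀ + x) - phase N₀ N₁ p₀) * deriv (saddleCoord p₀) (p₀ + x) =
      Real.sqrt Real.pi / saddleScale N₀ N₁ := by
  have hp0 : 0 < N₀.re := by linarith
  have hp1 : 0 < N₁.re := by linarith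
  have ha := saddleScale_ne_zero hp0 hp1
  obtain ⟨C, h⟩ := exists_isGaussPath hN₀ hN₁ h₀ he
  have := h.integral_deriv one_pos
  rw [Real.sqrt_one, ofReal_one, div_one] at this
  rw [← this, eq_div_iff ha, mul_comm, ← integral_const_mul]
  refine integral_congr_ae (Eventually.of_forall fun x => ?_)
  simp only [one_mul]
  rw [saddleScale_mul_sq hp0 hp1 h₀ he (add_ofReal_mem_logStrip h₀ x), neg_sub]
  ring

/-- The contribution of the pole, for a pole in the valley above the saddle line. -/
theorem integral_exp_phase_mul_deriv_div (hN₀ : 1 ≤ N₀.re) (hN₁ : 1 ≤ N₁.re) (h₀ : p₀ ∈ logStrip)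
    (he : exp p₀ = N₁ / N₀) {b : ℂ} (hb : b ∈ logStrip)
    (hre : (phase N₀ N₁ p₀ - phase N₀ N₁ b).re < 0)
    (him : 0 < (saddleScale N₀ N₁ * saddleCoord p₀ b).im) :
    ∫ x : ℝ, exp (phase N₀ N₁ (p₀ + x) - phase N₀ N₁ p₀) *
      (deriv (saddleCoord p₀) (p₀ + x) / (saddleCoord p₀ (p₀ + x) - saddleCoord p₀ b)) =
      Real.pi * I * exp (phase N₀ N₁ b - phase N₀ N₁ p₀) *
        erfc (-I * (saddleScale N₀ N₁ * saddleCoord p₀ b)) := by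
  have hp0 : 0 < N₀.re := by linarith
  have hp1 : 0 < N₁.re := by linarith
  have ha := saddleScale_ne_zero hp0 hp1
  obtain ⟨C, h⟩ := exists_isGaussPath hN₀ hN₁ h₀ he
  have hsq := saddleScale_mul_sq hp0 hp1 h₀ he hb
  have := h.integral_exp_mul_deriv_div_sub (ζ := saddleScale N₀ N₁ * saddleCoord p₀ b)
    (by rw [hsq]; exact hre) him
  rw [hsq, neg_sub] at this
  rw [← this]
  refine integral_congr_ae (Eventually.of_forall fun x => ?_)
  simp only
  rw [saddleScale_mul_sq hp0 hp1 h₀ he (add_ofReal_mem_logStrip h₀ x), neg_sub, ← mul_sub,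
    mul_div_mul_left _ _ ha]

/-- There are poles in the valley above the saddle line. -/
theorem exists_mem_valley (hN₀ : 1 ≤ N₀.re) (hN₁ : 1 ≤ N₁.re) (h₀ : p₀ ∈ logStrip)
    (he : exp p₀ = N₁ / N₀) : ∃ b ∈ logStrip, p₀.im < b.im ∧
      (phase N₀ N₁ p₀ - phase N₀ N₁ b).re < 0 ∧
      0 < (saddleScale N₀ N₁ * saddleCoord p₀ b).im := by
  have hp0 : 0 < N₀.re := by linarith
  have hp1 : 0 < N₁.re := by linarith
  set a := saddleScale N₀ N₁ with hadef
  have h1 : ContinuousAt (fun y : ℝ => gapRoot (p₀, p₀ + y * I)) 0 := by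
    have : ContinuousAt (fun q => gapRoot (p₀, q)) (p₀ + (0 : ℝ) * I) :=
      (continuousOn_gapRoot.comp (f := fun q => (p₀, q)) (by fun_prop)
        (fun q hq => ⟨h₀, hq⟩)).continuousAt (isOpen_logStrip.mem_nhds (by simpa using h₀))
    exact ContinuousAt.comp (f := fun y : ℝ => p₀ + y * I) this (by fun_prop)
  have g0 : gapRoot (p₀, p₀ + ((0 : ℝ) : ℂ) * I) = 1 := by
    rw [ofReal_zero, zero_mul, add_zero, gapRoot_self h₀]
  have e1 : ∀ᶠ y : ℝ in 𝓝 0, 0 < (a * gapRoot (p₀, p₀ + y * I)).re := by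
    have hc : ContinuousAt (fun y : ℝ => (a * gapRoot (p₀, p₀ + y * I)).re) 0 :=
      continuous_re.continuousAt.comp (continuousAt_const.mul h1)
    refine hc.eventually_const_lt ?_
    simp only [g0, mul_one]; exact re_saddleScale_pos hp0 hp1
  have e2 : ∀ᶠ y : ℝ in 𝓝 0, 0 < ((a * gapRoot (p₀, p₀ + y * I)) ^ 2).re := by
    have hc : ContinuousAt (fun y : ℝ => ((a * gapRoot (p₀, p₀ + y * I)) ^ 2).re) 0 :=
      continuous_re.continuousAt.comp ((continuousAt_const.mul h1).pow 2)
    refine hc.eventually_const_lt ?_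
    simp only [g0, mul_one]; rw [hadef, saddleScale_sq]; exact re_harmonic_pos hp0 hp1
  have e3 : ∀ᶠ y : ℝ in 𝓝 0, p₀ + y * I ∈ logStrip := by
    have : ContinuousAt (fun y : ℝ => p₀ + y * I) 0 := by fun_prop
    exact this.eventually_mem (isOpen_logStrip.mem_nhds (by simpa using h₀))
  obtain ⟨y, ⟨⟨hy1, hy2⟩, hy3⟩, hy⟩ := (((e1.and e2).and e3).filter_mono
    (nhdsWithin_le_nhds (s := Ioi 0))).and self_mem_nhdsWithin |>.exists
  have hy : 0 < y := hy
  -- Just above the saddle `Z ≈ i y a` with `Re a > 0` and `Re a² > 0`; hence `Im Z > 0` and `Re Z²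
  -- < 0` for small `y > 0`.
  have hZ : a * saddleCoord p₀ (p₀ + y * I) = y * (I * (a * gapRoot (p₀, p₀ + y * I))) := by
    rw [saddleCoord]; ring
  refine ⟨p₀ + y * I, hy3, by simpa using hy, ?_, ?_⟩
  · rw [← saddleScale_mul_sq hp0 hp1 h₀ he hy3, ← hadef, hZ, mul_pow, mul_pow, I_sq, ← ofReal_pow,
      re_ofReal_mul, neg_one_mul, neg_re]
    nlinarith [mul_pos (pow_pos hy 2) hy2]
  · rw [hZ, im_ofReal_mul, I_mul_im]; exact mul_pos hy hy1

end path

end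

/-! ### The difference of the kernels and the exact representation of the error. -/

noncomputable section

theorem dslope_exp_ne_zero {p b : ℂ} (hp : p ∈ logStrip) (hb : b ∈ logStrip) :
    dslope exp b p ≠ 0 := by
  by_cases h : p = b
  · rw [h, dslope_same, Complex.deriv_exp]; exact exp_ne_zero b
  · rw [dslope_of_ne _ h, slope_def_field]
    exact div_ne_zero (exp_sub_exp_ne_zero hp hb h) (sub_ne_zero.2 h)

theorem saddleCoord_sub_ne_zero {p₀ p b : ℂ} (h₀ : p₀ ∈ logStrip) (hp : p ∈ logStrip)
    (hb : b ∈ logStrip) (h : p ≠ b) : saddleCoord p₀ p - saddleCoord p₀ b ≠ 0 :=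
  fun h0 => h (saddleCoord_injOn h₀ hp hb (sub_eq_zero.1 h0))

theorem dslope_saddleCoord_ne_zero {p₀ p b : ℂ} (h₀ : p₀ ∈ logStrip) (hp : p ∈ logStrip)
    (hb : b ∈ logStrip) : dslope (saddleCoord p₀) b p ≠ 0 := by
  by_cases h : p = b
  · rw [h, dslope_same]; exact deriv_saddleCoord_ne_zero h₀ hb
  · rw [dslope_of_ne _ h, slope_def_field]
    exact div_ne_zero (saddleCoord_sub_ne_zero h₀ hp hb h) (sub_ne_zero.2 h)

/-- The difference of the two kernels with a simple pole of residue one at `b`, with the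
singularity at `b` removed. -/
def kernelDiff (p₀ b : ℂ) : ℂ → ℂ :=
  dslope (fun p => (1 + exp b) * logistic p / dslope exp b p -
    deriv (saddleCoord p₀) p / dslope (saddleCoord p₀) b p) b

theorem kernelDiff_of_ne {p₀ p b : ℂ} (h₀ : p₀ ∈ logStrip) (hb : b ∈ logStrip) (h : p ≠ b) :
    kernelDiff p₀ b p = (1 + exp b) * (logistic p / (exp p - exp b)) -
      deriv (saddleCoord p₀) p / (saddleCoord p₀ p - saddleCoord p₀ b) := by
  have h1 := one_add_exp_ne_zero hb
  have h2 := exp_ne_zero b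
  have h3 := deriv_saddleCoord_ne_zero h₀ hb
  have h4 : p - b ≠ 0 := sub_ne_zero.2 h
  -- Both residues equal one, so the function inside the outer `dslope` vanishes at `b` and the
  -- slope is the kernel difference itself.
  have hz : (1 + exp b) * logistic b / dslope exp b b -
      deriv (saddleCoord p₀) b / dslope (saddleCoord p₀) b b = 0 := by
    rw [dslope_same, dslope_same, Complex.deriv_exp, div_self h3, logistic]; field_simp; ring
  rw [kernelDiff, dslope_of_ne _ h, slope_def_field, hz, dslope_of_ne _ h, dslope_of_ne _ h,
    slope_def_field, slope_def_field, sub_zero, sub_div, div_div, div_div, div_mul_cancel₀ _ h4,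
    div_mul_cancel₀ _ h4, mul_div_assoc]

theorem differentiableOn_kernelDiff {p₀ b : ℂ} (h₀ : p₀ ∈ logStrip) (hb : b ∈ logStrip) :
    DifferentiableOn ℂ (kernelDiff p₀ b) logStrip := by
  have hn := isOpen_logStrip.mem_nhds hb
  refine (differentiableOn_dslope hn).2 (DifferentiableOn.sub ?_ ?_)
  · refine DifferentiableOn.div (DifferentiableOn.const_mul (fun p hp =>
      (hasDerivAt_logistic hp).differentiableAt.differentiableWithinAt) _)
      ((differentiableOn_dslope hn).2 differentiable_exp.differentiableOn)
      fun p hp => dslope_exp_ne_zero hp hb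
  · exact (differentiableOn_deriv_saddleCoord h₀).div
      ((differentiableOn_dslope hn).2 (differentiableOn_saddleCoord h₀))
      fun p hp => dslope_saddleCoord_ne_zero h₀ hp hb

/-- The kernel difference is bounded near the ends of the strip. -/
theorem exists_tail_bound_kernelDiff {k l : Set ℂ} (hk : IsCompact k) (hks : k ⊆ logStrip)
    (hl : IsCompact l) (hls : l ⊆ logStrip) :
    ∃ C X : ℝ, ∀ p₀ ∈ k, ∀ b ∈ l, ∀ p ∈ logStrip, X ≤ |p.re| → ‖kernelDiff p₀ b p‖ ≤ C := by
  obtain ⟨C₁, X₁, h₁⟩ := exists_tail_bound_logistic_div hl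
  obtain ⟨C₂, X₂, h₂⟩ := exists_tail_bound_deriv_div hk hks hl hls
  obtain ⟨B, hB0, hB⟩ := exists_abs_re_le_of_isCompact hl
  refine ⟨(1 + Real.exp B) * C₁ + C₂, max (max X₁ X₂) (B + 1), fun p₀ h₀ b hb p hp hX => ?_⟩
  have hne : p ≠ b := fun h => by
    have h1 := hB b hb
    rw [← h] at h1
    have h2 := (le_max_right _ _).trans hX
    linarith
  rw [kernelDiff_of_ne (hks h₀) (hls hb) hne]
  have e : ‖1 + exp b‖ ≤ 1 + Real.exp B := by
    refine (norm_add_le _ _).trans ?_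
    rw [norm_one, norm_exp]
    gcongr
    exact (le_abs_self _).trans (hB b hb)
  refine (norm_sub_le _ _).trans (add_le_add ?_ (h₂ p₀ h₀ b hb p hp
    (((le_max_right _ _).trans (le_max_left _ _)).trans hX)))
  rw [norm_mul]
  exact mul_le_mul e (h₁ p (((le_max_left _ _).trans (le_max_left _ _)).trans hX) b hb)
    (norm_nonneg _) (by positivity)

section representation

variable {N₀ N₁ p₀ : ℂ}

theorem integral_exp_phase_sub_mul (G : ℂ → ℂ) : ∫ x : ℝ,
    exp (phase N₀ N₁ (p₀ + x) - phase N₀ N₁ p₀) * G (p₀ + x) =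
      exp (-phase N₀ N₁ p₀) * ∫ x : ℝ, exp (phase N₀ N₁ (x + p₀.im * I)) * G (x + p₀.im * I) := by
  rw [integral_line_im (fun p => exp (phase N₀ N₁ p) * G p) p₀, ← integral_const_mul]
  refine integral_congr_ae (Eventually.of_forall fun x => ?_)
  simp only
  rw [sub_eq_neg_add, exp_add]; ring

theorem integrable_exp_phase_sub_mul (hN₀ : 0 < N₀.re) (hN₁ : 0 < N₁.re) (h₀ : p₀ ∈ logStrip)
    {G : ℂ → ℂ} {C X : ℝ} (hG : ContinuousOn G logStrip)
    (ht : ∀ p ∈ logStrip, X ≤ |p.re| → ‖G p‖ ≤ C) :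
    Integrable fun x : ℝ => exp (phase N₀ N₁ (p₀ + x) - phase N₀ N₁ p₀) * G (p₀ + x) := by
  have him := abs_lt.1 (mem_logStrip.1 h₀)
  have hsub := closedStrip_subset_logStrip him.1 him.2
  have h1 := ((integrable_exp_phase_mul hN₀ hN₁ him.1 him.2 (hG.mono hsub)
    fun p hp hX => ht p (hsub hp) hX).comp_add_right p₀.re).const_mul (exp (-phase N₀ N₁ p₀))
  refine h1.congr (Eventually.of_forall fun x => ?_)
  simp only
  rw [← add_ofReal_eq, sub_eq_neg_add, exp_add]; ring

/-- Both sides are holomorphic in `b` above the line `Im p = θ`; on the left this uses the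
injectivity of `u`, which leaves no other pole. For `b` in the valley above the saddle the line can
be raised to `p₀` without meeting `b`, and the Cauchy transform applies. The valley contains an open
set, so the identity theorem extends the formula. -/
theorem exp_phase_mul_erfc_eq (hN₀ : 1 ≤ N₀.re) (hN₁ : 1 ≤ N₁.re) (h₀ : p₀ ∈ logStrip)
    (he : exp p₀ = N₁ / N₀) {θ : ℝ} (h₁ : -Real.pi < θ) (h₂ : θ < p₀.im) {b : ℂ}
    (hb : b ∈ logStrip) (hθ : θ < b.im) :
    exp (-phase N₀ N₁ p₀) * ∫ x : ℝ, exp (phase N₀ N₁ (x + θ * I)) *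
      (deriv (saddleCoord p₀) (x + θ * I) /
        (saddleCoord p₀ (x + θ * I) - saddleCoord p₀ b)) =
      Real.pi * I * exp (phase N₀ N₁ b - phase N₀ N₁ p₀) *
        erfc (-I * (saddleScale N₀ N₁ * saddleCoord p₀ b)) := by
  have hp0 : 0 < N₀.re := by linarith
  have hp1 : 0 < N₁.re := by linarith
  have him := abs_lt.1 (mem_logStrip.1 h₀)
  have hsub : closedStrip θ θ ⊆ logStrip := closedStrip_subset_logStrip h₁ (h₂.trans him.2)
  have hu := differentiableOn_saddleCoord h₀
  have hu' := differentiableOn_deriv_saddleCoord h₀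
  have hk : ({p₀} : Set ℂ) ⊆ logStrip := singleton_subset_iff.2 h₀
  let U : Set ℂ := logStrip ∩ {b | θ < b.im}
  have hU : IsOpen U := isOpen_logStrip_above θ
  have hUconv : Convex ℝ U := convex_logStrip.inter (convex_halfSpace_im_gt θ)
  have hneU : ∀ p ∈ closedStrip θ θ, ∀ b ∈ U, saddleCoord p₀ p - saddleCoord p₀ b ≠ 0 :=
    fun p hp b hb => saddleCoord_sub_ne_zero h₀ (hsub hp) hb.1 fun h => by
      rw [h] at hp; exact absurd hp.2 (not_le.2 hb.2)
  have hL : DifferentiableOn ℂ (fun b => exp (-phase N₀ N₁ p₀) * ∫ x : ℝ,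
      exp (phase N₀ N₁ (x + θ * I)) * (deriv (saddleCoord p₀) (x + θ * I) /
        (saddleCoord p₀ (x + θ * I) - saddleCoord p₀ b))) U := by
    refine DifferentiableOn.const_mul (differentiableOn_integral_exp_phase_mul hp0 hp1
      (G := fun x => deriv (saddleCoord p₀) x.1 / (saddleCoord p₀ x.1 - saddleCoord p₀ x.2))
      hU h₁ (h₂.trans him.2) ?_ ?_ ?_) _
    · refine ContinuousOn.div ?_ (ContinuousOn.sub ?_ ?_) fun x hx => hneU x.1 hx.1 x.2 hx.2
      · exact hu'.continuousOn.comp continuousOn_fst fun x hx => hsub hx.1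
      · exact hu.continuousOn.comp continuousOn_fst fun x hx => hsub hx.1
      · exact hu.continuousOn.comp continuousOn_snd fun x hx => hx.2.1
    · intro p hp
      exact (differentiableOn_const (deriv (saddleCoord p₀) p)).div ((differentiableOn_const (saddleCoord p₀ p)).sub
        (hu.mono inter_subset_left)) fun b hb => hneU p hp b hb
    · intro k hkU hkc
      obtain ⟨C, X, h⟩ := exists_tail_bound_deriv_div isCompact_singleton hk hkc
        fun b hb => (hkU hb).1
      exact ⟨C, X, fun p hp hX b hb => h p₀ rfl b hb p (hsub hp) hX⟩
  have hR : DifferentiableOn ℂ (fun b => Real.pi * I * exp (phase N₀ N₁ b - phase N₀ N₁ p₀) *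
        erfc (-I * (saddleScale N₀ N₁ * saddleCoord p₀ b))) U := by
    have hph := (differentiableOn_phase N₀ N₁).mono (inter_subset_left (t := {b | θ < b.im}))
    have huU := hu.mono (inter_subset_left (t := {b | θ < b.im}))
    refine DifferentiableOn.mul (DifferentiableOn.const_mul (hph.sub_const _).cexp _) ?_
    exact differentiable_erfc.comp_differentiableOn ((huU.const_mul _).const_mul _)
  obtain ⟨b₁, hb₁, himb₁, hval₁, hval₂⟩ := exists_mem_valley hN₀ hN₁ h₀ he
  refine AnalyticOnNhd.eqOn_of_preconnected_of_eventuallyEq (hL.analyticOnNhd hU)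
    (hR.analyticOnNhd hU) hUconv.isPreconnected (z₀ := b₁) ⟨hb₁, h₂.trans himb₁⟩ ?_ ⟨hb, hθ⟩
  have hcph := ((differentiableOn_phase N₀ N₁).differentiableAt
    (isOpen_logStrip.mem_nhds hb₁)).continuousAt
  have hcu := (hu.differentiableAt (isOpen_logStrip.mem_nhds hb₁)).continuousAt
  have hc₁ : ContinuousAt (fun b => (phase N₀ N₁ p₀ - phase N₀ N₁ b).re) b₁ :=
    continuous_re.continuousAt.comp (continuousAt_const.sub hcph)
  have hc₂ : ContinuousAt (fun b => (saddleScale N₀ N₁ * saddleCoord p₀ b).im) b₁ :=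
    continuous_im.continuousAt.comp (continuousAt_const.mul hcu)
  filter_upwards [isOpen_logStrip.mem_nhds hb₁, continuous_im.continuousAt.eventually_const_lt himb₁,
    hc₁.eventually_lt_const hval₁, hc₂.eventually_const_lt hval₂] with b hb hbim hre himz
  rw [← integral_exp_phase_mul_deriv_div hN₀ hN₁ h₀ he hb hre himz]
  have hbpi := (abs_lt.1 (mem_logStrip.1 hb)).2
  have hS : closedStrip θ p₀.im ⊆ logStrip := closedStrip_subset_logStrip h₁ him.2
  obtain ⟨C, X, h⟩ := exists_tail_bound_deriv_div isCompact_singleton hk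
    (isCompact_singleton (x := b)) (singleton_subset_iff.2 hb)
  rw [integral_exp_phase_sub_mul (fun p => deriv (saddleCoord p₀) p /
    (saddleCoord p₀ p - saddleCoord p₀ b))]
  congr 1
  refine integral_exp_phase_mul_shift hp0 hp1 (G := fun p => deriv (saddleCoord p₀) p /
    (saddleCoord p₀ p - saddleCoord p₀ b)) h₂.le h₁ him.2 ?_ (C := C) (X := X)
    fun p hp hX => h p₀ rfl b rfl p (hS hp) hX
  refine (hu'.mono hS).div ((hu.mono hS).sub_const _) fun p hp => ?_
  refine saddleCoord_sub_ne_zero h₀ (hS hp) hb fun h => ?_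
  rw [h] at hp
  exact absurd hp.2 (not_le.2 hbim)

/-- The exact difference between `I(β)` and its error function term, as an integral along the
saddle line. -/
theorem hypergeometricI_sub_erfc (hN₀ : 1 ≤ N₀.re) (hN₁ : 1 ≤ N₁.re) (h₀ : p₀ ∈ logStrip)
    (he : exp p₀ = N₁ / N₀) {b : ℂ} (hb : b ∈ logStrip) :
    exp (-phase N₀ N₁ p₀) * ((1 + exp b) * hypergeometricI N₀ N₁ (exp b)) -
      Real.pi * I * exp (phase N₀ N₁ b - phase N₀ N₁ p₀) *
        erfc (-I * (saddleScale N₀ N₁ * saddleCoord p₀ b)) =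
      ∫ x : ℝ, exp (phase N₀ N₁ (p₀ + x) - phase N₀ N₁ p₀) * kernelDiff p₀ b (p₀ + x) := by
  have hp0 : 0 < N₀.re := by linarith
  have hp1 : 0 < N₁.re := by linarith
  have him := abs_lt.1 (mem_logStrip.1 h₀)
  have hbim := abs_lt.1 (mem_logStrip.1 hb)
  -- A line below both the saddle and the pole: each kernel can be integrated separately there, and
  -- the two are subtracted before the line is raised, when no pole is left to cross.
  obtain ⟨θ, h₁, h₂⟩ := exists_between (lt_min him.1 hbim.1)
  have h₃ : θ < p₀.im := h₂.trans_le (min_le_left _ _)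
  have h₄ : θ < b.im := h₂.trans_le (min_le_right _ _)
  have hk : ({p₀} : Set ℂ) ⊆ logStrip := singleton_subset_iff.2 h₀
  have hl : ({b} : Set ℂ) ⊆ logStrip := singleton_subset_iff.2 hb
  have hS : closedStrip θ p₀.im ⊆ logStrip := closedStrip_subset_logStrip h₁ him.2
  have hsub : closedStrip θ θ ⊆ logStrip := closedStrip_subset_logStrip h₁ (h₃.trans him.2)
  have hne : ∀ p ∈ closedStrip θ θ, p ≠ b := fun p hp h => by
    rw [h] at hp; exact absurd hp.2 (not_le.2 h₄)
  obtain ⟨C, X, hT⟩ := exists_tail_bound_kernelDiff isCompact_singleton hk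
    (isCompact_singleton (x := b)) hl
  obtain ⟨C₁, X₁, hT₁⟩ := exists_tail_bound_logistic_div (isCompact_singleton (x := b))
  obtain ⟨C₂, X₂, hT₂⟩ := exists_tail_bound_deriv_div isCompact_singleton hk
    (isCompact_singleton (x := b)) hl
  rw [integral_exp_phase_sub_mul, ← integral_exp_phase_mul_shift hp0 hp1 h₃.le h₁ him.2
    ((differentiableOn_kernelDiff h₀ hb).mono hS) fun p hp hX => hT p₀ rfl b rfl p (hS hp) hX,
    ← exp_phase_mul_erfc_eq hN₀ hN₁ h₀ he h₁ h₃ hb h₄,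
    hypergeometricI_eq_lineEuler hp0 hp1 hb h₁ h₄, ← mul_sub, lineEuler, ← integral_const_mul,
    ← integral_sub]
  · congr 1
    refine integral_congr_ae (Eventually.of_forall fun x => ?_)
    simp only
    rw [kernelDiff_of_ne h₀ hb (hne _ (ofReal_add_mul_I_mem_closedStrip x θ))]
    ring
  · refine (integrable_exp_phase_mul hp0 hp1 (G := fun p => logistic p / (exp p - exp b)) h₁
      (h₃.trans him.2) ?_ fun p _ hX => hT₁ p hX b rfl).const_mul _
    exact (continuousOn_logistic.mono hsub).div (by fun_prop)
      fun p hp => exp_sub_exp_ne_zero (hsub hp) hb (hne p hp)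
  · refine integrable_exp_phase_mul hp0 hp1 (G := fun p => deriv (saddleCoord p₀) p /
      (saddleCoord p₀ p - saddleCoord p₀ b)) h₁ (h₃.trans him.2) ?_
      fun p hp hX => hT₂ p₀ rfl b rfl p (hsub hp) hX
    exact ((differentiableOn_deriv_saddleCoord h₀).continuousOn.mono hsub).div
      (((differentiableOn_saddleCoord h₀).continuousOn.mono hsub).sub continuousOn_const)
      fun p hp => saddleCoord_sub_ne_zero h₀ (hsub hp) hb (hne p hp)

end representation

end

/-! ### The quotient in Laplace's method and its uniform bounds. -/

noncomputable section

/-- A function continuous on a closed subset of the product of a closed strip with a compact set is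
bounded there as soon as it is bounded near the two ends of the strip. -/
theorem exists_bound_of_tails_of_isClosed {θ₁ θ₂ : ℝ} {P : Type*} [TopologicalSpace P] {k : Set P}
    (hk : IsCompact k) {T : Set (ℂ × P)} (hT : IsClosed T) (hTk : T ⊆ closedStrip θ₁ θ₂ ×ˢ k)
    {G : ℂ × P → ℂ} (hG : ContinuousOn G T) {C X : ℝ}
    (ht : ∀ x ∈ T, X ≤ |x.1.re| → ‖G x‖ ≤ C) : ∃ C', 0 ≤ C' ∧ ∀ x ∈ T, ‖G x‖ ≤ C' := by
  have hc : IsCompact (T ∩ (closedStrip θ₁ θ₂ ∩ {p | |p.re| ≤ X}) ×ˢ k) :=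
    ((isCompact_closedStrip_inter θ₁ θ₂ X).prod hk).inter_left hT
  obtain ⟨D, hD⟩ := hc.exists_bound_of_continuousOn (hG.mono inter_subset_left)
  refine ⟨max (max C D) 0, le_max_right _ _, fun x hx => ?_⟩
  rcases le_total X |x.1.re| with h | h
  · exact (ht x hx h).trans ((le_max_left _ _).trans (le_max_left _ _))
  · exact (hD x ⟨hx, ⟨(hTk hx).1, h⟩, (hTk hx).2⟩).trans
      ((le_max_right _ _).trans (le_max_left _ _))

theorem norm_exp_div_exp_sub_exp_le {B : ℝ} {p b : ℂ} (hp : B + 1 ≤ |p.re|)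
    (hb : |b.re| ≤ B) : ‖exp p / (exp p - exp b)‖ ≤ 2 := by
  have h0 := Real.exp_neg_one_lt_d9
  have h1 := norm_sub_norm_le (exp p) (exp b)
  have h2 := norm_sub_norm_le (exp b) (exp p)
  rw [norm_sub_rev (exp b)] at h2
  rw [norm_exp, norm_exp] at h1 h2
  have hb' := abs_le.1 hb
  have key : Real.exp p.re ≤ 2 * ‖exp p - exp b‖ ∧ 0 < ‖exp p - exp b‖ := by
    rcases le_abs'.1 hp with h | h
    · have h3 : Real.exp p.re ≤ Real.exp b.re * Real.exp (-1) := by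
        rw [← Real.exp_add]; exact Real.exp_le_exp.2 (by linarith)
      constructor <;> nlinarith [Real.exp_pos b.re]
    · have h3 : Real.exp b.re ≤ Real.exp p.re * Real.exp (-1) := by
        rw [← Real.exp_add]; exact Real.exp_le_exp.2 (by linarith)
      constructor <;> nlinarith [Real.exp_pos p.re]
  rw [norm_div, norm_exp, div_le_iff₀ key.2]
  exact key.1

/-- The quotient `(R - R(p₀) u') / (u u')`, where `R` is the kernel difference, away from the
points `p₀` and `b`. -/
def laplaceQuot (x : ℂ × ℂ × ℂ) : ℂ :=
  logisticDeriv x.2.1 * (1 + exp x.2.2) * (1 + exp x.2.1) *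
    (exp x.1 / (exp x.1 - exp x.2.2) * (1 / (exp x.1 - exp x.2.1))) -
  1 / saddleCoord x.2.1 x.1 * (1 / (saddleCoord x.2.1 x.1 - saddleCoord x.2.1 x.2.2)) -
  ((1 + exp x.2.2) * (logistic x.2.1 / (exp x.2.1 - exp x.2.2)) + 1 / saddleCoord x.2.1 x.2.2) *
    (1 / saddleCoord x.2.1 x.1)

/-- The explicit formula is jointly continuous where the three points are separated, and each factor
is bounded near the ends of the strip; compactness handles the rest. -/
theorem exists_laplaceQuot_le {k : Set ℂ} (hk : IsCompact k) (hks : k ⊆ logStrip) {θ r : ℝ}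
    (hθ : θ < Real.pi) (hr : 0 < r) : ∃ M, 0 ≤ M ∧ ∀ q ∈ closedStrip (-θ) θ, ∀ p₀ ∈ k, ∀ b ∈ k,
      r ≤ ‖q - p₀‖ → r ≤ ‖q - b‖ → r ≤ ‖p₀ - b‖ → ‖laplaceQuot (q, p₀, b)‖ ≤ M := by
  have hS : closedStrip (-θ) θ ⊆ logStrip := closedStrip_subset_logStrip (by linarith) hθ
  let T : Set (ℂ × ℂ × ℂ) := closedStrip (-θ) θ ×ˢ (k ×ˢ k) ∩
    {x | r ≤ ‖x.1 - x.2.1‖ ∧ r ≤ ‖x.1 - x.2.2‖ ∧ r ≤ ‖x.2.1 - x.2.2‖}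
  have hT : IsClosed T := by
    refine ((isClosed_closedStrip _ _).prod (hk.prod hk).isClosed).inter ?_
    have hcl : ∀ f : ℂ × ℂ × ℂ → ℝ, Continuous f → IsClosed {x | r ≤ f x} := fun f hf =>
      isClosed_le continuous_const hf
    exact (hcl (fun x => ‖x.1 - x.2.1‖) (by fun_prop)).inter
      ((hcl (fun x => ‖x.1 - x.2.2‖) (by fun_prop)).inter
        (hcl (fun x => ‖x.2.1 - x.2.2‖) (by fun_prop)))
  have hmem : ∀ x ∈ T, x.1 ∈ logStrip ∧ x.2.1 ∈ logStrip ∧ x.2.2 ∈ logStrip := fun x hx =>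
    ⟨hS hx.1.1, hks hx.1.2.1, hks hx.1.2.2⟩
  have hne : ∀ x ∈ T, x.1 ≠ x.2.1 ∧ x.1 ≠ x.2.2 ∧ x.2.1 ≠ x.2.2 := fun x hx => by
    obtain ⟨h1, h2, h3⟩ := hx.2
    refine ⟨fun h => ?_, fun h => ?_, fun h => ?_⟩
    · rw [h, sub_self, norm_zero] at h1; linarith
    · rw [h, sub_self, norm_zero] at h2; linarith
    · rw [h, sub_self, norm_zero] at h3; linarith
  have cu : ContinuousOn (fun x : ℂ × ℂ × ℂ => saddleCoord x.2.1 x.1) T :=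
    continuousOn_saddleCoord.comp (f := fun x : ℂ × ℂ × ℂ => (x.2.1, x.1)) (by fun_prop)
      fun x hx => ⟨(hmem x hx).2.1, (hmem x hx).1⟩
  have cub : ContinuousOn (fun x : ℂ × ℂ × ℂ => saddleCoord x.2.1 x.2.2) T :=
    continuousOn_saddleCoord.comp (f := fun x : ℂ × ℂ × ℂ => (x.2.1, x.2.2)) (by fun_prop)
      fun x hx => ⟨(hmem x hx).2.1, (hmem x hx).2.2⟩
  have cl : ContinuousOn (fun x : ℂ × ℂ × ℂ => logistic x.2.1) T :=
    continuousOn_logistic.comp (f := fun x : ℂ × ℂ × ℂ => x.2.1) (by fun_prop)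
      fun x hx => (hmem x hx).2.1
  have cd : ContinuousOn (fun x : ℂ × ℂ × ℂ => logisticDeriv x.2.1) T :=
    continuousOn_logisticDeriv.comp (f := fun x : ℂ × ℂ × ℂ => x.2.1) (by fun_prop)
      fun x hx => (hmem x hx).2.1
  have nu : ∀ x ∈ T, saddleCoord x.2.1 x.1 ≠ 0 := fun x hx =>
    saddleCoord_ne_zero (hmem x hx).2.1 (hmem x hx).1 (hne x hx).1
  have nub : ∀ x ∈ T, saddleCoord x.2.1 x.2.2 ≠ 0 := fun x hx =>
    saddleCoord_ne_zero (hmem x hx).2.1 (hmem x hx).2.2 (hne x hx).2.2.symm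
  have c₁ : ContinuousOn (fun x : ℂ × ℂ × ℂ => logisticDeriv x.2.1 * (1 + exp x.2.2) *
      (1 + exp x.2.1)) T := (cd.mul (by fun_prop)).mul (by fun_prop)
  have c₂ : ContinuousOn (fun x : ℂ × ℂ × ℂ => exp x.1 / (exp x.1 - exp x.2.2) *
      (1 / (exp x.1 - exp x.2.1))) T :=
    (ContinuousOn.div (by fun_prop) (by fun_prop) fun x hx =>
      exp_sub_exp_ne_zero (hmem x hx).1 (hmem x hx).2.2 (hne x hx).2.1).mul
    (ContinuousOn.div (by fun_prop) (by fun_prop) fun x hx =>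
      exp_sub_exp_ne_zero (hmem x hx).1 (hmem x hx).2.1 (hne x hx).1)
  have c₃ : ContinuousOn (fun x : ℂ × ℂ × ℂ => 1 / saddleCoord x.2.1 x.1) T :=
    continuousOn_const.div cu nu
  have c₄ : ContinuousOn (fun x : ℂ × ℂ × ℂ =>
      1 / (saddleCoord x.2.1 x.1 - saddleCoord x.2.1 x.2.2)) T :=
    continuousOn_const.div (cu.sub cub) fun x hx =>
      saddleCoord_sub_ne_zero (hmem x hx).2.1 (hmem x hx).1 (hmem x hx).2.2 (hne x hx).2.1
  have c₅ : ContinuousOn (fun x : ℂ × ℂ × ℂ => (1 + exp x.2.2) *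
      (logistic x.2.1 / (exp x.2.1 - exp x.2.2)) + 1 / saddleCoord x.2.1 x.2.2) T :=
    (ContinuousOn.mul (by fun_prop) (cl.div (by fun_prop) fun x hx =>
      exp_sub_exp_ne_zero (hmem x hx).2.1 (hmem x hx).2.2 (hne x hx).2.2)).add
      (continuousOn_const.div cub nub)
  have hG : ContinuousOn laplaceQuot T := by
    exact ((c₁.mul c₂).sub (c₃.mul c₄)).sub (c₅.mul c₃)
  have hTsub : T ⊆ closedStrip (-θ) θ ×ˢ (k ×ˢ k) := inter_subset_left
  obtain ⟨B, hB0, hB⟩ := exists_abs_re_le_of_isCompact hk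
  obtain ⟨X₁, -, hX₁⟩ := exists_saddleCoord_ge hk hks 1
  obtain ⟨X₂, -, hX₂⟩ := exists_tail_saddleCoord_sub_ge hk hks hk hks 1
  -- the factors depending on the parameters alone
  have hcont : ∀ f : ℂ × ℂ → ℂ, ContinuousOn f ((k ×ˢ k) ∩ {x | r ≤ ‖x.1 - x.2‖}) →
      ∃ C, 0 ≤ C ∧ ∀ x ∈ T, ‖f x.2‖ ≤ C := by
    intro f hf
    have hc : IsCompact ((k ×ˢ k) ∩ {x : ℂ × ℂ | r ≤ ‖x.1 - x.2‖}) :=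
      (hk.prod hk).inter_right (isClosed_le continuous_const (by fun_prop))
    obtain ⟨C, hC⟩ := hc.exists_bound_of_continuousOn hf
    exact ⟨max C 0, le_max_right _ _, fun x hx =>
      (hC x.2 ⟨hx.1.2, hx.2.2.2⟩).trans (le_max_left _ _)⟩
  have cl' : ContinuousOn (fun x : ℂ × ℂ => logistic x.1)
      ((k ×ˢ k) ∩ {x | r ≤ ‖x.1 - x.2‖}) :=
    continuousOn_logistic.comp continuousOn_fst fun x hx => hks hx.1.1
  have cd' : ContinuousOn (fun x : ℂ × ℂ => logisticDeriv x.1)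
      ((k ×ˢ k) ∩ {x | r ≤ ‖x.1 - x.2‖}) :=
    continuousOn_logisticDeriv.comp continuousOn_fst fun x hx => hks hx.1.1
  have hne' : ∀ x ∈ (k ×ˢ k) ∩ {x : ℂ × ℂ | r ≤ ‖x.1 - x.2‖}, x.1 ≠ x.2 := fun x hx h => by
    have := hx.2
    rw [mem_ofPred_eq, h, sub_self, norm_zero] at this; linarith
  obtain ⟨C₁, hC₁0, hC₁⟩ := hcont (fun x => logisticDeriv x.1 * (1 + exp x.2) * (1 + exp x.1))
    ((cd'.mul (by fun_prop)).mul (by fun_prop))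
  obtain ⟨C₅, hC₅0, hC₅⟩ := hcont (fun x => (1 + exp x.2) *
      (logistic x.1 / (exp x.1 - exp x.2)) + 1 / saddleCoord x.1 x.2)
    ((ContinuousOn.mul (by fun_prop) (cl'.div (by fun_prop) fun x hx =>
      exp_sub_exp_ne_zero (hks hx.1.1) (hks hx.1.2) (hne' x hx))).add
      (continuousOn_const.div (continuousOn_saddleCoord.mono fun x hx =>
        ⟨hks hx.1.1, hks hx.1.2⟩) fun x hx =>
          saddleCoord_ne_zero (hks hx.1.1) (hks hx.1.2) (hne' x hx).symm))
  obtain ⟨M, hM0, hM⟩ := exists_bound_of_tails_of_isClosed (hk.prod hk) hT hTsub hG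
    (C := C₁ * (2 * (1 / (Real.exp (-B) / 2))) + 1 * 1 + C₅ * 1) (X := max (max X₁ X₂) (B + 1))
    (fun x hx hX => by
      have hXB := (le_max_right _ _).trans hX
      have b₁ := hB _ hx.1.2.1
      have b₂ := hB _ hx.1.2.2
      have e₁ : ‖1 / saddleCoord x.2.1 x.1‖ ≤ 1 := by
        rw [norm_div, norm_one]
        exact div_le_one_of_le₀ (hX₁ _ hx.1.2.1 _ (hmem x hx).1
          (((le_max_left _ _).trans (le_max_left _ _)).trans hX)) (norm_nonneg _)
      have e₂ : ‖1 / (saddleCoord x.2.1 x.1 - saddleCoord x.2.1 x.2.2)‖ ≤ 1 := by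
        rw [norm_div, norm_one]
        exact div_le_one_of_le₀ (hX₂ _ hx.1.2.1 _ hx.1.2.2 _ (hmem x hx).1
          (((le_max_right _ _).trans (le_max_left _ _)).trans hX)) (norm_nonneg _)
      have e₃ := norm_exp_div_exp_sub_exp_le hXB b₂
      have e₄ : ‖1 / (exp x.1 - exp x.2.1)‖ ≤ 1 / (Real.exp (-B) / 2) := by
        rw [norm_div, norm_one]
        exact one_div_le_one_div_of_le (by positivity) (norm_exp_sub_exp_ge hB0 hXB b₁)
      have e₅ := hC₁ x hx
      have e₆ := hC₅ x hx
      rw [laplaceQuot]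
      refine (norm_sub_le _ _).trans (add_le_add ((norm_sub_le _ _).trans (add_le_add ?_ ?_)) ?_)
      · rw [norm_mul, norm_mul (exp x.1 / _)]
        gcongr
      · rw [norm_mul]
        exact mul_le_mul e₁ e₂ (norm_nonneg _) zero_le_one
      · rw [norm_mul]
        exact mul_le_mul e₆ e₁ (norm_nonneg _) hC₅0)
  exact ⟨M, hM0, fun q hq p₀ h₀ b hb h1 h2 h3 => hM (q, p₀, b) ⟨⟨hq, h₀, hb⟩, h1, h2, h3⟩⟩

/-- The quotient `(R - R(p₀) u') / (u u')`, holomorphic on the whole strip. -/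
def laplaceFactor (p₀ b : ℂ) (p : ℂ) : ℂ :=
  dslope (fun p => kernelDiff p₀ b p - kernelDiff p₀ b p₀ * deriv (saddleCoord p₀) p) p₀ p /
    (dslope (saddleCoord p₀) p₀ p * deriv (saddleCoord p₀) p)

theorem differentiableOn_laplaceFactor {p₀ b : ℂ} (h₀ : p₀ ∈ logStrip) (hb : b ∈ logStrip) :
    DifferentiableOn ℂ (laplaceFactor p₀ b) logStrip := by
  have hn := isOpen_logStrip.mem_nhds h₀
  refine DifferentiableOn.div ((differentiableOn_dslope hn).2
    ((differentiableOn_kernelDiff h₀ hb).sub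
      ((differentiableOn_deriv_saddleCoord h₀).const_mul _)))
    (((differentiableOn_dslope hn).2 (differentiableOn_saddleCoord h₀)).mul
      (differentiableOn_deriv_saddleCoord h₀)) fun p hp => ?_
  exact mul_ne_zero (dslope_saddleCoord_ne_zero h₀ hp h₀) (deriv_saddleCoord_ne_zero h₀ hp)

theorem laplaceFactor_mul {p₀ b p : ℂ} (h₀ : p₀ ∈ logStrip) (hp : p ∈ logStrip) :
    saddleCoord p₀ p * deriv (saddleCoord p₀) p * laplaceFactor p₀ b p =
      kernelDiff p₀ b p - kernelDiff p₀ b p₀ * deriv (saddleCoord p₀) p := by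
  by_cases h : p = p₀
  · rw [h, saddleCoord_self, deriv_saddleCoord_self h₀]; ring
  · have h1 := deriv_saddleCoord_ne_zero h₀ hp
    have h2 := saddleCoord_ne_zero h₀ hp h
    have h3 := sub_ne_zero.2 h
    rw [laplaceFactor, dslope_of_ne _ h, dslope_of_ne _ h, slope_def_field, slope_def_field,
      saddleCoord_self, deriv_saddleCoord_self h₀]
    field_simp
    ring

/-- Replacing `u u'` by means of `saddleCoord_mul_deriv` cancels every derivative of `u`, so joint
continuity in `(p, p₀, b)` becomes visible. -/
theorem laplaceFactor_eq_laplaceQuot {p₀ b p : ℂ} (h₀ : p₀ ∈ logStrip) (hb : b ∈ logStrip)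
    (hp : p ∈ logStrip) (hp₀ : p ≠ p₀) (hpb : p ≠ b) (hne : p₀ ≠ b) :
    laplaceFactor p₀ b p = laplaceQuot (p, p₀, b) := by
  have h1 := deriv_saddleCoord_ne_zero h₀ hp
  have h2 := saddleCoord_ne_zero h₀ hp hp₀
  have h3 := saddleCoord_ne_zero h₀ hb hne.symm
  have h4 := saddleCoord_sub_ne_zero h₀ hp hb hpb
  have h5 := exp_sub_exp_ne_zero hp hb hpb
  have h6 := exp_sub_exp_ne_zero hp h₀ hp₀
  have h7 := exp_sub_exp_ne_zero h₀ hb hne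
  have h8 := one_add_exp_ne_zero hp
  have h9 := one_add_exp_ne_zero h₀
  have h10 := logisticDeriv_ne_zero h₀
  have hL := laplaceFactor_mul (b := b) h₀ hp
  have hs := saddleCoord_mul_deriv h₀ hp
  rw [logistic_sub_logistic hp h₀] at hs
  rw [kernelDiff_of_ne h₀ hb hpb, kernelDiff_of_ne h₀ hb hne, deriv_saddleCoord_self h₀,
    saddleCoord_self] at hL
  have hL2 : laplaceFactor p₀ b p = ((1 + exp b) * (logistic p / (exp p - exp b)) -
      deriv (saddleCoord p₀) p / (saddleCoord p₀ p - saddleCoord p₀ b) -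
      ((1 + exp b) * (logistic p₀ / (exp p₀ - exp b)) - 1 / (0 - saddleCoord p₀ b)) *
        deriv (saddleCoord p₀) p) / (saddleCoord p₀ p * deriv (saddleCoord p₀) p) := by
    rw [eq_div_iff (mul_ne_zero h2 h1), ← hL]; ring
  have hd : (1 + exp b) * (logistic p / (exp p - exp b)) /
      (saddleCoord p₀ p * deriv (saddleCoord p₀) p) =
      logisticDeriv p₀ * (1 + exp b) * (1 + exp p₀) *
        (exp p / (exp p - exp b) * (1 / (exp p - exp p₀))) := by
    have : saddleCoord p₀ p * deriv (saddleCoord p₀) p =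
        (exp p - exp p₀) / ((1 + exp p) * (1 + exp p₀)) / logisticDeriv p₀ := by
      rw [eq_div_iff h10, ← hs]; ring
    rw [this, logistic]
    field_simp
  rw [hL2, sub_div, sub_div, hd, laplaceQuot]
  simp only
  rw [zero_sub]
  field_simp
  ring

end

/-! ### Laplace's method for a pole away from the saddle. -/

noncomputable section

/-- Among three radii one avoids two given distances. -/
theorem exists_radius {ρ : ℝ} (hρ : 0 < ρ) (d e : ℝ) :
    ∃ r, ρ ≤ r ∧ r ≤ 3 * ρ ∧ ρ / 2 ≤ |d - r| ∧ ρ / 2 ≤ |e - r| := by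
  by_contra! h
  have key : ∀ r, ρ ≤ r → r ≤ 3 * ρ → |d - r| < ρ / 2 ∨ |e - r| < ρ / 2 := fun r h1 h2 => by
    by_cases h3 : ρ / 2 ≤ |d - r|
    · exact Or.inr (h r h1 h2 h3)
    · exact Or.inl (not_le.1 h3)
  -- The candidates `ρ`, `2ρ`, `3ρ` are `ρ` apart, so each of the two distances is closer than `ρ/2`
  -- to at most one of them.
  have k1 := key ρ le_rfl (by linarith)
  have k2 := key (2 * ρ) (by linarith) (by linarith)
  have k3 := key (3 * ρ) (by linarith) le_rfl
  simp only [abs_lt] at k1 k2 k3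
  rcases k1 with k1 | k1 <;> rcases k2 with k2 | k2 <;> rcases k3 with k3 | k3 <;> linarith [k1.1, k1.2, k2.1, k2.2, k3.1, k3.2]

/-- Cauchy's estimate on a circle about `p₀ + x` that keeps a distance `ρ/2` from both `p₀` and `b`.
On it the quotient has its explicit form, although `p₀ + x` itself may be close to a removable
singularity. -/
theorem exists_deriv_laplaceFactor_le {k : Set ℂ} (hk : IsCompact k) {θ ρ : ℝ} (hρ : 0 < ρ)
    (hkθ : k ⊆ closedStrip (-θ) θ) (hθ : θ + 3 * ρ < Real.pi) :
    ∃ M, 0 ≤ M ∧ ∀ p₀ ∈ k, ∀ b ∈ k, ρ ≤ ‖p₀ - b‖ →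
      (∀ x : ℝ, ‖deriv (laplaceFactor p₀ b) (p₀ + x)‖ ≤ M) ∧
      ∃ X : ℝ, ∀ x : ℝ, X ≤ |x| → ‖laplaceFactor p₀ b (p₀ + x)‖ ≤ M * ρ := by
  have hS : closedStrip (-(θ + 3 * ρ)) (θ + 3 * ρ) ⊆ logStrip :=
    closedStrip_subset_logStrip (by linarith) hθ
  have hks : k ⊆ logStrip := fun p hp => hS ⟨by linarith [(hkθ hp).1], by linarith [(hkθ hp).2]⟩
  obtain ⟨M, hM0, hM⟩ := exists_laplaceQuot_le hk hks hθ (half_pos hρ)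
  refine ⟨M / ρ, by positivity, fun p₀ h₀ b hb hbρ => ⟨fun x => ?_, ?_⟩⟩
  · have hne : p₀ ≠ b := fun h => by rw [h, sub_self, norm_zero] at hbρ; linarith
    obtain ⟨r, hr1, hr3, hr₀, hrb⟩ := exists_radius hρ ‖p₀ + x - p₀‖ ‖p₀ + x - b‖
    have hr0 : 0 < r := by linarith
    have hball : ∀ q ∈ Metric.closedBall (p₀ + x : ℂ) r,
        q ∈ closedStrip (-(θ + 3 * ρ)) (θ + 3 * ρ) := fun q hq => by
      have h1 := (abs_im_le_norm (q - (p₀ + x))).trans (mem_closedBall_iff_norm.1 hq)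
      have h2 : (q - (p₀ + x)).im = q.im - p₀.im := by simp
      rw [h2, abs_le] at h1
      have h3 := hkθ h₀
      exact ⟨by linarith [h3.1, h1.1], by linarith [h3.2, h1.2]⟩
    have hd : DiffContOnCl ℂ (laplaceFactor p₀ b) (Metric.ball (p₀ + x : ℂ) r) := by
      refine DifferentiableOn.diffContOnCl
        ((differentiableOn_laplaceFactor (hks h₀) (hks hb)).mono fun q hq => ?_)
      exact hS (hball q (Metric.closure_ball_subset_closedBall hq))
    refine (norm_deriv_le_of_forall_mem_sphere_norm_le hr0 hd (C := M) fun q hq => ?_).trans ?_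
    · have hq' := hball q (Metric.sphere_subset_closedBall hq)
      have hqr : ‖q - (p₀ + x)‖ = r := mem_sphere_iff_norm.1 hq
      have far : ∀ c : ℂ, ρ / 2 ≤ |‖p₀ + x - c‖ - r| → ρ / 2 ≤ ‖q - c‖ := fun c hc => by
        have h1 := abs_norm_sub_norm_le (p₀ + x - c) (p₀ + x - q)
        rw [norm_sub_rev (p₀ + x : ℂ) q, hqr, show p₀ + x - c - (p₀ + x - q) = q - c by ring] at h1
        exact hc.trans h1
      have f0 := far p₀ hr₀
      have fb := far b hrb
      rw [laplaceFactor_eq_laplaceQuot (hks h₀) (hks hb) (hS hq') ?_ ?_ hne]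
      · exact hM q hq' p₀ h₀ b hb f0 fb (by linarith)
      · intro h; rw [h, sub_self, norm_zero] at f0; linarith
      · intro h; rw [h, sub_self, norm_zero] at fb; linarith
    · exact div_le_div_of_nonneg_left hM0 hρ hr1
  · rw [div_mul_cancel₀ _ hρ.ne']
    have hne : p₀ ≠ b := fun h => by rw [h, sub_self, norm_zero] at hbρ; linarith
    refine ⟨ρ + ‖p₀ - b‖, fun x hx => ?_⟩
    have hmem : p₀ + x ∈ closedStrip (-(θ + 3 * ρ)) (θ + 3 * ρ) := by
      have h3 := hkθ h₀
      constructor <;> simp <;> linarith [h3.1, h3.2]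
    have f0 : ρ / 2 ≤ ‖p₀ + x - p₀‖ := by
      rw [add_sub_cancel_left, norm_real, Real.norm_eq_abs]
      linarith [norm_nonneg (p₀ - b)]
    have fb : ρ / 2 ≤ ‖p₀ + x - b‖ := by
      have := norm_sub_norm_le (x : ℂ) (b - p₀)
      rw [norm_real, Real.norm_eq_abs, norm_sub_rev b, show (x : ℂ) - (b - p₀) = p₀ + x - b by ring]
        at this
      linarith
    rw [laplaceFactor_eq_laplaceQuot (hks h₀) (hks hb) (hS hmem) ?_ ?_ hne]
    · exact hM _ hmem p₀ h₀ b hb f0 fb (by linarith)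
    · intro h; rw [h, sub_self, norm_zero] at f0; linarith
    · intro h; rw [h, sub_self, norm_zero] at fb; linarith

theorem hasDerivAt_exp_phase_line {N₀ N₁ p₀ : ℂ} (hN₀ : 0 < N₀.re) (hN₁ : 0 < N₁.re)
    (h₀ : p₀ ∈ logStrip) (he : exp p₀ = N₁ / N₀) {p : ℂ} (hp : p ∈ logStrip) :
    HasDerivAt (fun p => exp (phase N₀ N₁ p - phase N₀ N₁ p₀))
      (exp (phase N₀ N₁ p - phase N₀ N₁ p₀) *
        -(N₀ * N₁ / (N₀ + N₁) * (saddleCoord p₀ p * deriv (saddleCoord p₀) p))) p := by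
  have h1 : HasDerivAt (fun p => phase N₀ N₁ p - phase N₀ N₁ p₀)
      (N₁ * 1 - (N₀ + N₁) * logistic p) p :=
    (((hasDerivAt_id p).const_mul N₁).sub
      ((hasDerivAt_softplus hp).const_mul (N₀ + N₁))).sub_const _
  refine h1.cexp.congr_deriv ?_
  have h2 := saddleCoord_mul_deriv h₀ hp
  rw [← add_mul_logisticDeriv hN₀ hN₁ he, mul_assoc, h2]
  linear_combination (-exp (phase N₀ N₁ p - phase N₀ N₁ p₀)) * add_mul_logistic hN₀ hN₁ he

/-- Laplace's method, with a uniform remainder, for a pole at a distance from the saddle point. -/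
theorem exists_laplace_remainder {k : Set ℂ} (hk : IsCompact k) {θ ρ : ℝ} (hρ : 0 < ρ)
    (hkθ : k ⊆ closedStrip (-θ) θ) (hθ : θ + 3 * ρ < Real.pi) :
    ∃ M, 0 ≤ M ∧ ∀ N₀ N₁ : ℂ, 1 ≤ N₀.re → 1 ≤ N₁.re → ∀ p₀ ∈ k, exp p₀ = N₁ / N₀ →
      ∀ b ∈ k, ρ ≤ ‖p₀ - b‖ →
      ‖(∫ x : ℝ, exp (phase N₀ N₁ (p₀ + x) - phase N₀ N₁ p₀) * kernelDiff p₀ b (p₀ + x)) -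
        kernelDiff p₀ b p₀ * (Real.sqrt Real.pi / saddleScale N₀ N₁)‖ ≤
      M / ‖N₀ * N₁ / (N₀ + N₁)‖ := by
  have hks : k ⊆ logStrip := hkθ.trans (closedStrip_subset_logStrip (by linarith) (by linarith))
  obtain ⟨M, hM0, hM⟩ := exists_deriv_laplaceFactor_le hk hρ hkθ hθ
  -- `8 = 4 · 2`: the weight on the saddle line is at most `4 e^{-|x|}`, whose integral is `8`.
  refine ⟨8 * M, by positivity, fun N₀ N₁ hN₀ hN₁ p₀ h₀ he b hb hbρ => ?_⟩
  obtain ⟨hQ', X, hQ⟩ := hM p₀ h₀ b hb hbρ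
  have hp0 : 0 < N₀.re := by linarith
  have hp1 : 0 < N₁.re := by linarith
  have h₀S := hks h₀
  have hbS := hks hb
  have hmem := fun x : ℝ => add_ofReal_mem_logStrip h₀S x
  have hN : 0 < (N₀ * N₁ / (N₀ + N₁) / 2).re := re_harmonic_pos hp0 hp1
  set A := N₀ * N₁ / (N₀ + N₁) with hA
  have hA0 : A ≠ 0 := fun h => by rw [h] at hN; simp at hN
  have dQ := differentiableOn_laplaceFactor h₀S hbS
  have dQ' := dQ.deriv isOpen_logStrip
  let w : ℝ → ℂ := fun x => exp (phase N₀ N₁ (p₀ + x) - phase N₀ N₁ p₀)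
  have hw : ∀ x, ‖w x‖ ≤ 4 * Real.exp (-1 * |x|) := fun x => by
    rw [neg_one_mul]; exact norm_exp_phase_sub_le hN₀ hN₁ h₀S he x
  have hwc : Continuous w := by
    refine continuous_exp.comp (Continuous.sub ?_ continuous_const)
    exact (differentiableOn_phase N₀ N₁).continuousOn.comp_continuous (by fun_prop) hmem
  have hQ'c : Continuous fun x : ℝ => deriv (laplaceFactor p₀ b) (p₀ + x) :=
    dQ'.continuousOn.comp_continuous (by fun_prop) hmem
  have hbd : ∀ x, ‖w x * deriv (laplaceFactor p₀ b) (p₀ + x)‖ ≤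
      4 * Real.exp (-1 * |x|) * M := fun x => by
    rw [norm_mul]; exact mul_le_mul (hw x) (hQ' x) (norm_nonneg _) (by positivity)
  have hbi : Integrable fun x : ℝ => 4 * Real.exp (-1 * |x|) * M :=
    ((integrable_exp_neg_mul_abs one_pos).const_mul 4).mul_const M
  have hi₁ : Integrable fun x => w x * deriv (laplaceFactor p₀ b) (p₀ + x) :=
    hbi.mono' (hwc.mul hQ'c).aestronglyMeasurable (Eventually.of_forall hbd)
  have hsing : ({p₀} : Set ℂ) ⊆ logStrip := singleton_subset_iff.2 h₀S
  obtain ⟨C₁, X₁, hT₁⟩ := exists_tail_bound_kernelDiff isCompact_singleton hsing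
    (isCompact_singleton (x := b)) (singleton_subset_iff.2 hbS)
  obtain ⟨C₂, X₂, -, -, hT₂⟩ := exists_tail_bound_deriv_saddleCoord isCompact_singleton hsing
  have hiR : Integrable fun x : ℝ => w x * kernelDiff p₀ b (p₀ + x) :=
    integrable_exp_phase_sub_mul hp0 hp1 h₀S (differentiableOn_kernelDiff h₀S hbS).continuousOn
      (hT₁ p₀ rfl b rfl)
  have hiu : Integrable fun x : ℝ => w x * deriv (saddleCoord p₀) (p₀ + x) :=
    integrable_exp_phase_sub_mul hp0 hp1 h₀S (differentiableOn_deriv_saddleCoord h₀S).continuousOn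
      (hT₂ p₀ rfl)
  have hi₂ : Integrable fun x : ℝ => w x * kernelDiff p₀ b (p₀ + x) -
      kernelDiff p₀ b p₀ * (w x * deriv (saddleCoord p₀) (p₀ + x)) :=
    hiR.sub (hiu.const_mul _)
  -- Integration by parts. Since `w' = -A u u' w` and `u u' Q = R - R(p₀) u'`, where `R` is the
  -- kernel difference and `Q` the quotient, integrating the derivative of `w Q` gives `A ∫ w (R -
  -- R(p₀) u') = ∫ w Q'`.
  have hder : ∀ x : ℝ, HasDerivAt (fun x : ℝ => w x * laplaceFactor p₀ b (p₀ + x))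
      (w x * deriv (laplaceFactor p₀ b) (p₀ + x) - A * (w x * kernelDiff p₀ b (p₀ + x) -
      kernelDiff p₀ b p₀ * (w x * deriv (saddleCoord p₀) (p₀ + x)))) x := fun x => by
    have h1 := (hasDerivAt_exp_phase_line hp0 hp1 h₀S he (hmem x)).mul
      (dQ.differentiableAt (isOpen_logStrip.mem_nhds (hmem x))).hasDerivAt
    have h2 := (h1.comp_const_add p₀ (x : ℂ)).comp_ofReal
    refine h2.congr_deriv ?_
    have h3 := laplaceFactor_mul (b := b) h₀S (hmem x)
    simp only [w]
    linear_combination -A * exp (phase N₀ N₁ (p₀ + x) - phase N₀ N₁ p₀) * h3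
  have hlim : ∀ l : Filter ℝ, Tendsto (fun x : ℝ => |x|) l atTop →
      Tendsto (fun x : ℝ => w x * laplaceFactor p₀ b (p₀ + x)) l (𝓝 0) := fun l hl => by
    have h1 : Tendsto (fun x : ℝ => 4 * Real.exp (-1 * |x|) * (M * ρ)) l (𝓝 0) := by
      have : Tendsto (fun x : ℝ => Real.exp (-1 * |x|)) l (𝓝 0) :=
        Real.tendsto_exp_atBot.comp (hl.const_mul_atTop_of_neg (by norm_num))
      simpa using (this.const_mul 4).mul_const (M * ρ)
    refine squeeze_zero_norm' ?_ h1
    filter_upwards [hl.eventually_ge_atTop X] with x hx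
    rw [norm_mul]
    exact mul_le_mul (hw x) (hQ x hx) (norm_nonneg _) (by positivity)
  have h0 := integral_of_hasDerivAt_of_tendsto hder (hi₁.sub (hi₂.const_mul A))
    (hlim _ tendsto_abs_atBot_atTop) (hlim _ tendsto_abs_atTop_atTop)
  rw [integral_sub hi₁ (hi₂.const_mul A), integral_const_mul, integral_sub hiR (hiu.const_mul _),
    integral_const_mul, sub_zero, sub_eq_zero] at h0
  have hg := integral_exp_phase_mul_deriv hN₀ hN₁ h₀S he
  rw [hg] at h0
  have hle : ‖∫ x, w x * deriv (laplaceFactor p₀ b) (p₀ + x)‖ ≤ 8 * M := by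
    refine (norm_integral_le_of_norm_le hbi (Eventually.of_forall hbd)).trans ?_
    rw [integral_mul_const, integral_const_mul]
    simp only [neg_one_mul]
    rw [integral_exp_neg_abs]; norm_num
  rw [le_div_iff₀ (norm_pos_iff.2 hA0), mul_comm, ← norm_mul, ← h0]
  exact hle

end

/-! ### The value at the saddle and the uniform bound for a pole near it. -/

noncomputable section

theorem deriv_dslope_self {f : ℂ → ℂ} {U : Set ℂ} (hU : IsOpen U) (hf : DifferentiableOn ℂ f U)
    {c : ℂ} (hc : c ∈ U) : deriv (dslope f c) c = deriv (deriv f) c / 2 := by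
  have hD := (differentiableOn_dslope (hU.mem_nhds hc)).2 hf
  have hDat := fun b (hb : b ∈ U) => (hD.differentiableAt (hU.mem_nhds hb)).hasDerivAt
  have h1 : ∀ b ∈ U, HasDerivAt f (dslope f c b + (b - c) * deriv (dslope f c) b) b := by
    intro b hb
    have h2 := (((hasDerivAt_id b).sub_const c).mul (hDat b hb)).const_add (f c)
    refine (h2.congr_of_eventuallyEq (Eventually.of_forall fun x => ?_)).congr_deriv (by simp)
    have := sub_smul_dslope f c x
    simp only [smul_eq_mul] at this
    simp only [Pi.mul_apply, id, this]; ring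
  have h3 : HasDerivAt (deriv f) (deriv (dslope f c) c + deriv (dslope f c) c) c := by
    have h4 := (hDat c hc).add (((hasDerivAt_id c).sub_const c).mul
      ((hD.deriv hU).differentiableAt (hU.mem_nhds hc)).hasDerivAt)
    refine (h4.congr_of_eventuallyEq ?_).congr_deriv (by simp)
    filter_upwards [hU.mem_nhds hc] with b hb
    rw [(h1 b hb).deriv]; rfl
  rw [h3.deriv]; ring

/-- The value at the saddle point of the kernel difference, as a holomorphic function of the
pole. -/
def saddleValue (p₀ : ℂ) : ℂ → ℂ :=
  dslope (fun b => 1 / dslope (saddleCoord p₀) p₀ b -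
    logistic p₀ * (1 + exp b) / dslope exp p₀ b) p₀

theorem differentiableOn_saddleValue {p₀ : ℂ} (h₀ : p₀ ∈ logStrip) :
    DifferentiableOn ℂ (saddleValue p₀) logStrip := by
  have hn := isOpen_logStrip.mem_nhds h₀
  refine (differentiableOn_dslope hn).2 (DifferentiableOn.sub ?_ ?_)
  · exact (differentiableOn_const _).div
      ((differentiableOn_dslope hn).2 (differentiableOn_saddleCoord h₀))
      fun p hp => dslope_saddleCoord_ne_zero h₀ hp h₀
  · exact DifferentiableOn.div (by fun_prop)
      ((differentiableOn_dslope hn).2 differentiable_exp.differentiableOn)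
      fun p hp => dslope_exp_ne_zero hp h₀

theorem saddleValue_eq {p₀ b : ℂ} (h₀ : p₀ ∈ logStrip) (hb : b ∈ logStrip) (h : b ≠ p₀) :
    saddleValue p₀ b = (1 + exp b) * (logistic p₀ / (exp p₀ - exp b)) +
      1 / saddleCoord p₀ b := by
  have h1 := one_add_exp_ne_zero h₀
  have h2 := exp_ne_zero p₀
  have h3 := sub_ne_zero.2 h
  have h4 := exp_sub_exp_ne_zero hb h₀ h
  have h4' := exp_sub_exp_ne_zero h₀ hb h.symm
  have h5 := saddleCoord_ne_zero h₀ hb h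
  have hz : 1 / dslope (saddleCoord p₀) p₀ p₀ -
      logistic p₀ * (1 + exp p₀) / dslope exp p₀ p₀ = 0 := by
    rw [dslope_same, dslope_same, Complex.deriv_exp, deriv_saddleCoord_self h₀, logistic]
    field_simp; ring
  rw [saddleValue, dslope_of_ne _ h, slope_def_field, hz, dslope_of_ne _ h, dslope_of_ne _ h,
    slope_def_field, slope_def_field, saddleCoord_self, ← neg_sub (exp b) (exp p₀)]
  field_simp
  ring

theorem saddleValue_eq_kernelDiff {p₀ b : ℂ} (h₀ : p₀ ∈ logStrip) (hb : b ∈ logStrip)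
    (h : b ≠ p₀) : saddleValue p₀ b = kernelDiff p₀ b p₀ := by
  rw [saddleValue_eq h₀ hb h, kernelDiff_of_ne h₀ hb h.symm, deriv_saddleCoord_self h₀,
    saddleCoord_self, zero_sub, div_neg, sub_neg_eq_add]

/-- The second Taylor coefficient of `u` at `p₀`. Dividing `saddleCoord_mul_deriv` by `b - p₀` gives
an identity between holomorphic functions, which is differentiated at `p₀`. -/
theorem deriv_dslope_saddleCoord {p₀ : ℂ} (h₀ : p₀ ∈ logStrip) :
    deriv (dslope (saddleCoord p₀) p₀) p₀ = (1 - exp p₀) / (6 * (1 + exp p₀)) := by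
  have hn := isOpen_logStrip.mem_nhds h₀
  have h1 := one_add_exp_ne_zero h₀
  have hs := exp_ne_zero p₀
  have hu := differentiableOn_saddleCoord h₀
  have hD := ((differentiableOn_dslope hn).2 hu).differentiableAt hn
  have hE := (((differentiableOn_dslope hn).2
    (differentiable_exp.differentiableOn (s := logStrip))).differentiableAt hn)
  have hu' := (differentiableOn_deriv_saddleCoord h₀).differentiableAt hn
  have hu'' : deriv (deriv (saddleCoord p₀)) p₀ = 2 * deriv (dslope (saddleCoord p₀) p₀) p₀ := by
    rw [deriv_dslope_self isOpen_logStrip hu h₀]; ring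
  have hE' : deriv (dslope exp p₀) p₀ = exp p₀ / 2 := by
    rw [deriv_dslope_self isOpen_univ differentiable_exp.differentiableOn (mem_univ p₀),
      Complex.deriv_exp, Complex.deriv_exp]
  have hl := (hD.hasDerivAt.mul hu'.hasDerivAt).const_mul (logisticDeriv p₀)
  have hr := hE.hasDerivAt.div
    (((hasDerivAt_exp p₀).const_add 1).mul_const (1 + exp p₀)) (mul_ne_zero h1 h1)
  have heq : (fun b => logisticDeriv p₀ * (dslope (saddleCoord p₀) p₀ b *
      deriv (saddleCoord p₀) b)) =ᶠ[𝓝 p₀]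
      fun b => dslope exp p₀ b / ((1 + exp b) * (1 + exp p₀)) := by
    filter_upwards [hn] with b hb
    by_cases h : b = p₀
    · rw [h, dslope_same, dslope_same, deriv_saddleCoord_self h₀, Complex.deriv_exp, logisticDeriv]
      field_simp
    · have h2 := saddleCoord_mul_deriv h₀ hb
      have h3 := sub_ne_zero.2 h
      have h4 := one_add_exp_ne_zero hb
      rw [logistic_sub_logistic hb h₀] at h2
      rw [dslope_of_ne _ h, dslope_of_ne _ h, slope_def_field, slope_def_field, saddleCoord_self,
        sub_zero, div_mul_eq_mul_div, ← mul_div_assoc, h2]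
      field_simp
  have key := (hl.congr_of_eventuallyEq heq.symm).unique hr
  rw [hu'', hE', dslope_same, dslope_same, Complex.deriv_exp, deriv_saddleCoord_self h₀,
    logisticDeriv] at key
  field_simp at key
  rw [eq_div_iff (mul_ne_zero (by norm_num) h1)]
  linear_combination key

theorem saddleValue_self {p₀ : ℂ} (h₀ : p₀ ∈ logStrip) :
    saddleValue p₀ p₀ = (1 - exp p₀) / (3 * (1 + exp p₀)) := by
  have hn := isOpen_logStrip.mem_nhds h₀
  have h1 := one_add_exp_ne_zero h₀
  have hs := exp_ne_zero p₀
  have hD := (((differentiableOn_dslope hn).2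
    (differentiableOn_saddleCoord h₀)).differentiableAt hn).hasDerivAt
  have hE := (((differentiableOn_dslope hn).2
    (differentiable_exp.differentiableOn (s := logStrip))).differentiableAt hn).hasDerivAt
  have hE' : deriv (dslope exp p₀) p₀ = exp p₀ / 2 := by
    rw [deriv_dslope_self isOpen_univ differentiable_exp.differentiableOn (mem_univ p₀),
      Complex.deriv_exp, Complex.deriv_exp]
  have hd := ((hasDerivAt_const p₀ (1 : ℂ)).div hD (dslope_saddleCoord_ne_zero h₀ h₀ h₀)).sub
    ((((hasDerivAt_exp p₀).const_add 1).const_mul (logistic p₀)).div hE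
      (dslope_exp_ne_zero h₀ h₀))
  rw [saddleValue, dslope_same]
  refine hd.deriv.trans ?_
  rw [deriv_dslope_saddleCoord h₀, hE', dslope_same, dslope_same, Complex.deriv_exp,
    deriv_saddleCoord_self h₀, logistic]
  field_simp
  ring

/-- The normalized error of the uniform asymptotic formula. -/
def uniformRemainder (N₀ N₁ p₀ b : ℂ) : ℂ :=
  exp (-phase N₀ N₁ p₀) * ((1 + exp b) * hypergeometricI N₀ N₁ (exp b)) -
    Real.pi * I * exp (phase N₀ N₁ b - phase N₀ N₁ p₀) *
      erfc (-I * (saddleScale N₀ N₁ * saddleCoord p₀ b)) -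
    saddleValue p₀ b * (Real.sqrt Real.pi / saddleScale N₀ N₁)

theorem differentiableOn_uniformRemainder {N₀ N₁ p₀ : ℂ} (hN₀ : 0 < N₀.re) (hN₁ : 0 < N₁.re)
    (h₀ : p₀ ∈ logStrip) : DifferentiableOn ℂ (uniformRemainder N₀ N₁ p₀) logStrip := by
  have hI : DifferentiableOn ℂ (fun b => hypergeometricI N₀ N₁ (exp b)) logStrip := by
    refine DifferentiableOn.const_mul ?_ _
    refine (isHypergeometricBranch_hypergeometricBranch hN₀ hN₁).1.comp (by fun_prop) fun b hb => ?_
    rw [mem_ofPred_eq, add_sub_cancel_left]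
    exact exp_mem_slitPlane_of_mem hb
  refine ((DifferentiableOn.mul (by fun_prop) hI).const_mul _).sub ?_ |>.sub
    ((differentiableOn_saddleValue h₀).mul_const _)
  refine DifferentiableOn.mul (DifferentiableOn.const_mul
    ((differentiableOn_phase N₀ N₁).sub_const _).cexp _) ?_
  exact differentiable_erfc.comp_differentiableOn
    (((differentiableOn_saddleCoord h₀).const_mul _).const_mul _)

/-- For `b` within `ρ` of the saddle, the remainder is holomorphic in `b` on the disc of radius `ρ`
about `p₀`, and its boundary circle is in the range of Laplace's method. The maximum principle gives
the same bound inside, so no expansion is needed where pole and saddle merge. -/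
theorem exists_uniformRemainder_le {k : Set ℂ} (hk : IsCompact k) {θ : ℝ}
    (hkθ : k ⊆ closedStrip (-θ) θ) (hθ : θ < Real.pi) :
    ∃ M, 0 ≤ M ∧ ∀ N₀ N₁ : ℂ, 1 ≤ N₀.re → 1 ≤ N₁.re → ∀ p₀ ∈ k, exp p₀ = N₁ / N₀ →
      ∀ b ∈ k, ‖uniformRemainder N₀ N₁ p₀ b‖ ≤ M / ‖N₀ * N₁ / (N₀ + N₁)‖ := by
  -- Thickening by `ρ` and then drawing circles of radius up to `3ρ` reaches height `θ + 4ρ`,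
  -- half-way between `θ` and `π`.
  set ρ := (Real.pi - θ) / 8 with hρdef
  have hρ : 0 < ρ := by rw [hρdef]; linarith
  have hkc : IsCompact (Metric.cthickening ρ k) := hk.cthickening
  have hkcθ : Metric.cthickening ρ k ⊆ closedStrip (-(θ + ρ)) (θ + ρ) := fun q hq => by
    rw [hk.cthickening_eq_biUnion_closedBall hρ.le] at hq
    simp only [mem_iUnion] at hq
    obtain ⟨p, hp, hpq⟩ := hq
    have h1 := (abs_im_le_norm (q - p)).trans (mem_closedBall_iff_norm.1 hpq)
    rw [sub_im, abs_le] at h1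
    have h3 := hkθ hp
    exact ⟨by linarith [h3.1, h1.1], by linarith [h3.2, h1.2]⟩
  obtain ⟨M, hM0, hM⟩ := exists_laplace_remainder hkc hρ hkcθ (by rw [hρdef]; linarith)
  have hS : Metric.cthickening ρ k ⊆ logStrip := hkcθ.trans
    (closedStrip_subset_logStrip (by rw [hρdef]; linarith) (by rw [hρdef]; linarith))
  have hsub : k ⊆ Metric.cthickening ρ k := Metric.self_subset_cthickening k
  refine ⟨M, hM0, fun N₀ N₁ hN₀ hN₁ p₀ h₀ he => ?_⟩
  have hfar : ∀ b ∈ Metric.cthickening ρ k, ρ ≤ ‖p₀ - b‖ →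
      ‖uniformRemainder N₀ N₁ p₀ b‖ ≤ M / ‖N₀ * N₁ / (N₀ + N₁)‖ := fun b hb hbρ => by
    have hne : b ≠ p₀ := fun h => by rw [h, sub_self, norm_zero] at hbρ; linarith
    have := hM N₀ N₁ hN₀ hN₁ p₀ (hsub h₀) he b hb hbρ
    rwa [uniformRemainder, hypergeometricI_sub_erfc hN₀ hN₁ (hS (hsub h₀)) he (hS hb),
      saddleValue_eq_kernelDiff (hS (hsub h₀)) (hS hb) hne]
  intro b hb
  rcases le_total ρ ‖p₀ - b‖ with h | h
  · exact hfar b (hsub hb) h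
  · have hball : Metric.closedBall p₀ ρ ⊆ Metric.cthickening ρ k :=
      Metric.closedBall_subset_cthickening h₀ ρ
    have hd : DiffContOnCl ℂ (uniformRemainder N₀ N₁ p₀) (Metric.ball p₀ ρ) :=
      DifferentiableOn.diffContOnCl ((differentiableOn_uniformRemainder (by linarith)
        (by linarith) (hS (hsub h₀))).mono
        (Metric.closure_ball_subset_closedBall.trans (hball.trans hS)))
    refine norm_le_of_forall_mem_frontier_norm_le Metric.isBounded_ball hd (fun z hz => ?_)
      (z := b) ?_
    · have hz' := Metric.frontier_ball_subset_sphere hz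
      refine hfar z (hball (Metric.sphere_subset_closedBall hz')) ?_
      rw [norm_sub_rev]
      exact (mem_sphere_iff_norm.1 hz').ge
    · rw [closure_ball _ hρ.ne', mem_closedBall_iff_norm, norm_sub_rev]
      exact h

end

/-! ### Translation back to `β`, `γ`, `g(0, β)` and the final estimate. -/

noncomputable section

variable {N₀ N₁ s β : ℂ}

theorem cpow_neg_half (z : ℂ) : z ^ (-(1 / 2) : ℂ) = (z ^ (1 / 2 : ℂ))⁻¹ := cpow_neg z _

theorem cpow_half_ne_zero {z : ℂ} (hz : z ≠ 0) : z ^ (1 / 2 : ℂ) ≠ 0 := by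
  simp [cpow_eq_zero_iff, hz]

theorem one_add_mul_gZero (hs : s ∈ slitPlane) (hβ : β ∈ slitPlane) :
    (1 + β) * gZero s β = (1 + s) ^ (1 / 2 : ℂ) * saddleValue (log s) (log β) := by
  have hs0 := slitPlane_ne_zero hs
  have h1s := slitPlane_ne_zero (one_add_mem_slitPlane hs)
  have h1β := slitPlane_ne_zero (one_add_mem_slitPlane hβ)
  have hr := cpow_half_ne_zero h1s
  have hr2 := cpow_half_sq (1 + s)
  rw [gZero]
  split_ifs with h
  · subst h
    have h3 : (1 + β) ^ (3 / 2 : ℂ) = (1 + β) * (1 + β) ^ (1 / 2 : ℂ) := by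
      rw [show (3 / 2 : ℂ) = 1 + 1 / 2 by norm_num, cpow_add _ _ h1s, cpow_one]
    rw [saddleValue_self (log_mem_logStrip hs), exp_log hs0, h3]
    generalize (1 + β) ^ (1 / 2 : ℂ) = r at *
    field_simp
    linear_combination (β - 1) * hr2
  · have hne : log β ≠ log s := fun e => h <| by
      rw [← exp_log (slitPlane_ne_zero hβ), e, exp_log hs0]
    have hsβ : s - β ≠ 0 := sub_ne_zero.2 (Ne.symm h)
    have hu : saddleCoord (log s) (log β) ≠ 0 :=
      saddleCoord_ne_zero (log_mem_logStrip hs) (log_mem_logStrip hβ) hne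
    rw [saddleValue_eq (log_mem_logStrip hs) (log_mem_logStrip hβ) hne,
      gammaBranch_eq hs hβ, cpow_neg_half, logistic, exp_log hs0, exp_log (slitPlane_ne_zero hβ)]
    have e1 : 1 - β / s = (s - β) / s := by field_simp
    rw [e1]
    generalize (1 + s) ^ (1 / 2 : ℂ) = r at *
    rw [← hr2]
    have h1s' := h1s
    rw [← hr2] at h1s'
    field_simp
    ring

theorem two_pi_div_cpow_half (hN₁ : 0 < N₁.re) :
    (2 * (Real.pi : ℂ) / N₁) ^ (1 / 2 : ℂ) = Real.sqrt Real.pi / (N₁ / 2) ^ (1 / 2 : ℂ) := by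
  have n1 := ne_zero_of_re_pos' hN₁
  have h2 : (0 : ℝ) < (2 : ℂ).re := by norm_num
  have hp : (0 : ℝ) < ((2 * Real.pi : ℝ) : ℂ).re := by rw [ofReal_re]; positivity
  have hn0 : (2 * (Real.pi : ℂ) / N₁) ≠ 0 :=
    div_ne_zero (mul_ne_zero two_ne_zero (ofReal_ne_zero.2 Real.pi_ne_zero)) n1
  have hm0 : N₁ / 2 ≠ 0 := div_ne_zero n1 two_ne_zero
  rw [eq_div_iff (cpow_half_ne_zero hm0), cpow_def_of_ne_zero hn0, cpow_def_of_ne_zero hm0,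
    ← exp_add]
  have hl : log (2 * (Real.pi : ℂ) / N₁) = log ((2 * Real.pi : ℝ) : ℂ) - log N₁ := by
    rw [← log_div_of_re_pos hp hN₁]; push_cast; rfl
  rw [hl, log_div_of_re_pos hN₁ h2, ← ofReal_ofNat 2, ← ofReal_log (by positivity),
    ← ofReal_log (by positivity), Real.log_mul (by norm_num) Real.pi_ne_zero,
    Real.sqrt_eq_rpow, Real.rpow_def_of_pos Real.pi_pos, ofReal_exp]
  congr 1
  push_cast
  ring

theorem saddleFactor_eq (hN₀ : 0 < N₀.re) (hN₁ : 0 < N₁.re) :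
    saddleFactor N₀ N₁ =
      exp (phase N₀ N₁ (log (N₁ / N₀))) * (2 * (Real.pi : ℂ) / N₁) ^ (1 / 2 : ℂ) := by
  have n0 := ne_zero_of_re_pos' hN₀
  have n1 := ne_zero_of_re_pos' hN₁
  have hN : 0 < (N₀ + N₁).re := by rw [add_re]; linarith
  have n2 := ne_zero_of_re_pos' hN
  have hsum : 1 + N₁ / N₀ = (N₀ + N₁) / N₀ := by field_simp
  rw [saddleFactor, phase, softplus, exp_log (div_ne_zero n1 n0), hsum,
    log_div_of_re_pos hN₁ hN₀, log_div_of_re_pos hN hN₀, cpow_def_of_ne_zero n0,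
    cpow_def_of_ne_zero n1, cpow_def_of_ne_zero n2, ← exp_add, ← exp_sub]
  congr 2
  ring

theorem erfcTerm_eq (hN₀ : 0 < N₀.re) (hN₁ : 0 < N₁.re) (hβ : β ∈ slitPlane) :
    erfcTerm N₀ N₁ β = exp (phase N₀ N₁ (log β)) / (1 + β) *
      (Real.pi * I *
        erfc (-I * (saddleScale N₀ N₁ * saddleCoord (log (N₁ / N₀)) (log β)))) := by
  have hβ0 := slitPlane_ne_zero hβ
  have h1β := slitPlane_ne_zero (one_add_mem_slitPlane hβ)
  have harg : gammaBranch (N₁ / N₀) β * (N₁ / 2) ^ (1 / 2 : ℂ) =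
      -I * (saddleScale N₀ N₁ * saddleCoord (log (N₁ / N₀)) (log β)) := by
    rw [gammaBranch_eq (div_mem_slitPlane_of_re_pos hN₁ hN₀) hβ, saddleScale_eq hN₀ hN₁]
    ring
  rw [erfcTerm, harg, phase, softplus, exp_log hβ0, exp_sub, cpow_add _ _ h1β, cpow_one,
    cpow_def_of_ne_zero hβ0, cpow_def_of_ne_zero h1β, mul_comm (log β),
    mul_comm (log (1 + β)), div_div]

/-- An exact identity: the whole error is the normalized remainder, already bounded, times factors
that are compared with `saddleFactor`. -/
theorem hypergeometricI_sub_asymptotic (hN₀ : 0 < N₀.re) (hN₁ : 0 < N₁.re)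
    (hβ : β ∈ slitPlane) :
    hypergeometricI N₀ N₁ β -
        (erfcTerm N₀ N₁ β + gZero (N₁ / N₀) β * saddleFactor N₀ N₁) =
      exp (phase N₀ N₁ (log (N₁ / N₀))) / (1 + β) *
        uniformRemainder N₀ N₁ (log (N₁ / N₀)) (log β) := by
  have hs := div_mem_slitPlane_of_re_pos hN₁ hN₀
  have h1s := slitPlane_ne_zero (one_add_mem_slitPlane hs)
  have h1β := slitPlane_ne_zero (one_add_mem_slitPlane hβ)
  have hg : gZero (N₁ / N₀) β =
      (1 + N₁ / N₀) ^ (1 / 2 : ℂ) * saddleValue (log (N₁ / N₀)) (log β) / (1 + β) := by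
    rw [← one_add_mul_gZero hs hβ, mul_div_cancel_left₀ _ h1β]
  have hm := cpow_half_ne_zero (div_ne_zero (ne_zero_of_re_pos' hN₁) two_ne_zero)
  have hr := cpow_half_ne_zero h1s
  rw [hg, erfcTerm_eq hN₀ hN₁ hβ, saddleFactor_eq hN₀ hN₁, two_pi_div_cpow_half hN₁,
    uniformRemainder, exp_log (slitPlane_ne_zero hβ), saddleScale_eq hN₀ hN₁, cpow_neg_half,
    exp_sub, exp_neg]
  have he := exp_ne_zero (phase N₀ N₁ (log (N₁ / N₀)))
  field_simp
  ring

theorem log_mem_annularStrip {K θ : ℝ} {z : ℂ} (hK : 0 < K) (h1 : K⁻¹ ≤ ‖z‖) (h2 : ‖z‖ ≤ K)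
    (h3 : |z.arg| ≤ θ) : log z ∈ closedStrip (-θ) θ ∩ {p | |p.re| ≤ Real.log K} := by
  have hz : 0 < ‖z‖ := (inv_pos.2 hK).trans_le h1
  refine ⟨?_, ?_⟩
  · have := abs_le.1 h3
    exact ⟨by rw [log_im]; exact this.1, by rw [log_im]; exact this.2⟩
  · rw [mem_ofPred_eq, log_re, abs_le, ← Real.log_inv]
    exact ⟨Real.log_le_log (inv_pos.2 hK) h1, Real.log_le_log hz h2⟩

theorem mem_slitPlane_of_abs_arg_lt {z : ℂ} (h0 : z ≠ 0) (h : |z.arg| < Real.pi) :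
    z ∈ slitPlane :=
  mem_slitPlane_iff_arg.2 ⟨fun e => by rw [e, abs_of_pos Real.pi_pos] at h; exact h.false, h0⟩

theorem norm_inv_harmonic_le (hN₀ : 0 < N₀.re) (hN₁ : 0 < N₁.re) {K : ℝ} (hK : ‖N₁ / N₀‖ ≤ K) :
    ‖N₀ * N₁ / (N₀ + N₁)‖⁻¹ ≤ (1 + K) / ‖N₁‖ := by
  have n0 := ne_zero_of_re_pos' hN₀
  have n1 := ne_zero_of_re_pos' hN₁
  rw [← norm_inv, show (N₀ * N₁ / (N₀ + N₁))⁻¹ = (1 + N₁ / N₀) / N₁ by field_simp, norm_div]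
  gcongr
  exact (norm_add_le _ _).trans (by rw [norm_one]; gcongr)

theorem inv_sqrt_norm_le (hN₁ : 0 < N₁.re) :
    (Real.sqrt ‖N₁‖)⁻¹ ≤ ‖(2 * (Real.pi : ℂ) / N₁) ^ (1 / 2 : ℂ)‖ := by
  have hn : 0 < ‖N₁‖ := norm_pos_iff.2 (ne_zero_of_re_pos' hN₁)
  rw [← Real.sqrt_inv, Real.sqrt_le_left (norm_nonneg _), ← norm_pow, cpow_half_sq, norm_div, norm_mul, norm_real, Real.norm_of_nonneg
    Real.pi_pos.le, inv_eq_one_div]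
  gcongr
  norm_num
  linarith [Real.pi_gt_three]

theorem exists_hypergeometricI_asymptotic {δ K ε : ℝ} (hδ : 0 < δ) (hK : 0 < K) (hε : 0 < ε) :
    ∃ R > (0 : ℝ), ∀ N₀ N₁ β : ℂ, R ≤ N₀.re → R ≤ N₁.re →
      K⁻¹ ≤ ‖N₁ / N₀‖ → ‖N₁ / N₀‖ ≤ K → |(N₁ / N₀).arg| ≤ Real.pi - δ →
      K⁻¹ ≤ ‖β‖ → ‖β‖ ≤ K → |β.arg| ≤ Real.pi - δ →
      ‖hypergeometricI N₀ N₁ β -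
          (erfcTerm N₀ N₁ β + gZero (N₁ / N₀) β * saddleFactor N₀ N₁)‖
        ≤ ε * ‖saddleFactor N₀ N₁‖ := by
  have hθ : Real.pi - δ < Real.pi := by linarith
  have hk := isCompact_closedStrip_inter (-(Real.pi - δ)) (Real.pi - δ) (Real.log K)
  have hstrip : closedStrip (-(Real.pi - δ)) (Real.pi - δ) ⊆ logStrip :=
    closedStrip_subset_logStrip (by linarith) (by linarith)
  obtain ⟨M, hM0, hM⟩ := exists_uniformRemainder_le hk inter_subset_left hθ
  obtain ⟨c, hc, hcb⟩ := hk.exists_norm_ge (f := fun b => 1 + exp b) (by fun_prop)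
    (fun b hb => one_add_exp_ne_zero (hstrip hb.1))
  -- The relative error is at most `ε D / ‖N₁‖` against `ε ‖N₁‖^{-1/2}`, so `‖N₁‖ ≥ D²` suffices.
  -- Here `c` bounds `|1 + β|` from below and `1 + K` bounds `‖1 + s^*‖`; the lower bound `1` on `R`
  -- is needed for the saddle line estimate.
  set D := M * (1 + K) / (c * ε) with hD
  refine ⟨max 1 (D ^ 2), by positivity, fun N₀ N₁ β h0 h1 hs1 hs2 hs3 hβ1 hβ2 hβ3 => ?_⟩
  have h0' := (le_max_left _ _).trans h0
  have h1' := (le_max_left _ _).trans h1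
  have hN₀ : 0 < N₀.re := by linarith
  have hN₁ : 0 < N₁.re := by linarith
  have hβ0 : β ≠ 0 := norm_pos_iff.1 ((inv_pos.2 hK).trans_le hβ1)
  have hβ := mem_slitPlane_of_abs_arg_lt hβ0 (hβ3.trans_lt hθ)
  have hs0 := slitPlane_ne_zero (div_mem_slitPlane_of_re_pos hN₁ hN₀)
  have hrem := hM N₀ N₁ h0' h1' _ (log_mem_annularStrip hK hs1 hs2 hs3) (exp_log hs0) _
    (log_mem_annularStrip hK hβ1 hβ2 hβ3)
  have hcβ := hcb _ (log_mem_annularStrip hK hβ1 hβ2 hβ3)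
  rw [exp_log hβ0] at hcβ
  have hn : 0 < ‖N₁‖ := norm_pos_iff.2 (ne_zero_of_re_pos' hN₁)
  have hDn : D ≤ Real.sqrt ‖N₁‖ :=
    Real.le_sqrt_of_sq_le (((le_max_right _ _).trans h1).trans (re_le_norm N₁))
  have hsq := Real.mul_self_sqrt hn.le
  have hsp := Real.sqrt_pos.2 hn
  rw [hypergeometricI_sub_asymptotic hN₀ hN₁ hβ, saddleFactor_eq hN₀ hN₁, norm_mul, norm_div,
    norm_mul, div_mul_eq_mul_div, mul_div_assoc, mul_left_comm]
  refine mul_le_mul_of_nonneg_left ?_ (norm_nonneg _)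
  calc ‖uniformRemainder N₀ N₁ (log (N₁ / N₀)) (log β)‖ / ‖1 + β‖
      ≤ M * ((1 + K) / ‖N₁‖) / c := by
        gcongr
        exact hrem.trans (by
          rw [div_eq_mul_inv]
          exact mul_le_mul_of_nonneg_left (norm_inv_harmonic_le hN₀ hN₁ hs2) hM0)
    _ = ε * (D / ‖N₁‖) := by rw [hD]; field_simp
    _ ≤ ε * (Real.sqrt ‖N₁‖)⁻¹ := by
        gcongr
        rw [div_le_iff₀ hn]
        nth_rewrite 2 [← hsq]
        rwa [inv_mul_cancel_left₀ hsp.ne']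
    _ ≤ _ := mul_le_mul_of_nonneg_left (inv_sqrt_norm_le hN₁) hε.le

end

theorem mainTheorem4 :
    -- the branch of the hypergeometric function in the definition of `I(β)` exists
    (∀ N₀ N₁ : ℂ, 0 < N₀.re → 0 < N₁.re →
      IsHypergeometricBranch 1 (N₀ + 1) (N₀ + N₁ + 2)
        (hypergeometricBranch 1 (N₀ + 1) (N₀ + N₁ + 2))) ∧
    -- the analytic branch `γ` exists
    (∀ s ∈ Complex.slitPlane, IsGammaBranch s (gammaBranch s)) ∧
    -- the asymptotic formula, uniformly in `β` and `s^* = N₁ / N₀`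
    (∀ δ > (0 : ℝ), ∀ K > (0 : ℝ), ∀ ε > (0 : ℝ), ∃ R > (0 : ℝ), ∀ N₀ N₁ β : ℂ,
      R ≤ N₀.re → R ≤ N₁.re →
      K⁻¹ ≤ ‖N₁ / N₀‖ → ‖N₁ / N₀‖ ≤ K → |(N₁ / N₀).arg| ≤ Real.pi - δ →
      K⁻¹ ≤ ‖β‖ → ‖β‖ ≤ K → |β.arg| ≤ Real.pi - δ →
      ‖hypergeometricI N₀ N₁ β -
          (erfcTerm N₀ N₁ β + gZero (N₁ / N₀) β * saddleFactor N₀ N₁)‖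
        ≤ ε * ‖saddleFactor N₀ N₁‖) :=
  ⟨fun _ _ => isHypergeometricBranch_hypergeometricBranch,
    fun _ => isGammaBranch_gammaBranch,
    fun _ hδ _ hK _ hε => exists_hypergeometricI_asymptotic hδ hK hε⟩
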